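/- Let $\mathfrak L := (\mathbb Q; <, 1, (c\,\cdot)_{c\in\mathbb Q})$ be the structure on the rational numbers with the strict order $<$, the constant $1$, and, for every $c \in \mathbb Q$, the unary function $x \mapsto c x$. A relation $R \subseteq \mathbb Q^n$ is called \emph{piecewise linear homogeneous (PLH)} if it is first-order definable (without parameters) over $\mathfrak L$. It is \emph{preserved by} $\max$ (max-closed) if for all $x, y \in R$ the componentwise maximum $(\max(x_1,y_1),\dots,\max(x_n,y_n))$ is in $R$. Let $\tau$ be a finite set of relation symbols, each $r \in \tau$ with an arity $\mathrm{ar}(r) \in \mathbb N$, and for each $r \in \tau$ let $R_r \subseteq \mathbb Q^{\mathrm{ar}(r)}$. The constraint satisfaction problem of $(\mathbb Q; (R_r)_{r \in \tau})$ is the following decision problem. An instance consists of a finite set of variables $V$ and a finite list of constraints $r(v_1,\dots,v_{\mathrm{ar}(r)})$ with $r \in \tau$ and $v_1,\dots,v_{\mathrm{ar}(r)} \in V$ (variables may be repeated). The question is whether there is a map $\alpha : V \to \mathbb Q$ such that $(\alpha(v_1),\dots,\alpha(v_{\mathrm{ar}(r)})) \in R_r$ for every constraint $r(v_1,\dots,v_{\mathrm{ar}(r)})$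 of the instance. \textbf{Theorem.} If every relation $R_r$, $r \in \tau$, is PLH and preserved by $\max$, then the constraint satisfaction problem of $(\mathbb Q; (R_r)_{r\in\tau})$ is solvable in polynomial time: there are a multi-tape Turing machine and a polynomial $p$ such that on every instance, written with one letter for each relation symbol and with variables numbered and written in binary, the machine answers correctly within $p(\ell)$ steps, where $\ell$ is the length of the written instance. (The template $(\mathbb Q; (R_r)_{r\in\tau})$ is fixed; it is not part of the input.) -/

import Mathlib

/-! ### The structure `(ℚ; <, 1, (c·)_{c ∈ ℚ})` and piecewise linear homogeneous relations -/

namespace PLH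

/-- Function symbols: the constant `1`, and for every rational `c` the unary symbol `c·`. -/
inductive Functions : ℕ → Type
  | one : Functions 0
  | scale (c : ℚ) : Functions 1

/-- Relation symbols: the binary symbol `<`. -/
inductive Relations : ℕ → Type
  | lt : Relations 2

/-- The signature `{<, 1} ∪ {c·}_{c ∈ ℚ}`. -/
def language : FirstOrder.Language := ⟨Functions, Relations⟩

/-- The structure `(ℚ; <, 1, (c·)_{c ∈ ℚ})`. -/
instance structureRat : language.Structure ℚ where
  funMap {_} f x :=
    match f, x with
    | Functions.one, _ => 1
    | Functions.scale c, x => c * x 0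
  RelMap {_} r x :=
    match r, x with
    | Relations.lt, x => x 0 < x 1

/-- A relation on `ℚ` is piecewise linear homogeneous if it is first-order definable (without
parameters) over `(ℚ; <, 1, (c·)_{c ∈ ℚ})`. -/
def IsPLH {n : ℕ} (R : Set (Fin n → ℚ)) : Prop :=
  Set.Definable ∅ language R

/-- `R` is preserved by the binary operation `max`, applied componentwise. -/
def MaxClosed {n : ℕ} (R : Set (Fin n → ℚ)) : Prop :=
  ∀ x ∈ R, ∀ y ∈ R, (fun j => max (x j) (y j)) ∈ R

end PLH

/-! ### Constraint satisfaction problems -/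

namespace CSP

/-- An instance over a relational signature `τ` with arities `ar`: a finite set of variables
`{0, …, numVars - 1}` and a finite list of constraints, each of them a relation symbol applied to
a tuple of variables (with repetitions allowed). -/
structure Instance {τ : Type} (ar : τ → ℕ) where
  numVars : ℕ
  constraints : List (Σ r : τ, Fin (ar r) → Fin numVars)

/-- The instance has a solution over the structure with domain `D` in which every symbol `r` is
interpreted by the relation `R r`. -/
def Instance.Feasible {τ D : Type} {ar : τ → ℕ} (R : (r : τ) → Set (Fin (ar r) → D))
    (I : Instance ar) : Prop :=
  ∃ α : Fin I.numVars → D, ∀ c ∈ I.constraints, (fun j => α (c.2 j)) ∈ R c.1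

/-- The input alphabet: one letter for each relation symbol, the two bits and a separator. -/
inductive Letter (τ : Type) : Type
  | rel (r : τ)
  | bit (b : Bool)
  | comma

/-- Natural numbers in binary. -/
def encodeNat (τ : Type) (n : ℕ) : List (Letter τ) :=
  (Computability.encodeNat n).map Letter.bit

/-- A constraint is written as its relation symbol, followed by the indices of its variables in
binary, each of them preceded by a separator. -/
def encodeConstraint {τ : Type} {ar : τ → ℕ} {n : ℕ}
    (c : Σ r : τ, Fin (ar r) → Fin n) : List (Letter τ) :=
  Letter.rel c.1 ::
    (List.ofFn c.2).flatMap (fun v : Fin n => Letter.comma :: encodeNat τ v.val)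

/-- An instance is written as the number of its variables in binary, followed by its
constraints. -/
def Instance.encode {τ : Type} {ar : τ → ℕ} (I : Instance ar) : List (Letter τ) :=
  encodeNat τ I.numVars ++ I.constraints.flatMap encodeConstraint

end CSP

/-! ### Polynomial time -/

/-- The decision problem `P`, with inputs written as words by `enc`, is solvable in polynomial
time: some multi-stack Turing machine with finitely many states and finite alphabets answers it
correctly on every input, in a number of steps polynomial in the length of the encoded input. -/
def PolyTimeDecidable {α A : Type} (enc : α → List A) (P : α → Prop) : Prop :=
  ∃ f : α → Bool, (∀ a, f a = true ↔ P a) ∧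
    ∃ M : Turing.TM2ComputableInPolyTime enc Computability.encodeBool f,
      ∀ k, Finite (M.tm.Γ k)

/-! Membership in a PLH relation depends only on the outcomes of finitely many comparisons of `x i`
with `c * x j`, where the constant `1` counts as one more coordinate. This is quantifier elimination
by back and forth: in a dense order without endpoints, a new point on one side can be matched by a
point that cuts finitely many given points in the same way (`exists_extension`,
`exists_realize_iff`). All the absolute values of nonzero coefficients of the template lie in one
finite set `G` of positive rationals that contains `1` and is closed under inverses.

Over a finite domain, arc consistency decides a max-closed problem: delete a value of a variable if
some constraint has no tuple of remaining values that supports it. If every variable in a constraint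
keeps a value, then the largest remaining values form a solution, because the maximum of the
supporting tuples is the tuple of largest values (`MaxClosed.exists_mem`,
`exists_solution_of_closed`).

The domain is infinite, but a sample depending on the size of the instance suffices. The absolute
values of the nonzero numbers of a solution satisfy inequalities `α i ≤ c * α j`, some of them
strict. Require a factor `δ > 1` close to `1` in the strict ones, start with the unknown that stands
for `1`, and scale the remaining unknowns together until an inequality between a settled and an
unsettled unknown becomes tight. One unknown after the other thereby becomes a monomial in `G` times
a power of `δ`, with exponents bounded by the number of unknowns (`Settled.exists_insert`,
`exists_monomial_solution`). Since `G` is fixed, there are only polynomially many such values with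
signs. They are represented by codes: a sign, an exponent of `δ` and exponents of the elements of
`G`. For `δ` close enough to `1` comparison is lexicographic, first by the monomials and then by the
power of `δ`, so no concrete `δ` is ever computed (`cmp_value`, `memCode_iff`). Pruning codes is
therefore sound and complete (`prune_correct`).

For the time bound, let `N` be a constant multiple of `ℓ + 1`. Positions in the input and components
of codes are numbers below `N`, and the set of removed codes is a table of tuples of fixed length.
One round of pruning is first-order definable from two further tables: which positions are followed
by the same variable name, and the binary digits of the products of powers of numerators and
denominators. These integers have at most `N` digits, and their digits are computed by school
multiplication. Hence the whole algorithm consists of first-order assignments to tables and of loops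
with `N` iterations. Such programs are compiled to a loop language on stacks of bits
(`stores_ofTabProg`), and this to a machine (`runs_code`); as the nesting of the loops is fixed, the
running time is polynomial. -/

/-! ### A loop language on stacks of bits -/

/-- Programs over stacks of bits indexed by `K`; `rep p` runs `p` a number of times that is fixed
in advance. -/
inductive LoopProg (K : Type) : Type
  | skip
  | push (k : K) (b : Bool)
  | pop (k : K)
  | mov (k k' : K)
  | ite (k : K) (p q : LoopProg K)
  | seq (p q : LoopProg K)
  | rep (p : LoopProg K)

namespace LoopProg

open Function

set_option linter.unusedSectionVars false

variable {K : Type} [DecidableEq K]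

/-- Transport of the top of the stack `k` to the stack `k'`. -/
def move (k k' : K) (s : K → List Bool) : K → List Bool :=
  match s k with
  | [] => s
  | b :: l => update (update s k l) k' (b :: update s k l k')

/-- The effect of a program on the stacks, if loops are run `N` times. -/
def den (N : ℕ) : LoopProg K → (K → List Bool) → (K → List Bool)
  | skip, s => s
  | push k b, s => update s k (b :: s k)
  | pop k, s => update s k (s k).tail
  | mov k k', s => move k k' s
  | ite k p q, s => if (s k).head? = some true then den N p s else den N q s
  | seq p q, s => den N q (den N p s)
  | rep p, s => (den N p)^[N] s

/-- The nesting depth of loops, where every loop counts twice. -/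
def depth : LoopProg K → ℕ
  | ite _ p q => max p.depth q.depth
  | seq p q => max p.depth q.depth
  | rep p => p.depth + 2
  | _ => 0

/-- An upper bound for the running time of a program, if loops are run `N` times. -/
def cost (N : ℕ) : LoopProg K → ℕ
  | ite _ p q => 1 + (cost N p + cost N q)
  | seq p q => cost N p + cost N q
  | rep p => N * (cost N p + 1) + 2 * N + 3
  | _ => 1

theorem exists_polynomial_cost (p : LoopProg K) :
    ∃ P : Polynomial ℕ, ∀ N, P.eval N = p.cost N := by
  induction p with
  | ite k p q hp hq =>
    obtain ⟨P, hP⟩ := hp; obtain ⟨Q, hQ⟩ := hq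
    exact ⟨1 + (P + Q), fun N => by simp [cost, hP, hQ]⟩
  | seq p q hp hq =>
    obtain ⟨P, hP⟩ := hp; obtain ⟨Q, hQ⟩ := hq
    exact ⟨P + Q, fun N => by simp [cost, hP, hQ]⟩
  | rep p hp =>
    obtain ⟨P, hP⟩ := hp
    exact ⟨Polynomial.X * (P + 1) + 2 * Polynomial.X + 3, fun N => by simp [cost, hP]⟩
  | _ => exact ⟨1, fun N => by simp [cost]⟩

/-- An elementary instruction lengthens a stack by at most one symbol. The bound limits the time
needed to empty the stacks at the end of the computation. -/
theorem length_den_le (N : ℕ) (p : LoopProg K) :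
    ∀ (s : K → List Bool) (m : ℕ), (∀ k, (s k).length ≤ m) →
      ∀ k, (den N p s k).length ≤ m + p.cost N := by
  induction p with
  | skip => intro s m h k; exact (h k).trans (by simp)
  | push k' b =>
    intro s m h k
    by_cases hk : k = k'
    · subst hk; simpa [den, cost] using h k
    · simpa [den, cost, hk] using (h k).trans (by simp)
  | pop k' =>
    intro s m h k
    by_cases hk : k = k'
    · subst hk; simp only [den, update_self, List.length_tail, cost]; have := h k; omega
    · simpa [den, cost, hk] using (h k).trans (by simp)
  | mov k₁ k₂ =>
    intro s m h k
    simp only [den, cost, move]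
    rcases hl : s k₁ with _ | ⟨b, l⟩
    · exact (h k).trans (by simp)
    · have h1 := h k₁
      rw [hl] at h1
      simp only
      have h2 : ∀ j, (update s k₁ l j).length ≤ m := by
        intro j
        by_cases hj : j = k₁
        · subst hj; simp at h1 ⊢; omega
        · simpa [hj] using h j
      by_cases hk : k = k₂
      · subst hk; simpa using h2 k
      · rw [update_of_ne hk]; exact (h2 k).trans (by simp)
  | ite k' p q hp hq =>
    intro s m h k
    simp only [den, cost]
    split
    · exact (hp s m h k).trans (by omega)
    · exact (hq s m h k).trans (by omega)
  | seq p q hp hq =>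
    intro s m h k
    simp only [den, cost]
    exact (hq _ _ (hp s m h) k).trans (by omega)
  | rep p hp =>
    intro s m h
    have key : ∀ n k, ((den N p)^[n] s k).length ≤ m + n * p.cost N := by
      intro n
      induction n with
      | zero => simpa using h
      | succ n ih =>
        intro k
        rw [iterate_succ_apply']
        refine (hp _ _ ih k).trans ?_
        rw [Nat.succ_mul]; omega
    intro k
    refine (key N k).trans ?_
    simp only [cost, Nat.mul_add]; omega

/-- The stacks of the machine that runs a program: an input stack, a stack that holds as many
symbols as loops have iterations, the stacks of the program and loop counters. -/
inductive Stk (K C : Type) : Type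
  | inp
  | tick
  | usr (k : K)
  | ctr (i : C)

/-- The alphabets of the stacks. -/
abbrev Alph (A K C : Type) : Stk K C → Type
  | .inp => A
  | .tick => Bool
  | .usr _ => Bool
  | .ctr _ => Bool

instance {K C : Type} [Fintype K] [Fintype C] : Finite (Stk K C) :=
  Finite.of_injective
    (fun x : Stk K C => match x with
      | .inp => (Sum.inl false : Bool ⊕ K ⊕ C)
      | .tick => Sum.inl true
      | .usr k => Sum.inr (Sum.inl k)
      | .ctr i => Sum.inr (Sum.inr i))
    (by intro x y h; cases x <;> cases y <;> simp_all)

/-! ### Compilation of loop programs to machine code -/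

section Machine

variable {A C Λ : Type} [DecidableEq (Stk K C)]

/-- The contents of all stacks of the machine. -/
def conts (w : List A) (t : List Bool) (u : K → List Bool) (c : C → List Bool) :
    ∀ k : Stk K C, List (Alph A K C k)
  | .inp => w
  | .tick => t
  | .usr k => u k
  | .ctr i => c i

theorem update_inp (w w' : List A) (t : List Bool) (u : K → List Bool) (c : C → List Bool) :
    update (conts w t u c) .inp w' = conts w' t u c := by
  funext k; cases k <;> simp [conts, update]

theorem update_tick (w : List A) (t t' : List Bool) (u : K → List Bool) (c : C → List Bool) :
    update (conts w t u c) .tick t' = conts w t' u c := by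
  funext k; cases k <;> simp [conts, update]

theorem update_usr (w : List A) (t : List Bool) (u : K → List Bool) (c : C → List Bool) (j : K)
    (l : List Bool) :
    update (conts w t u c) (.usr j) l = conts w t (update u j l) c := by
  funext k
  cases k with
  | usr k =>
    by_cases h : k = j
    · subst h; simp [conts]
    · simp [conts, h]
  | _ => simp [conts, update]

theorem update_ctr [DecidableEq C] (w : List A) (t : List Bool) (u : K → List Bool)
    (c : C → List Bool) (j : C) (l : List Bool) :
    update (conts w t u c) (.ctr j) l = conts w t u (update c j l) := by
  funext k
  cases k with
  | ctr k =>
    by_cases h : k = j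
    · subst h; simp [conts]
    · simp [conts, h]
  | _ => simp [conts, update]

/-- The internal states of the machine. -/
abbrev Mem (A : Type) : Type := Option A × Option Bool × Bool

/-- The initial internal state. -/
abbrev mem₀ {A : Type} : Mem A := (none, none, false)

/-- The labels of the machine code of a program. -/
inductive Lab : LoopProg K → Type
  | skip : Lab skip
  | push {k : K} {b : Bool} : Lab (push k b)
  | pop {k : K} : Lab (pop k)
  | mov {k k' : K} : Lab (mov k k')
  | test {k : K} {p q : LoopProg K} : Lab (ite k p q)
  | pos {k : K} {p q : LoopProg K} (l : Lab p) : Lab (ite k p q)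
  | neg {k : K} {p q : LoopProg K} (l : Lab q) : Lab (ite k p q)
  | fst {p q : LoopProg K} (l : Lab p) : Lab (seq p q)
  | snd {p q : LoopProg K} (l : Lab q) : Lab (seq p q)
  | copy {p : LoopProg K} : Lab (rep p)
  | restore {p : LoopProg K} : Lab (rep p)
  | loop {p : LoopProg K} : Lab (rep p)
  | body {p : LoopProg K} (l : Lab p) : Lab (rep p)

theorem finite_lab (p : LoopProg K) : Finite (Lab p) := by
  induction p with
  | ite k p q hp hq =>
    refine Finite.of_surjective (fun x : Option (Lab p ⊕ Lab q) => match x with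
      | none => Lab.test
      | some (Sum.inl l) => (Lab.pos l : Lab (ite k p q))
      | some (Sum.inr l) => Lab.neg l) ?_
    rintro (_ | _)
    exacts [⟨none, rfl⟩, ⟨some (Sum.inl _), rfl⟩, ⟨some (Sum.inr _), rfl⟩]
  | seq p q hp hq =>
    refine Finite.of_surjective (fun x : Lab p ⊕ Lab q => match x with
      | Sum.inl l => (Lab.fst l : Lab (seq p q))
      | Sum.inr l => Lab.snd l) ?_
    rintro (_ | _)
    exacts [⟨Sum.inl _, rfl⟩, ⟨Sum.inr _, rfl⟩]
  | rep p hp =>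
    refine Finite.of_surjective (fun x : Option (Option (Option (Lab p))) => match x with
      | none => (Lab.copy : Lab (rep p))
      | some none => Lab.restore
      | some (some none) => Lab.loop
      | some (some (some l)) => Lab.body l) ?_
    rintro (_ | _)
    exacts [⟨none, rfl⟩, ⟨some none, rfl⟩, ⟨some (some none), rfl⟩, ⟨some (some (some _)), rfl⟩]
  | skip => exact Finite.of_surjective (fun _ : Unit => Lab.skip) (by rintro ⟨⟩; exact ⟨(), rfl⟩)
  | push => exact Finite.of_surjective (fun _ : Unit => Lab.push) (by rintro ⟨⟩; exact ⟨(), rfl⟩)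
  | pop => exact Finite.of_surjective (fun _ : Unit => Lab.pop) (by rintro ⟨⟩; exact ⟨(), rfl⟩)
  | mov => exact Finite.of_surjective (fun _ : Unit => Lab.mov) (by rintro ⟨⟩; exact ⟨(), rfl⟩)

/-- The label at which the machine code of a program starts. -/
def entry : (p : LoopProg K) → Lab p
  | ite _ _ _ => .test
  | seq p _ => .fst (entry p)
  | rep _ => .copy
  | skip => .skip
  | push _ _ => .push
  | pop _ => .pop
  | mov _ _ => .mov

open Turing.TM2.Stmt in
/-- The machine code of a program, with labels in an ambient type. -/
def code (A : Type) (cn : ℕ → C) :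
    (p : LoopProg K) → (Lab p → Λ) → Λ → Lab p → Turing.TM2.Stmt (Alph A K C) Λ (Mem A)
  | skip, _, x, .skip => goto fun _ => x
  | push k b, _, x, .push => .push (.usr k) (fun _ => b) (goto fun _ => x)
  | pop k, _, x, .pop => .pop (.usr k) (fun v _ => v) (goto fun _ => x)
  | mov k k', _, x, .mov =>
    .pop (.usr k) (fun _ o => (none, o, false))
      (branch (fun v => v.2.1.isSome)
        (.push (.usr k') (fun v => v.2.1.getD false) (load (fun _ => mem₀) (goto fun _ => x)))
        (load (fun _ => mem₀) (goto fun _ => x)))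
  | ite k p q, e, _, .test =>
    peek (.usr k) (fun _ o => (none, o, false))
      (branch (fun v => decide (v.2.1 = some true))
        (load (fun _ => mem₀) (goto fun _ => e (.pos (entry p))))
        (load (fun _ => mem₀) (goto fun _ => e (.neg (entry q)))))
  | ite _ p _, e, x, .pos l => code A cn p (fun l => e (.pos l)) x l
  | ite _ _ q, e, x, .neg l => code A cn q (fun l => e (.neg l)) x l
  | seq p q, e, _, .fst l => code A cn p (fun l => e (.fst l)) (e (.snd (entry q))) l
  | seq _ q, e, x, .snd l => code A cn q (fun l => e (.snd l)) x l
  | rep p, e, _, .copy =>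
    .pop .tick (fun _ o => (none, o, false))
      (branch (fun v => v.2.1.isSome)
        (.push (.ctr (cn p.depth)) (fun _ => true)
          (.push (.ctr (cn (p.depth + 1))) (fun _ => true)
            (load (fun _ => mem₀) (goto fun _ => e .copy))))
        (load (fun _ => mem₀) (goto fun _ => e .restore)))
  | rep p, e, _, .restore =>
    .pop (.ctr (cn p.depth)) (fun _ o => (none, o, false))
      (branch (fun v => v.2.1.isSome)
        (.push .tick (fun _ => true) (load (fun _ => mem₀) (goto fun _ => e .restore)))
        (load (fun _ => mem₀) (goto fun _ => e .loop)))
  | rep p, e, x, .loop =>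
    .pop (.ctr (cn (p.depth + 1))) (fun _ o => (none, o, false))
      (branch (fun v => v.2.1.isSome)
        (load (fun _ => mem₀) (goto fun _ => e (.body (entry p))))
        (load (fun _ => mem₀) (goto fun _ => x)))
  | rep p, e, _, .body l => code A cn p (fun l => e (.body l)) (e .loop) l

/-- The machine `M` gets from `c` to `c'` in exactly `t` steps. -/
def Runs (M : Λ → Turing.TM2.Stmt (Alph A K C) Λ (Mem A))
    (c c' : Turing.TM2.Cfg (Alph A K C) Λ (Mem A)) (t : ℕ) : Prop :=
  (flip bind (Turing.TM2.step M))^[t] (some c) = some c'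

theorem Runs.trans {M : Λ → Turing.TM2.Stmt (Alph A K C) Λ (Mem A)} {c₁ c₂ c₃ t₁ t₂}
    (h₁ : Runs M c₁ c₂ t₁) (h₂ : Runs M c₂ c₃ t₂) : Runs M c₁ c₃ (t₁ + t₂) := by
  unfold Runs at *
  rw [Nat.add_comm, iterate_add_apply, h₁, h₂]

theorem Runs.step {M : Λ → Turing.TM2.Stmt (Alph A K C) Λ (Mem A)} {l v S c}
    (h : Turing.TM2.stepAux (M l) v S = c) : Runs M ⟨some l, v, S⟩ c 1 := by
  subst h; rfl

/-- The machine code of a program does what the program does. -/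
theorem runs_code [DecidableEq C] (M : Λ → Turing.TM2.Stmt (Alph A K C) Λ (Mem A)) (cn : ℕ → C)
    (N : ℕ) (w : List A) (p : LoopProg K) :
    ∀ (e : Lab p → Λ) (x : Λ) (u : K → List Bool) (c : C → List Bool),
      (∀ l, M (e l) = code A cn p e x l) → Set.InjOn cn (Set.Iio p.depth) →
      (∀ i < p.depth, c (cn i) = []) →
      ∃ t ≤ p.cost N, Runs M ⟨some (e (entry p)), mem₀, conts w (List.replicate N true) u c⟩
        ⟨some x, mem₀, conts w (List.replicate N true) (den N p u) c⟩ t := by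
  induction p with
  | skip =>
    intro e x u c he _ _
    exact ⟨1, by simp [cost], Runs.step (by rw [he]; simp [code, entry, den])⟩
  | push k b =>
    intro e x u c he _ _
    exact ⟨1, by simp [cost], Runs.step (by rw [he]; simp [code, entry, den, update_usr, conts])⟩
  | pop k =>
    intro e x u c he _ _
    exact ⟨1, by simp [cost], Runs.step (by rw [he]; simp [code, entry, den, update_usr, conts])⟩
  | mov k k' =>
    intro e x u c he _ _
    refine ⟨1, by simp [cost], Runs.step ?_⟩
    rw [he]
    simp only [code, entry, Turing.TM2.stepAux, den, move]
    rcases h : u k with _ | ⟨b, l⟩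
    · simp only [conts, h, List.head?_nil, Option.isSome_none, cond_false, List.tail_nil,
        update_usr]
      rw [← h, update_eq_self]
    · simp [conts, h, update_usr]
  | ite k p q hp hq =>
    intro e x u c he hinj hc
    have hstep : Runs M ⟨some (e (entry (ite k p q))), mem₀, conts w (List.replicate N true) u c⟩
        ⟨some (if (u k).head? = some true then e (.pos (entry p))
          else e (.neg (entry q))), mem₀, conts w (List.replicate N true) u c⟩ 1 := by
      refine Runs.step ?_
      rw [he]
      simp only [code, entry, Turing.TM2.stepAux, conts]
      by_cases h : (u k).head? = some true <;> simp [h]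
    by_cases h : (u k).head? = some true
    · obtain ⟨t, ht, hr⟩ := hp (fun l => e (.pos l)) x u c
        (fun l => he (.pos l)) (hinj.mono (Set.Iio_subset_Iio (le_max_left _ _)))
        (fun i hi => hc i (lt_of_lt_of_le hi (le_max_left _ _)))
      rw [if_pos h] at hstep
      exact ⟨1 + t, by simp only [cost]; omega, by simpa [den, h] using hstep.trans hr⟩
    · obtain ⟨t, ht, hr⟩ := hq (fun l => e (.neg l)) x u c
        (fun l => he (.neg l)) (hinj.mono (Set.Iio_subset_Iio (le_max_right _ _)))
        (fun i hi => hc i (lt_of_lt_of_le hi (le_max_right _ _)))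
      rw [if_neg h] at hstep
      exact ⟨1 + t, by simp only [cost]; omega, by simpa [den, h] using hstep.trans hr⟩
  | seq p q hp hq =>
    intro e x u c he hinj hc
    obtain ⟨t, ht, hr⟩ := hp (fun l => e (.fst l)) (e (.snd (entry q))) u c
      (fun l => he (.fst l)) (hinj.mono (Set.Iio_subset_Iio (le_max_left _ _)))
      (fun i hi => hc i (lt_of_lt_of_le hi (le_max_left _ _)))
    obtain ⟨t', ht', hr'⟩ := hq (fun l => e (.snd l)) x (den N p u) c
      (fun l => he (.snd l)) (hinj.mono (Set.Iio_subset_Iio (le_max_right _ _)))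
      (fun i hi => hc i (lt_of_lt_of_le hi (le_max_right _ _)))
    exact ⟨t + t', by simp only [cost]; omega, hr.trans hr'⟩
  -- The ticks are copied to two counters. One of them restores the ticks, so that inner and later
  -- loops find `N` of them again; the other one counts the iterations. The body uses only counters
  -- with index below `p.depth`, and injectivity of `cn` keeps these apart from the two.
  | rep p hp =>
    intro e x u c he hinj hc
    have hd : cn p.depth ≠ cn (p.depth + 1) := fun h => by
      have := hinj (by simp [depth]) (by simp [depth]) h
      omega
    have hc0 : c (cn p.depth) = [] := hc _ (by simp [depth])
    have hc1 : c (cn (p.depth + 1)) = [] := hc _ (by simp [depth])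
    have h0 : ∀ n j, Runs M ⟨some (e .copy), mem₀,
        conts w (List.replicate n true) u (update (update c (cn p.depth)
          (List.replicate j true)) (cn (p.depth + 1)) (List.replicate j true))⟩
        ⟨some (e .restore), mem₀, conts w [] u (update (update c (cn p.depth)
          (List.replicate (n + j) true)) (cn (p.depth + 1)) (List.replicate (n + j) true))⟩
        (n + 1) := by
      intro n
      induction n with
      | zero =>
        intro j
        refine Runs.step ?_
        rw [he]
        simp [code, conts, update_tick]
      | succ n ih =>
        intro j
        rw [show n + 1 + 1 = 1 + (n + 1) by omega]
        refine Runs.trans (Runs.step ?_) (by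
          have := ih (j + 1)
          rwa [show n + (j + 1) = n + 1 + j by omega] at this)
        rw [he]
        simp only [code, Turing.TM2.stepAux, conts, List.replicate_succ, List.head?_cons,
          Option.isSome_some, cond_true, List.tail_cons, update_tick, update_ctr]
        congr 2
        funext i
        simp only [update_apply]
        split_ifs with h1 h2 <;> simp_all
    have h1 : ∀ n j, ∀ c' : C → List Bool, Runs M ⟨some (e .restore), mem₀,
        conts w (List.replicate j true) u (update c' (cn p.depth) (List.replicate n true))⟩
        ⟨some (e .loop), mem₀, conts w (List.replicate (n + j) true) u
          (update c' (cn p.depth) [])⟩ (n + 1) := by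
      intro n
      induction n with
      | zero =>
        intro j c'
        refine Runs.step ?_
        rw [he]
        simp [code, conts, update_ctr]
      | succ n ih =>
        intro j c'
        rw [show n + 1 + 1 = 1 + (n + 1) by omega]
        refine Runs.trans (Runs.step ?_) (by
          have := ih (j + 1) c'
          rwa [show n + (j + 1) = n + 1 + j by omega] at this)
        rw [he]
        simp [code, conts, update_ctr, update_tick, List.replicate_succ]
    have h2 : ∀ n, ∀ u : K → List Bool, ∃ t ≤ n * (p.cost N + 1) + 1, Runs M
        ⟨some (e .loop), mem₀, conts w (List.replicate N true) u
          (update c (cn (p.depth + 1)) (List.replicate n true))⟩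
        ⟨some x, mem₀, conts w (List.replicate N true) ((den N p)^[n] u) c⟩ t := by
      intro n
      induction n with
      | zero =>
        intro u
        refine ⟨1, by simp, Runs.step ?_⟩
        rw [he]
        have : update c (cn (p.depth + 1)) [] = c := by rw [← hc1, update_eq_self]
        simp only [code, Turing.TM2.stepAux, conts, update_ctr, List.replicate_zero, update_self,
          List.head?_nil, Option.isSome_none, cond_false, List.tail_nil, update_idem,
          iterate_zero, id]
        rw [this]
      | succ n ih =>
        intro u
        obtain ⟨t, ht, hr⟩ := hp (fun l => e (.body l)) (e .loop) u
          (update c (cn (p.depth + 1)) (List.replicate n true)) (fun l => he (.body l))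
          (hinj.mono (Set.Iio_subset_Iio (by simp [depth])))
          (fun i hi => by
            have : cn i ≠ cn (p.depth + 1) := fun h => by
              have := hinj (by simp only [depth, Set.mem_Iio]; omega) (by simp [depth]) h
              omega
            rw [update_of_ne this]
            exact hc i (by simp only [depth]; omega))
        obtain ⟨t', ht', hr'⟩ := ih (den N p u)
        refine ⟨1 + t + t', by rw [Nat.succ_mul]; omega,
          Runs.trans (Runs.trans (Runs.step ?_) hr) hr'⟩
        rw [he]
        simp [code, conts, update_ctr, List.replicate_succ]
    have e0 := h0 N 0
    have e1 := h1 N 0 (update c (cn (p.depth + 1)) (List.replicate N true))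
    obtain ⟨t, ht, e2⟩ := h2 N u
    have hcc : update (update c (cn p.depth) (List.replicate 0 true)) (cn (p.depth + 1))
        (List.replicate 0 true) = c := by
      funext i
      simp only [update_apply]
      split_ifs with h1 h2 <;> simp_all
    have hcc' : update (update c (cn (p.depth + 1)) (List.replicate N true)) (cn p.depth) [] =
        update c (cn (p.depth + 1)) (List.replicate N true) := by
      funext i
      simp only [update_apply]
      split_ifs with h1 h2 <;> simp_all
    rw [hcc, Nat.add_zero, update_comm hd] at e0
    rw [hcc', Nat.add_zero] at e1
    refine ⟨N + 1 + (N + 1) + t, by simp only [cost]; omega, (e0.trans e1).trans e2⟩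

end Machine

end LoopProg

namespace LoopProg

open Function

set_option linter.unusedSectionVars false

/-! ### Loop programs decide in polynomial time -/

section Decide

variable {A K C Λ : Type} [DecidableEq A] [DecidableEq K] [DecidableEq C]
  [DecidableEq (Stk (A ⊕ K) C)]

/-- The labels of the machine that reads its input, runs a program and answers. -/
inductive MLab (p : LoopProg (A ⊕ K)) : Type
  | read
  | run (l : Lab p)
  | answer
  | clean

theorem finite_mlab (p : LoopProg (A ⊕ K)) : Finite (MLab p) := by
  have := finite_lab p
  refine Finite.of_surjective (fun x : Option (Option (Option (Lab p))) => match x with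
      | none => MLab.read
      | some none => MLab.answer
      | some (some none) => MLab.clean
      | some (some (some l)) => MLab.run l) ?_
  rintro (_ | _)
  exacts [⟨none, rfl⟩, ⟨some (some (some _)), rfl⟩, ⟨some none, rfl⟩, ⟨some (some none), rfl⟩]

/-- For each letter of the list, record whether it is the letter that has just been read. -/
def pushLetters (l : List A) (q : Turing.TM2.Stmt (Alph A (A ⊕ K) C) Λ (Mem A)) :
    Turing.TM2.Stmt (Alph A (A ⊕ K) C) Λ (Mem A) :=
  l.foldr (fun a q => .push (.usr (Sum.inl a)) (fun v => decide (v.1 = some a)) q) q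

/-- Put `n` symbols onto the stack that holds the number of iterations. -/
def pushTicks (n : ℕ) (q : Turing.TM2.Stmt (Alph A (A ⊕ K) C) Λ (Mem A)) :
    Turing.TM2.Stmt (Alph A (A ⊕ K) C) Λ (Mem A) :=
  (fun q => .push .tick (fun _ => true) q)^[n] q

/-- Pop all the stacks of the list, and record whether one of them was not empty. -/
def popAll (l : List (Stk (A ⊕ K) C)) (q : Turing.TM2.Stmt (Alph A (A ⊕ K) C) Λ (Mem A)) :
    Turing.TM2.Stmt (Alph A (A ⊕ K) C) Λ (Mem A) :=
  l.foldr (fun k q => .pop k (fun v o => (none, v.2.1, v.2.2 || o.isSome)) q) q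

theorem stepAux_pushLetters (l : List A) (hl : l.Nodup)
    (q : Turing.TM2.Stmt (Alph A (A ⊕ K) C) Λ (Mem A)) (v : Mem A) (w : List A) (t : List Bool)
    (u : A → List Bool) (u' : K → List Bool) (c : C → List Bool) :
    Turing.TM2.stepAux (pushLetters l q) v (conts w t (Sum.elim u u') c) =
      Turing.TM2.stepAux q v (conts w t (Sum.elim
        (fun a => if a ∈ l then decide (v.1 = some a) :: u a else u a) u') c) := by
  induction l generalizing u with
  | nil => simp [pushLetters]
  | cons a l ih =>
    rw [List.nodup_cons] at hl
    rw [show pushLetters (a :: l) q = .push (.usr (Sum.inl a)) (fun v => decide (v.1 = some a))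
      (pushLetters l q) from rfl, Turing.TM2.stepAux, update_usr]
    rw [show update (Sum.elim u u') (Sum.inl a) (decide (v.1 = some a) ::
      conts w t (Sum.elim u u') c (Stk.usr (Sum.inl a))) =
      Sum.elim (update u a (decide (v.1 = some a) :: u a)) u' from by
        funext k
        rcases k with k | k
        · by_cases h : k = a
          · subst h; simp [conts]
          · simp [h]
        · simp, ih hl.2]
    congr 2
    funext k
    rcases k with k | k
    · by_cases h : k = a
      · subst h; simp [hl.1]
      · simp [h]
    · rfl

theorem stepAux_pushTicks (n : ℕ) (q : Turing.TM2.Stmt (Alph A (A ⊕ K) C) Λ (Mem A)) (v : Mem A)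
    (w : List A) (t : List Bool) (u : A ⊕ K → List Bool) (c : C → List Bool) :
    Turing.TM2.stepAux (pushTicks n q) v (conts w t u c) =
      Turing.TM2.stepAux q v (conts w (List.replicate n true ++ t) u c) := by
  induction n generalizing t with
  | zero => simp [pushTicks]
  | succ n ih =>
    unfold pushTicks at ih ⊢
    rw [iterate_succ_apply', Turing.TM2.stepAux, update_tick, ih]
    congr 2
    simp only [conts]
    rw [List.replicate_succ', List.append_assoc]; rfl

theorem stepAux_popAll (l : List (Stk (A ⊕ K) C)) (hl : l.Nodup)
    (q : Turing.TM2.Stmt (Alph A (A ⊕ K) C) Λ (Mem A)) (b : Option Bool) (f : Bool)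
    (S : ∀ k, List (Alph A (A ⊕ K) C k)) :
    Turing.TM2.stepAux (popAll l q) (none, b, f) S =
      Turing.TM2.stepAux q (none, b, f || l.any (fun k => (S k).head?.isSome))
        (fun k => if k ∈ l then (S k).tail else S k) := by
  induction l generalizing S f with
  | nil => simp [popAll]
  | cons a l ih =>
    rw [List.nodup_cons] at hl
    rw [show popAll (a :: l) q = .pop a (fun v o => (none, v.2.1, v.2.2 || o.isSome))
      (popAll l q) from rfl, Turing.TM2.stepAux, ih hl.2]
    have h1 : l.any (fun k => (update S a (S a).tail k).head?.isSome) =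
        l.any (fun k => (S k).head?.isSome) := by
      rw [Bool.eq_iff_iff, List.any_eq_true, List.any_eq_true]
      refine exists_congr fun k => and_congr_right fun hk => ?_
      rw [update_of_ne (by rintro rfl; exact hl.1 hk)]
    rw [h1]
    simp only [List.any_cons, Bool.or_assoc]
    congr 1
    funext k
    by_cases h : k = a
    · subst h; simp [hl.1]
    · simp [h]

/-- The machine that reads its input, runs a program and answers. -/
noncomputable def machine [Fintype A] [Fintype (Stk (A ⊕ K) C)] (κ : ℕ) (p : LoopProg (A ⊕ K))
    (res : K) (cn : ℕ → C) : MLab p → Turing.TM2.Stmt (Alph A (A ⊕ K) C) (MLab p) (Mem A)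
  | .read => .pop .inp (fun _ o => (o, none, false))
      (.branch (fun v => v.1.isSome)
        (pushLetters Finset.univ.toList
          (pushTicks κ (.load (fun _ => mem₀) (.goto fun _ => .read))))
        (pushTicks κ (.load (fun _ => mem₀) (.goto fun _ => .run (entry p)))))
  | .run l => code A cn p .run .answer l
  | .answer => .peek (.usr (Sum.inr res)) (fun _ o => (none, some (decide (o = some true)), false))
      (.goto fun _ => .clean)
  | .clean => .load (fun v => (none, v.2.1, false)) (popAll Finset.univ.toList
      (.branch (fun v => v.2.2) (.goto fun _ => .clean)
        (.push .tick (fun v => v.2.1.getD false) (.load (fun _ => mem₀) .halt))))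

/-- The stacks of a program when it starts: for each letter there is a stack that records in which
positions of the word (from right to left) the letter stands. -/
def start (K : Type) (w : List A) : A ⊕ K → List Bool :=
  Sum.elim (fun a => (w.map fun x => decide (x = a)).reverse) fun _ => []

/-- Invariant: the letters of `w₁` have been read, and each of them has contributed `κ` ticks. The
end of the input contributes `κ` more, so that loops run even on the empty word if `κ` is positive.
-/
theorem runs_read [Fintype A] [Fintype (Stk (A ⊕ K) C)] (κ : ℕ) (p : LoopProg (A ⊕ K))
    (res : K) (cn : ℕ → C) (c : C → List Bool) (w₂ : List A) : ∀ w₁ : List A,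
    Runs (machine κ p res cn)
      ⟨some .read, mem₀, conts w₂ (List.replicate (κ * w₁.length) true) (start K w₁) c⟩
      ⟨some (.run (entry p)), mem₀, conts []
        (List.replicate (κ * ((w₁ ++ w₂).length + 1)) true) (start K (w₁ ++ w₂)) c⟩
      (w₂.length + 1) := by
  induction w₂ with
  | nil =>
    intro w₁
    refine Runs.step ?_
    simp only [machine, Turing.TM2.stepAux, conts, List.head?_nil, Option.isSome_none, cond_false,
      List.tail_nil, update_inp, List.append_nil, stepAux_pushTicks]
    rw [List.replicate_append_replicate, Nat.mul_succ, Nat.add_comm κ]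
  | cons a w₂ ih =>
    intro w₁
    have h := ih (w₁ ++ [a])
    rw [List.append_assoc, List.singleton_append] at h
    rw [show (a :: w₂).length + 1 = 1 + (w₂.length + 1) by rw [List.length_cons]; omega]
    refine Runs.trans (Runs.step ?_) h
    simp only [machine, Turing.TM2.stepAux, conts, List.head?_cons, Option.isSome_some, cond_true,
      List.tail_cons, update_inp, stepAux_pushTicks, start]
    rw [stepAux_pushLetters _ (Finset.nodup_toList _), stepAux_pushTicks]
    simp only [Turing.TM2.stepAux]
    rw [List.replicate_append_replicate, List.length_append, List.length_singleton, Nat.mul_succ,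
      Nat.add_comm κ]
    congr 2
    funext k
    rcases k with k | k <;> simp

/-- A halting configuration must have empty stacks apart from the output. Every step pops all stacks
once and notes whether one of them was nonempty. The answer waits in the internal state and is
written after a round that found nothing. -/
theorem runs_clean [Fintype A] [Fintype (Stk (A ⊕ K) C)] (κ : ℕ) (p : LoopProg (A ⊕ K))
    (res : K) (cn : ℕ → C) (b : Bool) (m : ℕ) : ∀ (f : Bool) (S : ∀ k, List (Alph A (A ⊕ K) C k)),
    (∀ k, (S k).length ≤ m) → ∃ t ≤ m + 1, Runs (machine κ p res cn)
      ⟨some .clean, (none, some b, f), S⟩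
      ⟨none, mem₀, conts [] [b] (fun _ => []) (fun _ => [])⟩ t := by
  have key : ∀ (f : Bool) (S : ∀ k, List (Alph A (A ⊕ K) C k)), (∀ k, S k = []) →
      Runs (machine κ p res cn) ⟨some .clean, (none, some b, f), S⟩
      ⟨none, mem₀, conts [] [b] (fun _ => []) (fun _ => [])⟩ 1 := by
    intro f S hS
    refine Runs.step ?_
    have hS' : S = fun _ => [] := funext hS
    subst hS'
    simp only [machine, Turing.TM2.stepAux]
    rw [stepAux_popAll _ (Finset.nodup_toList _)]
    have h1 : (Finset.univ.toList : List (Stk (A ⊕ K) C)).any (fun _ => false) = false := by simp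
    simp only [Turing.TM2.stepAux, List.head?_nil, Option.isSome_none, h1,
      Bool.or_self, cond_false, List.tail_nil, ite_self]
    congr 1
    funext k
    cases k with
    | tick => simp [conts]
    | _ => simp [conts, update]
  induction m with
  | zero =>
    intro f S hS
    exact ⟨1, le_rfl, key f S fun k => List.length_eq_zero_iff.1 (Nat.le_zero.1 (hS k))⟩
  | succ m ih =>
    intro f S hS
    by_cases h : ∀ k, S k = []
    · exact ⟨1, by omega, key f S h⟩
    · push Not at h
      obtain ⟨k₀, hk₀⟩ := h
      obtain ⟨t, ht, hr⟩ := ih true (fun k => (S k).tail) (fun k => by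
        rw [List.length_tail]; have := hS k; omega)
      refine ⟨1 + t, by omega, Runs.trans (Runs.step ?_) hr⟩
      simp only [machine, Turing.TM2.stepAux]
      rw [stepAux_popAll _ (Finset.nodup_toList _)]
      have h1 : (Finset.univ.toList : List (Stk (A ⊕ K) C)).any
          (fun k => (S k).head?.isSome) = true := by
        rw [List.any_eq_true]
        refine ⟨k₀, by simp, ?_⟩
        cases h2 : S k₀ with
        | nil => exact absurd h2 hk₀
        | cons => simp
      simp [Turing.TM2.stepAux, h1]

end Decide

/-- If a loop program decides a problem, when it is started with the positions of the letters of
the input and when loops have `κ * (ℓ + 1)` iterations for inputs of length `ℓ`, then the problem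
is solvable in polynomial time. -/
theorem polyTimeDecidable {α A K : Type} [Finite A] [DecidableEq A] [Finite K] [DecidableEq K]
    (enc : α → List A) (P : α → Prop) (κ : ℕ) (p : LoopProg (A ⊕ K)) (res : K)
    (h : ∀ a, (den (κ * ((enc a).length + 1)) p (start K (enc a)) (Sum.inr res)).head? = some true ↔
      P a) : PolyTimeDecidable enc P := by
  classical
  have := Fintype.ofFinite A
  have := Fintype.ofFinite K
  have := finite_mlab p
  have := Fintype.ofFinite (MLab p)
  let C := Fin (p.depth + 1)
  have := Fintype.ofFinite (Stk (A ⊕ K) C)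
  let cn : ℕ → C := fun i => Fin.ofNat _ i
  obtain ⟨T, hT⟩ := exists_polynomial_cost p
  let N : α → ℕ := fun a => κ * ((enc a).length + 1)
  let f : α → Bool := fun a => decide (((den (N a) p (start K (enc a)) (Sum.inr res)).head?) = some true)
  refine ⟨f, fun a => by simpa [f] using h a, ?_⟩
  let tm : Turing.FinTM2 :=
    { K := Stk (A ⊕ K) C
      k₀ := .inp
      k₁ := .tick
      Γ := Alph A (A ⊕ K) C
      Λ := MLab p
      main := .read
      σ := Mem A
      initialState := mem₀
      Γk₀Fin := (inferInstance : Fintype A)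
      m := machine κ p res cn }
  have hfin : ∀ k, Finite (tm.Γ k) := by
    intro k
    change Finite (Alph A (A ⊕ K) C k)
    cases k
    · change Finite A; infer_instance
    all_goals change Finite Bool; infer_instance
  let Np : Polynomial ℕ := Polynomial.C κ * (Polynomial.X + 1)
  have hNp : ∀ a, Np.eval (enc a).length = N a := fun a => by simp [Np, N]
  have hbound : ∀ a, ∃ t ≤ ((Polynomial.X + 1) + T.comp Np + 1 +
      (Polynomial.X + Np + T.comp Np + 1)).eval (enc a).length,
      Runs (machine κ p res cn) ⟨some .read, mem₀, conts (enc a) [] (start K []) fun _ => []⟩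
        ⟨none, mem₀, conts [] [f a] (fun _ => []) (fun _ => [])⟩ t := by
    intro a
    have h1 := runs_read κ p res cn (fun _ => []) (enc a) []
    simp only [List.length_nil, Nat.mul_zero, List.replicate_zero, List.nil_append] at h1
    obtain ⟨t₂, ht₂, h2⟩ := runs_code (machine κ p res cn) cn (N a) [] p .run .answer
      (start K (enc a)) (fun _ => []) (fun l => rfl) (by
        intro i hi j hj hij
        have := congrArg Fin.val hij
        simp only [cn, Fin.ofNat] at this
        rw [Set.mem_Iio] at hi hj
        rwa [Nat.mod_eq_of_lt (by omega), Nat.mod_eq_of_lt (by omega)] at this)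
      (fun _ _ => rfl)
    have h3 : Runs (machine κ p res cn) ⟨some .answer, mem₀, conts []
        (List.replicate (N a) true) (den (N a) p (start K (enc a))) fun _ => []⟩
        ⟨some .clean, (none, some (f a), false), conts []
        (List.replicate (N a) true) (den (N a) p (start K (enc a))) fun _ => []⟩ 1 := by
      refine Runs.step ?_
      simp only [machine, Turing.TM2.stepAux, conts, f]
      congr!
    obtain ⟨t₄, ht₄, h4⟩ := runs_clean κ p res cn (f a) ((enc a).length + N a + p.cost (N a)) false
      (conts [] (List.replicate (N a) true) (den (N a) p (start K (enc a))) fun _ => []) (by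
        intro k
        cases k with
        | inp => simp [conts]
        | tick => simp only [conts, List.length_replicate]; omega
        | ctr => simp [conts]
        | usr k =>
          refine (length_den_le (N a) p _ (enc a).length ?_ k).trans (by omega)
          rintro (k | k) <;> simp [start])
    refine ⟨_, ?_, ((h1.trans h2).trans h3).trans h4⟩
    simp only [Polynomial.eval_add, Polynomial.eval_X, Polynomial.eval_one, Polynomial.eval_comp,
      hNp, hT]
    omega
  choose t ht hr using hbound
  refine ⟨{ tm := tm
            inputAlphabet := Equiv.refl A
            outputAlphabet := Equiv.refl Bool
            time := _
            outputsFun := fun a => ⟨⟨t a, ?_⟩, ht a⟩ }, hfin⟩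
  have h1 : Turing.initList tm (List.map (Equiv.refl A).invFun (enc a)) =
      (⟨some .read, mem₀, conts (enc a) [] (start K []) fun _ => []⟩ :
        Turing.TM2.Cfg (Alph A (A ⊕ K) C) (MLab p) (Mem A)) := by
    unfold Turing.initList
    congr 1
    funext k
    cases k with
    | inp =>
      refine (dif_pos rfl).trans ?_
      exact List.map_id _
    | usr k => rcases k with k | k <;> exact dif_neg nofun
    | _ => exact dif_neg nofun
  have h2 : Turing.haltList tm (List.map (Equiv.refl Bool).invFun (Computability.encodeBool (f a))) =
      (⟨none, mem₀, conts [] [f a] (fun _ => []) fun _ => []⟩ :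
        Turing.TM2.Cfg (Alph A (A ⊕ K) C) (MLab p) (Mem A)) := by
    unfold Turing.haltList
    congr 1
    funext k
    cases k with
    | tick => exact dif_pos rfl
    | _ => exact dif_neg nofun
  have h3 := hr a
  unfold Runs at h3
  rw [← h1] at h3
  refine h3.trans ?_
  simp only [Option.map_some]
  exact congrArg some h2.symm

end LoopProg

/-! ### First-order formulas over tables, evaluated by loop programs -/

/-- First-order formulas with named variables about the letters of a word, the order of the
positions and tables of tuples of positions. -/
inductive Fml (A I V : Type) : Type
  | letter (a : A) (v : V)
  | lt (v v' : V)
  | tab (i : I) (f : V → V)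
  | nand (φ ψ : Fml A I V)
  | ex (v : V) (φ : Fml A I V)

/-- Programs that compute tables by first-order definitions and by iteration. -/
inductive TabProg (A I V : Type) : Type
  | skip
  | assign (i : I) (φ : Fml A I V)
  | seq (p q : TabProg A I V)
  | rep (p : TabProg A I V)

section Semantics

open Function Classical

variable {A I V : Type}

/-- Satisfaction of a formula, where positions range over the numbers below `N`. -/
def Fml.Sat (N : ℕ) (L : A → ℕ → Prop) (X : I → (V → ℕ) → Prop) : Fml A I V → (V → ℕ) → Prop
  | letter a v, x => L a (x v)
  | lt v v', x => x v < x v'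
  | tab i f, x => X i (x ∘ f)
  | nand φ ψ, x => ¬(Sat N L X φ x ∧ Sat N L X ψ x)
  | ex v φ, x => ∃ y < N, Sat N L X φ (update x v y)

/-- The effect of a program on the tables. -/
noncomputable def TabProg.den (N : ℕ) (L : A → ℕ → Prop) :
    TabProg A I V → (I → (V → ℕ) → Prop) → (I → (V → ℕ) → Prop)
  | skip, X => X
  | assign i φ, X => update X i (φ.Sat N L X)
  | seq p q, X => den N L q (den N L p X)
  | rep p, X => (den N L p)^[N] X

end Semantics

namespace LoopProg

open Function Classical

set_option linter.unusedSectionVars false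

/-! ### Bulk moves and loops controlled by unary registers -/

section Moves

variable {K : Type} [DecidableEq K]

theorem iterate_move {k k' : K} (h : k ≠ k') (n : ℕ) (s : K → List Bool) :
    (move k k')^[n] s =
      update (update s k ((s k).drop n)) k' (((s k).take n).reverse ++ s k') := by
  induction n generalizing s with
  | zero => simp
  | succ n ih =>
    rw [iterate_succ_apply, ih]
    unfold move
    rcases hs : s k with _ | ⟨b, l⟩
    · simp [hs]
    · simp only [update_of_ne h, update_self, List.drop_succ_cons, List.take_succ_cons,
        List.reverse_cons, List.append_assoc, update_of_ne h.symm, List.singleton_append]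
      funext j
      by_cases h1 : j = k'
      · subst h1; simp
      · by_cases h2 : j = k
        · subst h2; simp [h]
        · simp [h1, h2]

theorem iterate_move_back {k k' : K} (h : k ≠ k') (n : ℕ) (s : K → List Bool) (hs : s k' = []) :
    (move k' k)^[n] ((move k k')^[n] s) = s := by
  rw [iterate_move h, iterate_move h.symm]
  funext j
  by_cases h1 : j = k
  · subst h1
    simp only [hs, List.append_nil, update_self, update_of_ne h]
    rw [List.take_of_length_le (by simp), List.reverse_reverse, List.take_append_drop]
  · by_cases h2 : j = k'
    · subst h2; simp [h.symm, hs]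
    · simp [h1, h2]

/-- Move `N ^ n` symbols, if loops have `N` iterations. -/
def movePow (k k' : K) : ℕ → LoopProg K
  | 0 => mov k k'
  | n + 1 => rep (movePow k k' n)

theorem den_movePow (N : ℕ) (k k' : K) (n : ℕ) :
    den N (movePow k k' n) = (move k k')^[N ^ n] := by
  induction n with
  | zero => funext s; simp [movePow, den]
  | succ n ih =>
    funext s
    rw [movePow, den, ih, ← iterate_mul, pow_succ]

/-- Pop `N ^ n` symbols, if loops have `N` iterations. -/
def popPow (k : K) : ℕ → LoopProg K
  | 0 => pop k
  | n + 1 => rep (popPow k n)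

theorem iterate_pop (N : ℕ) (k : K) (n : ℕ) (s : K → List Bool) :
    (den N (pop k))^[n] s = update s k ((s k).drop n) := by
  induction n generalizing s with
  | zero => simp
  | succ n ih => rw [iterate_succ_apply, ih]; simp [den]

theorem den_popPow (N : ℕ) (k : K) (n : ℕ) (s : K → List Bool) :
    den N (popPow k n) s = update s k ((s k).drop (N ^ n)) := by
  have h : den N (popPow k n) = (den N (pop k))^[N ^ n] := by
    induction n with
    | zero => funext s; simp [popPow]
    | succ n ih =>
      funext s
      rw [popPow, den, ih, ← iterate_mul, pow_succ]
  rw [h, iterate_pop]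

/-- Run a program as many times as the stack `k` has symbols, where `c` is an auxiliary stack. -/
def repStack (k c : K) (p : LoopProg K) : LoopProg K :=
  seq (rep (ite k (seq (mov k c) p) skip)) (rep (mov c k))

/-- Every iteration shifts one symbol from `k` to `c` before running `p`; once `k` is empty, the
remaining iterations are idle, and the second loop shifts everything back. By `hp`, the program `p`
commutes with overwriting `k` and `c`, so the shifting does not disturb it. -/
theorem den_repStack (N : ℕ) {k c : K} (hkc : k ≠ c) (p : LoopProg K)
    (hp : ∀ s l l', den N p (update (update s k l) c l') = update (update (den N p s) k l) c l')
    (s : K → List Bool) (n : ℕ) (hn : n ≤ N) (hk : s k = List.replicate n true) (hc : s c = []) :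
    den N (repStack k c p) s = (den N p)^[n] s := by
  have hpres : ∀ j, (den N p)^[j] s k = s k ∧ (den N p)^[j] s c = s c := by
    intro j
    induction j with
    | zero => simp
    | succ j ih =>
      rw [iterate_succ_apply']
      have := hp ((den N p)^[j] s) ((den N p)^[j] s k) ((den N p)^[j] s c)
      rw [update_eq_self, update_eq_self] at this
      rw [this]
      simp [hkc, ih]
  have key : ∀ j ≤ n, (den N (ite k (seq (mov k c) p) skip))^[j] s =
      update (update ((den N p)^[j] s) k (List.replicate (n - j) true)) c
        (List.replicate j true) := by
    intro j
    induction j with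
    | zero =>
      intro _
      simp only [iterate_zero, id, Nat.sub_zero, List.replicate_zero]
      rw [← hk, ← hc, update_eq_self, update_eq_self]
    | succ j ih =>
      intro hj
      rw [iterate_succ_apply', ih (by omega)]
      have e : n - j = (n - (j + 1)) + 1 := by omega
      simp only [den, move, update_of_ne hkc, update_self, e, List.replicate_succ, List.head?_cons,
        if_true]
      rw [iterate_succ_apply', ← hp]
      congr 1
      funext i
      by_cases h1 : i = c
      · subst h1; simp [hkc.symm]
      · by_cases h2 : i = k
        · subst h2; simp [hkc]
        · simp [h1, h2]
  have key2 : ∀ j, (den N (ite k (seq (mov k c) p) skip))^[n + j] s =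
      update (update ((den N p)^[n] s) k []) c (List.replicate n true) := by
    intro j
    induction j with
    | zero => rw [Nat.add_zero, key n le_rfl]; simp
    | succ j ih =>
      rw [← Nat.add_assoc, iterate_succ_apply', ih]
      simp [den, hkc]
  obtain ⟨j, rfl⟩ := Nat.exists_eq_add_of_le hn
  have hm : den (n + j) (mov c k) = move c k := rfl
  rw [repStack, den, den, den, key2, hm, iterate_move hkc.symm]
  funext i
  by_cases h1 : i = k
  · subst h1; simp [hkc, hpres, hk]
  · by_cases h2 : i = c
    · subst h2; simp [hkc.symm, hpres, hc]
    · simp [h1, h2]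

/-- Run a program for all values of the unary register `k` below `N`; the old value of the register
is saved on the stack `v`. -/
def forReg (k v : K) (p : LoopProg K) : LoopProg K :=
  seq (push v false) (seq (rep (mov k v)) (seq (rep (seq p (push k true)))
    (seq (rep (pop k)) (seq (rep (ite v (mov v k) skip)) (pop v)))))

/-- The symbol `false` separates the saved value from older values on the same stack, so quantifiers
over the same variable can be nested. After the runs for `0, …, N - 1`, the symbols above the mark
return to `k`. Only the stack `r` keeps a trace of the runs of `p`, described by `H`. -/
theorem den_forReg (N : ℕ) {k v r : K} (hkv : k ≠ v) (hrk : r ≠ k) (hrv : r ≠ v) (p : LoopProg K)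
    (s : K → List Bool) (n : ℕ) (hn : n ≤ N) (hk : s k = List.replicate n true)
    (H : ℕ → List Bool → List Bool)
    (hp : ∀ y < N, ∀ l, den N p (update (update (update s v
        (List.replicate n true ++ false :: s v)) k (List.replicate y true)) r l) =
      update (update (update s v
        (List.replicate n true ++ false :: s v)) k (List.replicate y true)) r (H y l)) :
    den N (forReg k v p) s = update s r (Nat.rec (s r) (fun y l => H y l) N) := by
  have hm : den N (mov k v) = move k v := rfl
  set s₁ := update s v (List.replicate n true ++ false :: s v) with hs₁
  have h1 : (den N (mov k v))^[N] (update s v (false :: s v)) =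
      update (update s₁ k (List.replicate 0 true)) r (s r) := by
    rw [hm, iterate_move hkv]
    simp only [update_of_ne hkv, hk, List.take_of_length_le, List.length_replicate, hn,
      List.drop_eq_nil_of_le, List.reverse_replicate, update_self]
    funext i
    by_cases h1 : i = v
    · subst h1; simp [hkv.symm, hrv.symm, hs₁]
    · by_cases h2 : i = k
      · subst h2; simp [hkv, hrk.symm]
      · by_cases h3 : i = r
        · subst h3; simp [hrv, hrk]
        · simp [h1, h2, h3, hs₁]
  have h2 : ∀ m ≤ N, (den N (seq p (push k true)))^[m]
      (update (update s₁ k (List.replicate 0 true)) r (s r)) =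
      update (update s₁ k (List.replicate m true)) r (Nat.rec (s r) (fun y l => H y l) m) := by
    intro m
    induction m with
    | zero => intro _; simp
    | succ m ih =>
      intro hmN
      rw [iterate_succ_apply', ih (by omega), den, hp m (by omega)]
      simp only [den, update_of_ne hrk.symm, update_self]
      rw [update_comm hrk, update_idem, ← List.replicate_succ]
  change den N (pop v) ((den N (ite v (mov v k) skip))^[N] ((den N (pop k))^[N]
    ((den N (seq p (push k true)))^[N] ((den N (mov k v))^[N] (update s v (false :: s v)))))) = _
  rw [h1, h2 N le_rfl, iterate_pop]
  set S := update (update (update s₁ k (List.replicate N true)) r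
    (Nat.rec (s r) (fun y l => H y l) N)) k [] with hS
  have h3 : update (update (update s₁ k (List.replicate N true)) r
      (Nat.rec (s r) (fun y l => H y l) N)) k (((update (update s₁ k (List.replicate N true)) r
      (Nat.rec (s r) (fun y l => H y l) N)) k).drop N) = S := by
    rw [hS, update_of_ne hrk.symm, update_self, List.drop_eq_nil_of_le (by simp)]
  rw [h3]
  have hSv : S v = List.replicate n true ++ false :: s v := by
    simp [hS, hkv.symm, hrv.symm, hs₁]
  have hSk : S k = [] := by simp [hS]
  have h4 : ∀ j ≤ n, (den N (ite v (mov v k) skip))^[j] S =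
      update (update S v (List.replicate (n - j) true ++ false :: s v)) k
        (List.replicate j true) := by
    intro j
    induction j with
    | zero =>
      intro _
      simp only [iterate_zero, id, Nat.sub_zero, List.replicate_zero]
      rw [← hSv, ← hSk, update_eq_self, update_eq_self]
    | succ j ih =>
      intro hj
      rw [iterate_succ_apply', ih (by omega)]
      have e : n - j = (n - (j + 1)) + 1 := by omega
      simp only [den, move, update_of_ne hkv.symm, update_self, e, List.replicate_succ,
        List.cons_append, List.head?_cons, if_true, update_of_ne hkv]
      funext i
      by_cases h1 : i = k
      · subst h1; simp
      · by_cases h2 : i = v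
        · subst h2; simp [hkv.symm]
        · simp [h1, h2]
  have h5 : ∀ j, (den N (ite v (mov v k) skip))^[n + j] S =
      update (update S v (false :: s v)) k (List.replicate n true) := by
    intro j
    induction j with
    | zero => rw [Nat.add_zero, h4 n le_rfl]; simp
    | succ j ih =>
      rw [← Nat.add_assoc, iterate_succ_apply', ih]
      simp [den, hkv.symm]
  obtain ⟨j, hj⟩ := Nat.exists_eq_add_of_le hn
  have h6 : (den N (ite v (mov v k) skip))^[N] S =
      update (update S v (false :: s v)) k (List.replicate n true) := by
    conv_lhs => rw [hj]
    rw [← hj]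
    have := h5 j
    rwa [← hj] at this
  rw [h6, den]
  funext i
  by_cases h1 : i = v
  · subst h1; simp [hkv.symm, hrv.symm]
  · by_cases h2 : i = k
    · subst h2; simp [hkv, hrk.symm, hk]
    · by_cases h3 : i = r
      · subst h3; simp [hrv, hrk, hS]
      · simp [h1, h2, h3, hS, hs₁]

end Moves

end LoopProg

namespace LoopProg

open Function Classical

set_option linter.unusedSectionVars false

/-- The truth value of a proposition. -/
noncomputable def truth (P : Prop) : Bool := decide P

theorem truth_iff {P : Prop} : truth P = true ↔ P := by simp [truth]

theorem truth_congr {P Q : Prop} (h : P ↔ Q) : truth P = truth Q := by rw [propext h]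

theorem truth_not (P : Prop) : truth (¬P) = !truth P := by
  by_cases h : P <;> simp [truth, h]

theorem truth_and (P Q : Prop) : truth (P ∧ Q) = (truth P && truth Q) := by
  by_cases h : P <;> by_cases h' : Q <;> simp [truth, h, h']

/-! ### Evaluation of formulas on stored tables -/

section Tables

variable {A I V : Type} [Fintype V]

/-- The stacks of a loop program that evaluates formulas: positions of the letters, registers for
the variables, saved values of registers, tables, results, a table under construction, and two
auxiliary stacks. -/
inductive Key (A I V : Type) : Type
  | letter (a : A)
  | reg (v : V)
  | sav (v : V)
  | tab (i : I)
  | res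
  | new
  | scr
  | cnt

instance [Finite A] [Finite I] : Finite (Key A I V) :=
  Finite.of_injective
    (fun x : Key A I V => match x with
      | .letter a => (Sum.inl a : A ⊕ V ⊕ V ⊕ I ⊕ Fin 4)
      | .reg v => Sum.inr (Sum.inl v)
      | .sav v => Sum.inr (Sum.inr (Sum.inl v))
      | .tab i => Sum.inr (Sum.inr (Sum.inr (Sum.inl i)))
      | .res => Sum.inr (Sum.inr (Sum.inr (Sum.inr 0)))
      | .new => Sum.inr (Sum.inr (Sum.inr (Sum.inr 1)))
      | .scr => Sum.inr (Sum.inr (Sum.inr (Sum.inr 2)))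
      | .cnt => Sum.inr (Sum.inr (Sum.inr (Sum.inr 3))))
    (by intro x y h; cases x <;> cases y <;> simp_all)

/-- All the stacks, including the input of the program. -/
abbrev Loc (A I V : Type) : Type := A ⊕ Key A I V

/-- The place of a tuple in a table, where the variables are listed from the most to the least
significant one. -/
def place (N : ℕ) (x : V → ℕ) : List V → ℕ
  | [] => 0
  | v :: l => x v * N ^ l.length + place N x l

/-- The stacks hold the tables `X` and the values `x` of the variables. -/
structure Holds (N : ℕ) (L : A → ℕ → Prop) (X : I → (V → ℕ) → Prop) (x : V → ℕ)
    (s : Loc A I V → List Bool) : Prop where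
  letter : ∀ a n, (s (.inr (.letter a)))[n]? = some true ↔ L a n
  reg : ∀ v, s (.inr (.reg v)) = List.replicate (x v) true
  tab : ∀ i (y : V → ℕ), (∀ v, y v < N) →
    ((s (.inr (.tab i)))[place N y Finset.univ.toList]? = some true ↔ X i y)
  length_tab : ∀ i, (s (.inr (.tab i))).length ≤ N ^ Fintype.card V
  scr : s (.inr .scr) = []
  cnt : s (.inr .cnt) = []

variable {N : ℕ} {L : A → ℕ → Prop} {X : I → (V → ℕ) → Prop} {x : V → ℕ}
  {s : Loc A I V → List Bool}

theorem Holds.update_of (h : Holds N L X x s) (k : Key A I V) (l : List Bool)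
    (hk : k = .res ∨ k = .new ∨ ∃ v, k = .sav v) : Holds N L X x (update s (.inr k) l) := by
  rcases hk with rfl | rfl | ⟨v, rfl⟩ <;>
  exact ⟨by simpa using h.letter, by simpa using h.reg, by simpa using h.tab,
    by simpa using h.length_tab, by simpa using h.scr, by simpa using h.cnt⟩

theorem Holds.update_reg (h : Holds N L X x s) (v : V) (y : ℕ) :
    Holds N L X (update x v y) (update s (.inr (.reg v)) (List.replicate y true)) := by
  refine ⟨by simpa using h.letter, fun v' => ?_, by simpa using h.tab,
    by simpa using h.length_tab, by simpa using h.scr, by simpa using h.cnt⟩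
  by_cases hv : v' = v
  · subst hv; simp
  · simpa [hv] using h.reg v'

/-- Move the stack `k` to the place that is given by variables. -/
def seek (k k' : Loc A I V) : List V → LoopProg (Loc A I V)
  | [] => skip
  | v :: l => seq (repStack (.inr (.reg v)) (.inr .cnt) (movePow k k' l.length)) (seek k k' l)

/-- The place of a tuple is a number in base `N`. Each digit is a unary register, and nested loops
make as many moves as the weight of the digit, so the moves add up to the place. -/
theorem den_seek {k k' : Loc A I V} (hkk : k ≠ k') (hk : k ≠ .inr .cnt) (hk' : k' ≠ .inr .cnt)
    (l : List V) (hl : ∀ v ∈ l, k ≠ .inr (.reg v) ∧ k' ≠ .inr (.reg v)) :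
    ∀ s : Loc A I V → List Bool, (∀ v ∈ l, s (.inr (.reg v)) = List.replicate (x v) true) →
      (∀ v ∈ l, x v ≤ N) → s (.inr .cnt) = [] →
      den N (seek k k' l) s = (move k k')^[place N x l] s := by
  induction l with
  | nil => intro s _ _ _; simp [seek, place, den]
  | cons v l ih =>
    intro s hs hx hc
    have hv := hl v (by simp)
    have h1 : den N (repStack (.inr (.reg v)) (.inr .cnt) (movePow k k' l.length)) s =
        (move k k')^[x v * N ^ l.length] s := by
      rw [den_repStack N (by simp) _ _ s (x v) (hx v (by simp)) (hs v (by simp)) hc, den_movePow,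
        ← iterate_mul, Nat.mul_comm]
      intro s l₁ l₂
      rw [den_movePow, iterate_move hkk, iterate_move hkk]
      have e1 := hv.1
      have e2 := hv.2
      funext j
      simp only [update_apply]
      split_ifs <;> simp_all
    rw [seek, den, h1, ih (fun v hv => hl v (by simp [hv])) _ _ (fun v hv => hx v (by simp [hv])),
      place, Nat.add_comm, iterate_add_apply]
    · rw [iterate_move hkk, update_of_ne hk'.symm, update_of_ne hk.symm, hc]
    · intro w hw
      have e := hl w (by simp [hw])
      rw [iterate_move hkk, update_of_ne e.2.symm, update_of_ne e.1.symm]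
      exact hs w (by simp [hw])

/-- Record in the stack of results whether the stack `k` contains a positive bit at the place that
is given by variables. -/
def look (k : Key A I V) (l : List V) : LoopProg (Loc A I V) :=
  seq (seek (.inr k) (.inr .scr) l)
    (seq (ite (.inr k) (push (.inr .res) true) (push (.inr .res) false))
      (seek (.inr .scr) (.inr k) l))

/-- The part of the stack above the place is turned over onto the scratch stack, the symbol that has
become the top is tested, and the same moves in the opposite direction restore the stack. -/
theorem den_look (h : Holds N L X x s) (hx : ∀ v, x v < N) (k : Key A I V) (l : List V)
    (hk : k ≠ .res ∧ k ≠ .scr ∧ k ≠ .cnt) (hl : ∀ v ∈ l, k ≠ .reg v) :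
    den N (look k l) s = update s (.inr .res)
      (truth ((s (.inr k))[place N x l]? = some true) :: s (.inr .res)) := by
  have hks : (.inr k : Loc A I V) ≠ .inr .scr := by simpa using hk.2.1
  have hkc : (.inr k : Loc A I V) ≠ .inr .cnt := by simpa using hk.2.2
  have hkr : (.inr k : Loc A I V) ≠ .inr .res := by simpa using hk.1
  have hl' : ∀ v ∈ l, (.inr k : Loc A I V) ≠ .inr (.reg v) := by simpa using hl
  rw [look, den, den_seek hks hkc (by simp) l (fun v hv => ⟨hl' v hv, by simp⟩) s
    (fun v _ => h.reg v) (fun v _ => (hx v).le) h.cnt]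
  set n := place N x l
  set S := (move (.inr k) (.inr .scr))^[n] s with hS
  have hS' := hS
  rw [iterate_move hks] at hS'
  have e1 : den N (ite (.inr k) (push (.inr .res) true) (push (.inr .res) false)) S =
      update S (.inr .res) (truth ((s (.inr k))[n]? = some true) :: s (.inr .res)) := by
    have hk1 : S (.inr k) = (s (.inr k)).drop n := by rw [hS']; simp [hks]
    have hr : S (.inr .res) = s (.inr .res) := by rw [hS']; simp [hkr.symm]
    simp only [den, hk1, hr, List.head?_drop]
    split_ifs with h1 <;> simp [h1, truth]
  have e2 : ∀ m, update ((move (.inr k) (.inr .scr))^[m] s) (.inr .res)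
      (truth ((s (.inr k))[n]? = some true) :: s (.inr .res)) =
      (move (.inr k) (.inr .scr))^[m] (update s (.inr .res)
        (truth ((s (.inr k))[n]? = some true) :: s (.inr .res))) := by
    intro m
    rw [iterate_move hks, iterate_move hks]
    funext j
    simp only [update_apply]
    split_ifs <;> simp_all
  rw [den, e1, hS, e2, den_seek hks.symm (by simp) hkc l (fun v hv => ⟨by simp, hl' v hv⟩)
    (x := x), iterate_move_back hks]
  · simp [h.scr]
  · intro v hv
    rw [iterate_move hks, update_of_ne (by simp), update_of_ne (hl' v hv).symm,
      update_of_ne (by simp)]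
    exact h.reg v
  · exact fun v _ => (hx v).le
  · rw [iterate_move hks, update_of_ne (by simp), update_of_ne hkc.symm, update_of_ne (by simp)]
    exact h.cnt

/-- Replace the two topmost results by their conjunction. -/
def andTop : LoopProg (Loc A I V) :=
  ite (.inr .res) (pop (.inr .res)) (seq (pop (.inr .res)) (seq (pop (.inr .res))
    (push (.inr .res) false)))

/-- Replace the two topmost results by their disjunction. -/
def orTop : LoopProg (Loc A I V) :=
  ite (.inr .res) (seq (pop (.inr .res)) (seq (pop (.inr .res))
    (push (.inr .res) true))) (pop (.inr .res))

/-- Negate the topmost result. -/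
def notTop : LoopProg (Loc A I V) :=
  ite (.inr .res) (seq (pop (.inr .res)) (push (.inr .res) false))
    (seq (pop (.inr .res)) (push (.inr .res) true))

theorem den_andTop (b c : Bool) (l : List Bool) :
    den N andTop (update s (.inr .res) (b :: c :: l)) =
      update s (.inr .res) ((b && c) :: l) := by
  cases b <;> simp [andTop, den]

theorem den_notTop (b : Bool) (l : List Bool) :
    den N notTop (update s (.inr .res) (b :: l)) =
      update s (.inr .res) ((!b) :: l) := by
  cases b <;> simp [notTop, den]

/-- Run a program for all values of a variable. -/
def forVar (v : V) (p : LoopProg (Loc A I V)) : LoopProg (Loc A I V) :=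
  forReg (.inr (.reg v)) (.inr (.sav v)) p

theorem den_forVar (h : Holds N L X x s) (hx : ∀ v, x v < N) (k : Key A I V)
    (hk : k = .res ∨ k = .new) (v : V) (p : LoopProg (Loc A I V)) (H : ℕ → List Bool → List Bool)
    (hp : ∀ y < N, ∀ s', Holds N L X (update x v y) s' →
      (k ≠ .new → s' (.inr .new) = s (.inr .new)) → (k ≠ .res → s' (.inr .res) = s (.inr .res)) →
      den N p s' = update s' (.inr k) (H y (s' (.inr k)))) :
    den N (forVar v p) s =
      update s (.inr k) (Nat.rec (s (.inr k)) (fun y l => H y l) N) := by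
  refine den_forReg N (by simp) (by rcases hk with rfl | rfl <;> simp)
    (by rcases hk with rfl | rfl <;> simp) p s (x v) (hx v).le (h.reg v) H fun y hy l => ?_
  rw [hp y hy]
  · rw [update_self, update_idem]
  · exact ((h.update_of _ _ (Or.inr (Or.inr ⟨v, rfl⟩))).update_reg v y).update_of _ _
      (hk.imp id Or.inl)
  · intro hk1
    rw [update_of_ne (by simpa using hk1.symm), update_of_ne (by simp), update_of_ne (by simp)]
  · intro hk1
    rw [update_of_ne (by simpa using hk1.symm), update_of_ne (by simp), update_of_ne (by simp)]

/-- The program that evaluates a formula. -/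
noncomputable def eval : Fml A I V → LoopProg (Loc A I V)
  | .letter a v => look (.letter a) [v]
  | .lt v v' => if v = v' then push (.inr .res) false else look (.reg v') [v]
  | .tab i f => look (.tab i) (Finset.univ.toList.map f)
  | .nand φ ψ => seq (eval φ) (seq (eval ψ) (seq andTop notTop))
  | .ex v φ => seq (push (.inr .res) false) (forVar v (seq (eval φ) orTop))

theorem place_map (f : V → V) (l : List V) : place N x (l.map f) = place N (x ∘ f) l := by
  induction l with
  | nil => rfl
  | cons v l ih => simp [place, ih]

theorem den_eval (φ : Fml A I V) : ∀ (x : V → ℕ) (s : Loc A I V → List Bool),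
    (∀ v, x v < N) → Holds N L X x s → den N (eval φ) s =
      update s (.inr .res) (truth (φ.Sat N L X x) :: s (.inr .res)) := by
  induction φ with
  | letter a v =>
    intro x s hx h
    rw [eval, den_look h hx _ _ (by simp) (by simp)]
    congr 2
    exact truth_congr (by simp [place, h.letter, Fml.Sat])
  | lt v v' =>
    intro x s hx h
    rw [eval]
    split_ifs with hv
    · subst hv; simp [den, Fml.Sat, truth]
    -- The register of `v'` is a stack of `x v'` positive bits, so its entry at place `x v` is
    -- positive exactly if `x v < x v'`. For `v = v'` the stack would be moved while it controls the
    -- loop, hence the separate case.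
    · rw [den_look h hx _ _ (by simp) (by simpa using Ne.symm hv)]
      congr 2
      exact truth_congr (by simp [place, h.reg, List.getElem?_replicate, Fml.Sat])
  | tab i f =>
    intro x s hx h
    rw [eval, den_look h hx _ _ (by simp) (by simp), place_map]
    congr 2
    exact truth_congr (h.tab i (x ∘ f) (fun v => hx _))
  | nand φ ψ h1 h2 =>
    intro x s hx h
    rw [eval, den, h1 x s hx h, den, h2 x _ hx (h.update_of _ _ (Or.inl rfl)), update_self,
      update_idem, den, den_andTop, den_notTop, ← truth_and, ← truth_not]
    congr 2
    exact truth_congr (by rw [Fml.Sat, and_comm])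
  | ex v φ ih =>
    intro x s hx h
    rw [eval, den, den]
    have h' := h.update_of .res (false :: s (.inr .res)) (Or.inl rfl)
    -- The topmost result accumulates the disjunction over the values tried so far, starting from
    -- `false`.
    rw [den_forVar h' hx .res (Or.inl rfl) v _
      (fun y l => if φ.Sat N L X (update x v y) then true :: l.tail else l)]
    · rw [update_idem, update_self]
      congr 1
      have : ∀ m, (Nat.rec (false :: s (.inr .res))
          (fun y l => if φ.Sat N L X (update x v y) then true :: l.tail else l) m :
          List Bool) = truth (∃ y < m, φ.Sat N L X (update x v y)) :: s (.inr .res) := by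
        intro m
        induction m with
        | zero => simp [truth]
        | succ m ihm =>
          simp only [ihm]
          split_ifs with h1
          · rw [List.tail_cons, truth_iff.2 ⟨m, Nat.lt_succ_self m, h1⟩]
          · congr 1
            refine truth_congr (exists_congr fun y => ⟨fun h2 => ⟨by omega, h2.2⟩, fun h2 =>
              ⟨lt_of_le_of_ne (Nat.lt_succ_iff.1 h2.1) ?_, h2.2⟩⟩)
            rintro rfl
            exact h1 h2.2
      rw [this]
      rfl
    · intro y hy s' hs' _ hres
      rw [den, ih (update x v y) s' ?_ hs']
      · unfold orTop
        by_cases h1 : φ.Sat N L X (update x v y) <;> simp [den, truth, h1]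
      · intro w
        by_cases hw : w = v
        · subst hw; simpa using hy
        · simpa [hw] using hx w

end Tables

end LoopProg

namespace LoopProg

open Function Classical

set_option linter.unusedSectionVars false

/-! ### Computation of whole tables -/

section Tables

variable {A I V : Type} [Fintype V] {N : ℕ} {L : A → ℕ → Prop} {X : I → (V → ℕ) → Prop}
  {x : V → ℕ} {s : Loc A I V → List Bool}

/-- The truth values of a predicate, where the variables in the list run through all values. -/
noncomputable def values (N : ℕ) (P : (V → ℕ) → Prop) : List V → (V → ℕ) → List Bool
  | [], x => [truth (P x)]
  | v :: l, x => (List.range N).flatMap fun y => values N P l (update x v y)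

theorem length_values (P : (V → ℕ) → Prop) (l : List V) (x : V → ℕ) :
    (values N P l x).length = N ^ l.length := by
  induction l generalizing x with
  | nil => rfl
  | cons v l ih =>
    simp [values, List.length_flatMap, ih, pow_succ, Nat.mul_comm]

theorem getElem?_flatMap_range {β : Type} (f : ℕ → List β) (M : ℕ) (hf : ∀ y, (f y).length = M)
    (n y j : ℕ) (hy : y < n) (hj : j < M) :
    ((List.range n).flatMap f)[y * M + j]? = (f y)[j]? := by
  induction n with
  | zero => omega
  | succ n ih =>
    have hlen : ((List.range n).flatMap f).length = n * M := by
      simp [List.length_flatMap, hf]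
    rw [List.range_succ, List.flatMap_append, List.flatMap_singleton]
    rcases Nat.lt_succ_iff_lt_or_eq.1 hy with hy | rfl
    · rw [List.getElem?_append_left, ih hy]
      rw [hlen]
      calc y * M + j < y * M + M := by omega
        _ = (y + 1) * M := by ring
        _ ≤ n * M := Nat.mul_le_mul_right _ hy
    · rw [List.getElem?_append_right (by omega), hlen, Nat.add_sub_cancel_left]

theorem place_lt (y : V → ℕ) (hy : ∀ v, y v < N) (l : List V) : place N y l < N ^ l.length := by
  induction l with
  | nil => simp [place]
  | cons v l ih =>
    calc place N y (v :: l) < y v * N ^ l.length + N ^ l.length := by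
          simp only [place]; omega
      _ = (y v + 1) * N ^ l.length := by ring
      _ ≤ N * N ^ l.length := Nat.mul_le_mul_right _ (hy v)
      _ = N ^ (v :: l).length := by rw [List.length_cons, pow_succ, Nat.mul_comm]

/-- The list runs through the tuples lexicographically, with the first variable as the most
significant one, which is the order of `place`. -/
theorem getElem?_values (P : (V → ℕ) → Prop) (l : List V) (hl : l.Nodup) (x y : V → ℕ)
    (hy : ∀ v, y v < N) :
    (values N P l x)[place N y l]? = some (truth (P fun v => if v ∈ l then y v else x v)) := by
  induction l generalizing x with
  | nil => simp [values, place]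
  | cons v l ih =>
    rw [List.nodup_cons] at hl
    rw [values, place, getElem?_flatMap_range _ (N ^ l.length) (fun y => length_values P l _) _ _ _
      (hy v) (place_lt y hy l), ih hl.2]
    congr 3
    funext w
    by_cases h1 : w = v
    · subst h1; simp [hl.1]
    · simp [h1]

/-- Run a program for all values of the variables in the list. -/
def forVars (p : LoopProg (Loc A I V)) : List V → LoopProg (Loc A I V)
  | [] => p
  | v :: l => forVar v (forVars p l)

/-- The truth values are pushed one after the other and hence appear in reverse order; the final
move in `assignTab` undoes the reversal. -/
theorem den_forVars (φ : Fml A I V) (l : List V) : ∀ (x : V → ℕ) (s : Loc A I V → List Bool),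
    (∀ v, x v < N) → Holds N L X x s → s (.inr .res) = [] →
    den N (forVars (seq (eval φ) (mov (.inr .res) (.inr .new))) l) s =
      update s (.inr .new) ((values N (φ.Sat N L X) l x).reverse ++ s (.inr .new)) := by
  induction l with
  | nil =>
    intro x s hx h hres
    rw [forVars, den, den_eval φ x s hx h]
    simp only [den, move, update_self, values, List.reverse_singleton]
    rw [update_idem, hres]
    congr 1
    · rw [← hres, update_eq_self]
    · simp
  | cons v l ih =>
    intro x s hx h hres
    rw [forVars, den_forVar h hx .new (Or.inr rfl) v _
      (fun y r => (values N (φ.Sat N L X) l (update x v y)).reverse ++ r)]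
    · congr 1
      have : ∀ m, (Nat.rec (s (.inr .new))
          (fun y r => (values N (φ.Sat N L X) l (update x v y)).reverse ++ r) m : List Bool) =
          ((List.range m).flatMap fun y => values N (φ.Sat N L X) l (update x v y)).reverse ++
            s (.inr .new) := by
        intro m
        induction m with
        | zero => simp
        | succ m ihm => simp only [ihm]; simp [List.range_succ]
      rw [this]
      rfl
    · intro y hy s' hs' _ hres'
      rw [ih _ s' ?_ hs' ((hres' (by simp)).trans hres)]
      intro w
      by_cases hw : w = v
      · subst hw; simpa using hy
      · simpa [hw] using hx w

/-- The program that computes a table. -/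
noncomputable def assignTab (i : I) (φ : Fml A I V) : LoopProg (Loc A I V) :=
  seq (forVars (seq (eval φ) (mov (.inr .res) (.inr .new))) Finset.univ.toList)
    (seq (popPow (.inr (.tab i)) (Fintype.card V))
      (movePow (.inr .new) (.inr (.tab i)) (Fintype.card V)))

/-- The stacks hold the tables `X`, all the variables have value `0` and nothing is under
construction. -/
def Stores (N : ℕ) (L : A → ℕ → Prop) (X : I → (V → ℕ) → Prop) (s : Loc A I V → List Bool) :
    Prop :=
  Holds N L X 0 s ∧ s (.inr .res) = [] ∧ s (.inr .new) = []

/-- The new table is built on a stack of its own, so `φ` may refer to the old contents of the table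
`i`, which are discarded only afterwards. This is what makes recursive definitions by iterated
assignment possible. -/
theorem stores_assignTab (hN : 0 < N) (h : Stores N L X s) (i : I) (φ : Fml A I V) :
    Stores N L (update X i (φ.Sat N L X)) (den N (assignTab i φ) s) := by
  obtain ⟨h, hres, hnew⟩ := h
  have hval : den N (assignTab i φ) s =
      update s (.inr (.tab i)) (values N (φ.Sat N L X) Finset.univ.toList 0) := by
    have hc : ((values N (φ.Sat N L X) Finset.univ.toList 0).reverse).length ≤
        N ^ Fintype.card V := by
      rw [List.length_reverse, length_values, Finset.length_toList]; rfl
    rw [assignTab, den, den_forVars φ _ 0 s (fun _ => hN) h hres, den, den_popPow, den_movePow,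
      iterate_move (by simp), hnew, List.append_nil]
    rw [update_of_ne (show (Sum.inr (Key.tab i) : Loc A I V) ≠ Sum.inr Key.new by simp),
      List.drop_eq_nil_of_le (h.length_tab i), update_of_ne (by simp), update_self,
      List.drop_eq_nil_of_le hc, List.take_of_length_le hc, List.reverse_reverse]
    funext j
    by_cases h1 : j = .inr (.tab i)
    · subst h1; simp
    · by_cases h2 : j = .inr .new
      · subst h2; simp [hnew]
      · simp [h1, h2]
  rw [hval]
  refine ⟨⟨by simpa using h.letter, by simpa using h.reg, ?_, ?_, by simpa using h.scr,
    by simpa using h.cnt⟩, by simpa using hres, by simpa using hnew⟩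
  · intro j y hy
    by_cases hj : j = i
    · subst hj
      rw [update_self, update_self, getElem?_values _ _ (Finset.nodup_toList _) _ _ hy]
      simp [truth_iff]
    · simpa [hj] using h.tab j y hy
  · intro j
    by_cases hj : j = i
    · subst hj
      rw [update_self, length_values, Finset.length_toList]; rfl
    · simpa [hj] using h.length_tab j

/-- The loop program of a table program. -/
noncomputable def ofTabProg : TabProg A I V → LoopProg (Loc A I V)
  | .skip => skip
  | .assign i φ => assignTab i φ
  | .seq p q => seq (ofTabProg p) (ofTabProg q)
  | .rep p => rep (ofTabProg p)

theorem stores_ofTabProg (hN : 0 < N) (p : TabProg A I V) :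
    ∀ (X : I → (V → ℕ) → Prop) (s : Loc A I V → List Bool), Stores N L X s →
      Stores N L (p.den N L X) (den N (ofTabProg p) s) := by
  induction p with
  | skip => intro X s h; exact h
  | assign i φ => intro X s h; exact stores_assignTab hN h i φ
  | seq p q hp hq => intro X s h; exact hq _ _ (hp _ _ h)
  | rep p hp =>
    intro X s h
    rw [ofTabProg, den, TabProg.den]
    have : ∀ n, Stores N L ((p.den N L)^[n] X) ((den N (ofTabProg p))^[n] s) := by
      intro n
      induction n with
      | zero => exact h
      | succ n ih => rw [iterate_succ_apply', iterate_succ_apply']; exact hp _ _ ih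
    exact this N

/-- Bring the positions of the letters into the right order. -/
def unreverse (l : List A) : LoopProg (Loc A I V) :=
  l.foldr (fun a p => seq (rep (mov (.inl a) (.inr (.letter a)))) p) skip

theorem den_unreverse (l : List A) (hl : l.Nodup) : ∀ s : Loc A I V → List Bool,
    (∀ a ∈ l, (s (.inl a)).length ≤ N) → (∀ a ∈ l, s (.inr (.letter a)) = []) →
    (∀ a ∈ l, den N (unreverse l) s (.inr (.letter a)) = (s (.inl a)).reverse) ∧
    ∀ k, (∀ a ∈ l, k ≠ .letter a) → den N (unreverse l) s (.inr k) = s (.inr k) := by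
  induction l with
  | nil => intro s _ _; exact ⟨by simp, fun k _ => rfl⟩
  | cons a l ih =>
    intro s hs hs'
    rw [List.nodup_cons] at hl
    have h1 : den N (unreverse (a :: l)) s = den N (unreverse l)
        (update (update s (.inl a) []) (.inr (.letter a)) (s (.inl a)).reverse) := by
      change den N (unreverse l) ((move (.inl a) (.inr (.letter a)))^[N] s) = _
      rw [iterate_move (by simp), hs' a (by simp), List.drop_eq_nil_of_le (hs a (by simp)),
        List.take_of_length_le (hs a (by simp)), List.append_nil]
    obtain ⟨h2, h3⟩ := ih hl.2
      (update (update s (.inl a) []) (.inr (.letter a)) (s (.inl a)).reverse)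
      (fun b hb => by
        have : b ≠ a := by rintro rfl; exact hl.1 hb
        simpa [this] using hs b (by simp [hb]))
      (fun b hb => by
        have : b ≠ a := by rintro rfl; exact hl.1 hb
        simpa [this] using hs' b (by simp [hb]))
    rw [h1]
    constructor
    · intro b hb
      rcases List.mem_cons.1 hb with rfl | hb
      · rw [h3 _ (fun b hb => by rintro ⟨⟩; exact hl.1 hb)]; simp
      · rw [h2 b hb, update_of_ne (by simp), update_of_ne]
        intro h; cases h; exact hl.1 hb
    · intro k hk
      rw [h3 k (fun b hb => hk b (by simp [hb])), update_of_ne (by simpa using hk a (by simp)),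
        update_of_ne (by simp)]

end Tables

end LoopProg

/-- If a table program and a formula decide a problem, where positions range over the numbers below
`κ * (ℓ + 1)` for inputs of length `ℓ`, then the problem is solvable in polynomial time. -/
theorem TabProg.polyTimeDecidable {α A I V : Type} [Finite A] [Finite I] [Fintype V]
    (enc : α → List A) (P : α → Prop) (κ : ℕ) (hκ : 0 < κ) (p : TabProg A I V) (φ : Fml A I V)
    (h : ∀ a, φ.Sat (κ * ((enc a).length + 1)) (fun x n => (enc a)[n]? = some x)
      (p.den (κ * ((enc a).length + 1)) (fun x n => (enc a)[n]? = some x) fun _ _ => False) 0 ↔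
      P a) : PolyTimeDecidable enc P := by
  classical
  have := Fintype.ofFinite A
  refine LoopProg.polyTimeDecidable enc P κ (.seq (LoopProg.unreverse Finset.univ.toList)
    (.seq (LoopProg.ofTabProg p) (LoopProg.eval φ))) LoopProg.Key.res fun a => ?_
  set N := κ * ((enc a).length + 1)
  have hN : (enc a).length < N := by
    calc (enc a).length < (enc a).length + 1 := Nat.lt_succ_self _
      _ ≤ N := Nat.le_mul_of_pos_left _ hκ
  rw [← h a]
  simp only [LoopProg.den]
  set s := LoopProg.start (LoopProg.Key A I V) (enc a)
  obtain ⟨h1, h2⟩ := LoopProg.den_unreverse (I := I) (V := V) (N := N) Finset.univ.toList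
    (Finset.nodup_toList _) s (fun x _ => by simp [s, LoopProg.start]; exact hN.le)
    (fun x _ => rfl)
  have h3 : LoopProg.Stores N (fun x n => (enc a)[n]? = some x) (fun _ _ => False)
      (LoopProg.den N (LoopProg.unreverse Finset.univ.toList) s) := by
    refine ⟨⟨fun x n => ?_, fun v => ?_, fun i y _ => ?_, fun i => ?_, ?_, ?_⟩, ?_, ?_⟩
    · rw [h1 x (by simp)]
      simp [s, LoopProg.start]
    all_goals
      rw [h2 _ (by simp)]
      simp [s, LoopProg.start]
  obtain ⟨h4, h5, h6⟩ := LoopProg.stores_ofTabProg (by omega) p _ _ h3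
  rw [LoopProg.den_eval φ 0 _ (fun _ => by simp; omega) h4]
  simp only [Function.update_self, List.head?_cons, Option.some.injEq, LoopProg.truth_iff]
  exact Iff.rfl

/-! ### Definable predicates -/

open Function Classical

set_option linter.unusedSectionVars false

/-- What a formula may speak about: the range of positions, the letters, the tables and the values
of the variables. -/
structure Env (A I V : Type) where
  N : ℕ
  L : A → ℕ → Prop
  X : I → (V → ℕ) → Prop
  x : V → ℕ

namespace Env

variable {A I V : Type}

/-- All the variables denote positions in the range. -/
def Ok (e : Env A I V) : Prop := ∀ v, e.x v < e.N

/-- Change the values of the variables. -/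
def withVars (e : Env A I V) (x : V → ℕ) : Env A I V := { e with x := x }

@[simp] theorem withVars_N (e : Env A I V) (x : V → ℕ) : (e.withVars x).N = e.N := rfl
@[simp] theorem withVars_L (e : Env A I V) (x : V → ℕ) : (e.withVars x).L = e.L := rfl
@[simp] theorem withVars_X (e : Env A I V) (x : V → ℕ) : (e.withVars x).X = e.X := rfl
@[simp] theorem withVars_x (e : Env A I V) (x : V → ℕ) : (e.withVars x).x = x := rfl
@[simp] theorem withVars_withVars (e : Env A I V) (x y : V → ℕ) :
    (e.withVars x).withVars y = e.withVars y := rfl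

theorem Ok.update {e : Env A I V} (h : e.Ok) {v : V} {y : ℕ} (hy : y < e.N) :
    (e.withVars (update e.x v y)).Ok := by
  intro w
  by_cases hw : w = v
  · subst hw; simpa using hy
  · simpa [hw] using h w

end Env

/-- A predicate is definable if it is expressed by a formula. -/
def Dfn {A I V : Type} (P : Env A I V → Prop) : Prop :=
  ∃ φ : Fml A I V, ∀ e : Env A I V, e.Ok → (φ.Sat e.N e.L e.X e.x ↔ P e)

namespace Dfn

variable {A I V : Type} {P Q : Env A I V → Prop}

theorem congr (hP : Dfn P) (h : ∀ e, e.Ok → (P e ↔ Q e)) : Dfn Q := by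
  obtain ⟨φ, hφ⟩ := hP
  exact ⟨φ, fun e he => (hφ e he).trans (h e he)⟩

theorem letter (a : A) (v : V) : Dfn fun e : Env A I V => e.L a (e.x v) :=
  ⟨.letter a v, fun _ _ => Iff.rfl⟩

theorem lt (v v' : V) : Dfn fun e : Env A I V => e.x v < e.x v' := ⟨.lt v v', fun _ _ => Iff.rfl⟩

theorem tab (i : I) (f : V → V) : Dfn fun e : Env A I V => e.X i (e.x ∘ f) :=
  ⟨.tab i f, fun _ _ => Iff.rfl⟩

theorem not (hP : Dfn P) : Dfn fun e => ¬P e := by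
  obtain ⟨φ, hφ⟩ := hP
  exact ⟨.nand φ φ, fun e he => by simp only [Fml.Sat, hφ e he, and_self]⟩

theorem and (hP : Dfn P) (hQ : Dfn Q) : Dfn fun e => P e ∧ Q e := by
  obtain ⟨φ, hφ⟩ := hP
  obtain ⟨ψ, hψ⟩ := hQ
  refine congr (P := fun e => ¬¬(P e ∧ Q e)) (not ⟨.nand φ ψ, fun e he => ?_⟩) fun e _ => not_not
  simp only [Fml.Sat, hφ e he, hψ e he]

theorem or (hP : Dfn P) (hQ : Dfn Q) : Dfn fun e => P e ∨ Q e :=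
  (hP.not.and hQ.not).not.congr fun e _ => by tauto

theorem imp (hP : Dfn P) (hQ : Dfn Q) : Dfn fun e => P e → Q e :=
  (hP.not.or hQ).congr fun e _ => by tauto

theorem iff (hP : Dfn P) (hQ : Dfn Q) : Dfn fun e => (P e ↔ Q e) :=
  ((hP.imp hQ).and (hQ.imp hP)).congr fun e _ => by tauto

theorem ex (v : V) (hP : Dfn P) : Dfn fun e => ∃ y < e.N, P (e.withVars (update e.x v y)) := by
  obtain ⟨φ, hφ⟩ := hP
  exact ⟨.ex v φ, fun e he => exists_congr fun y => and_congr_right fun hy =>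
    hφ (e.withVars (update e.x v y)) (he.update hy)⟩

theorem all (v : V) (hP : Dfn P) : Dfn fun e => ∀ y < e.N, P (e.withVars (update e.x v y)) :=
  (hP.not.ex v).not.congr fun e _ => by push Not; rfl

/-- Existential quantification over a finite set of variables. -/
theorem exs (W : Finset V) (hP : Dfn P) : Dfn fun e => ∃ z : V → ℕ, (∀ v, z v < e.N) ∧
    (∀ v ∉ W, z v = e.x v) ∧ P (e.withVars z) := by
  induction W using Finset.induction_on with
  | empty =>
    refine hP.congr fun e he => ⟨fun h => ⟨e.x, he, fun _ _ => rfl, h⟩, ?_⟩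
    rintro ⟨z, -, hz, h⟩
    rwa [show z = e.x from funext fun v => hz v (Finset.notMem_empty v)] at h
  | insert w W hw ih =>
    refine (ih.ex w).congr fun e he => ⟨?_, ?_⟩
    · rintro ⟨y, hy, z, hz, hzW, h⟩
      refine ⟨z, hz, fun v hv => ?_, h⟩
      rw [Finset.mem_insert, not_or] at hv
      rw [hzW v hv.2]
      simp [hv.1]
    · rintro ⟨z, hz, hzW, h⟩
      refine ⟨z w, hz w, z, hz, fun v hv => ?_, h⟩
      by_cases hvw : v = w
      · subst hvw; simp
      · simpa [hvw] using hzW v (by simp [hv, hvw])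

/-- Universal quantification over a finite set of variables. -/
theorem alls (W : Finset V) (hP : Dfn P) : Dfn fun e => ∀ z : V → ℕ, (∀ v, z v < e.N) →
    (∀ v ∉ W, z v = e.x v) → P (e.withVars z) :=
  (hP.not.exs W).not.congr fun e _ => by push Not; rfl

/-! ### Finite combinations, constants and successors -/

section Nontrivial

variable [Nontrivial V]

theorem false : Dfn fun _ : Env A I V => False := by
  obtain ⟨v⟩ : Nonempty V := inferInstance
  exact (lt v v).congr fun e _ => by simp

theorem true : Dfn fun _ : Env A I V => True := false.not.congr fun e _ => by simp

theorem const (p : Prop) : Dfn fun _ : Env A I V => p := by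
  by_cases h : p
  · exact true.congr fun e _ => by simp [h]
  · exact false.congr fun e _ => by simp [h]

theorem exists_finite {ι : Type*} [Finite ι] {P : ι → Env A I V → Prop} (hP : ∀ i, Dfn (P i)) :
    Dfn fun e => ∃ i, P i e := by
  have := Fintype.ofFinite ι
  have key : ∀ s : Finset ι, Dfn fun e => ∃ i ∈ s, P i e := by
    intro s
    induction s using Finset.induction_on with
    | empty => exact false.congr fun e _ => by simp
    | insert i s _ ih => exact ((hP i).or ih).congr fun e _ => by simp
  exact (key Finset.univ).congr fun e _ => by simp

theorem forall_finite {ι : Type*} [Finite ι] {P : ι → Env A I V → Prop} (hP : ∀ i, Dfn (P i)) :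
    Dfn fun e => ∀ i, P i e :=
  (exists_finite fun i => (hP i).not).not.congr fun e _ => by push Not; rfl

/-- A predicate that depends only on finitely many definable predicates, as far as a class of
environments is concerned, is definable in this class. -/
theorem of_family {ι : Type*} [Finite ι] {Q : ι → Env A I V → Prop} (hQ : ∀ i, Dfn (Q i))
    (Γ P : Env A I V → Prop)
    (h : ∀ e e', Γ e → Γ e' → (∀ i, Q i e ↔ Q i e') → P e → P e') :
    ∃ P', Dfn P' ∧ ∀ e, Γ e → (P' e ↔ P e) := by
  -- The formula is a finite disjunction over the truth patterns `S` of the family that occur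
  -- together with `P` in some environment of the class. Whether a pattern occurs does not depend on
  -- `e`, so it enters as a constant.
  refine ⟨fun e => ∃ S : Set ι, (∃ e', Γ e' ∧ (∀ i, i ∈ S ↔ Q i e') ∧ P e') ∧
    ∀ i, (i ∈ S ↔ Q i e), exists_finite fun S => (const _).and (forall_finite fun i =>
      (const _).iff (hQ i)), fun e he => ⟨?_, fun hP => ?_⟩⟩
  · rintro ⟨S, ⟨e', he', h1, h2⟩, h3⟩
    exact h e' e he' he (fun i => (h1 i).symm.trans (h3 i)) h2
  · exact ⟨{i | Q i e}, ⟨e, he, fun i => Iff.rfl, hP⟩, fun i => Iff.rfl⟩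

theorem eq (v v' : V) : Dfn fun e : Env A I V => e.x v = e.x v' :=
  ((lt v v').not.and (lt v' v).not).congr fun e _ => by omega

/-- A value is at least `n + 1` if some smaller one is at least `n`. Expressing this takes a second
variable, but two variables can be used alternately for all `n`. -/
theorem le_var (n : ℕ) : ∀ v : V, Dfn fun e : Env A I V => n ≤ e.x v := by
  induction n with
  | zero => exact fun v => true.congr fun e _ => by simp
  | succ n ih =>
    intro v
    obtain ⟨w, hw⟩ := exists_ne v
    refine (((lt w v).and (ih w)).ex w).congr fun e he => ⟨?_, fun h => ?_⟩
    · rintro ⟨y, hy, h1, h2⟩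
      simp [hw.symm] at h1 h2
      omega
    · have := he v
      exact ⟨n, by omega, by simp [hw.symm]; omega⟩

theorem var_eq (n : ℕ) (v : V) : Dfn fun e : Env A I V => e.x v = n :=
  ((le_var n v).and (le_var (n + 1) v).not).congr fun e _ => by omega

/-- The successor is the larger number with nothing in between. A number in between would be below
the value of `v'`, hence in the range of the quantified variable `u`. -/
theorem succ {v v' u : V} (hv : u ≠ v) (hv' : u ≠ v') :
    Dfn fun e : Env A I V => e.x v' = e.x v + 1 := by
  refine ((lt v v').and (((lt v u).and (lt u v')).ex u).not).congr fun e he => ?_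
  simp only [Env.withVars_x, update_self, update_of_ne hv.symm, update_of_ne hv'.symm]
  constructor
  · rintro ⟨h1, h2⟩
    by_contra h3
    have := he v'
    exact h2 ⟨e.x v + 1, by omega, by omega, by omega⟩
  · intro h1
    exact ⟨by omega, by rintro ⟨y, -, h2, h3⟩; omega⟩

end Nontrivial

/-- The formula that expresses a definable predicate. -/
noncomputable def fml (hP : Dfn P) : Fml A I V := hP.choose

theorem sat_fml (hP : Dfn P) {N : ℕ} {L : A → ℕ → Prop} {X : I → (V → ℕ) → Prop} {x : V → ℕ}
    (hx : ∀ v, x v < N) : hP.fml.Sat N L X x ↔ P ⟨N, L, X, x⟩ :=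
  hP.choose_spec ⟨N, L, X, x⟩ hx

end Dfn

/-! ### Definable relations depend on finitely many comparisons -/

namespace PLH

open FirstOrder Classical

/-- Two tuples compare in the same way, up to multiplication with constants from `C`. -/
def SameType {ι : Type*} (C : Finset ℚ) (z z' : ι → ℚ) : Prop :=
  ∀ c ∈ C, ∀ i j, cmp (z i) (c * z j) = cmp (z' i) (c * z' j)

theorem SameType.symm {ι : Type*} {C : Finset ℚ} {z z' : ι → ℚ} (h : SameType C z z') :
    SameType C z' z := fun c hc i j => (h c hc i j).symm

theorem SameType.mono {ι : Type*} {C C' : Finset ℚ} {z z' : ι → ℚ} (h : SameType C z z')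
    (hC : C' ⊆ C) : SameType C' z z' := fun c hc i j => h c (hC hc) i j

theorem SameType.comp {ι κ : Type*} {C : Finset ℚ} {z z' : ι → ℚ} (h : SameType C z z')
    (f : κ → ι) : SameType C (z ∘ f) (z' ∘ f) := fun c hc i j => h c hc (f i) (f j)

theorem cmp_swap_congr {x y x' y' : ℚ} (h : cmp x y = cmp x' y') : cmp y x = cmp y' x' := by
  rw [← cmp_swap x y, ← cmp_swap x' y', h]

theorem cmp_mul_congr {x y x' y' : ℚ} (c : ℚ) (h : cmp x y = cmp x' y') :
    cmp (c * x) (c * y) = cmp (c * x') (c * y') := by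
  rcases lt_trichotomy c 0 with hc | rfl | hc
  · rw [cmp_mul_neg_left hc, cmp_mul_neg_left hc, cmp_swap_congr h]
  · simp
  · rw [cmp_mul_pos_left hc, cmp_mul_pos_left hc, h]

theorem cmp_mul_self_congr {t t' : ℚ} (c : ℚ) (h : cmp t 0 = cmp t' 0) :
    cmp t (c * t) = cmp t' (c * t') := by
  have key : ∀ s : ℚ, cmp s (c * s) = cmp (1 * s) (c * s) := fun s => by rw [one_mul]
  rw [key, key]
  rcases lt_trichotomy t 0 with ht | rfl | ht
  · have ht' : t' < 0 := by rwa [cmp_eq_lt_iff _ _ |>.2 ht, eq_comm, cmp_eq_lt_iff] at h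
    rw [cmp_mul_neg_right ht, cmp_mul_neg_right ht']
  · have ht' : t' = 0 := by rwa [cmp_self_eq_eq, eq_comm, cmp_eq_eq_iff] at h
    rw [ht']
  · have ht' : 0 < t' := by rwa [cmp_eq_gt_iff _ _ |>.2 ht, eq_comm, cmp_eq_gt_iff] at h
    rw [cmp_mul_pos_right ht, cmp_mul_pos_right ht']

/-- In a dense order without endpoints, finitely many points can be cut in the same way as points
in the same order. -/
theorem exists_same_cut {κ : Type*} [Finite κ] {p p' : κ → ℚ}
    (h : ∀ a b, cmp (p a) (p b) = cmp (p' a) (p' b)) (t : ℚ) :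
    ∃ t', ∀ a, cmp t (p a) = cmp t' (p' a) := by
  have := Fintype.ofFinite κ
  by_cases ht : ∃ a, t = p a
  · obtain ⟨a, rfl⟩ := ht
    exact ⟨p' a, h a⟩
  · push Not at ht
    obtain ⟨t', h1, h2⟩ := Order.exists_between_finsets
      ((Finset.univ.filter fun a => p a < t).image p') ((Finset.univ.filter fun a => t < p a).image p')
      (by
        intro x hx y hy
        simp only [Finset.mem_image, Finset.mem_filter, Finset.mem_univ, true_and] at hx hy
        obtain ⟨a, ha, rfl⟩ := hx
        obtain ⟨b, hb, rfl⟩ := hy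
        rw [← cmp_eq_lt_iff, ← h, cmp_eq_lt_iff]
        exact ha.trans hb)
    refine ⟨t', fun a => ?_⟩
    rcases lt_or_gt_of_ne (ht a) with hlt | hlt
    · rw [(cmp_eq_lt_iff _ _).2 hlt, eq_comm, cmp_eq_lt_iff]
      exact h2 _ (Finset.mem_image_of_mem _ (by simpa using hlt))
    · rw [(cmp_eq_gt_iff _ _).2 hlt, eq_comm, cmp_eq_gt_iff]
      exact h1 _ (Finset.mem_image_of_mem _ (by simpa using hlt))

/-- The position of `t` relative to the points `d * z i` matters, where `d` is `0`, an element of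
`C` or an inverse of one. The order of these points is known from comparisons with the quotients of
such numbers, which are put into `C'`; so `exists_same_cut` yields `t'`. A comparison of `z i` with
`c * t` is one of `t` with `c⁻¹ * z i`, and one of `t` with `c * t` depends only on the sign of `t`,
which is read off from `d = 0`. -/
theorem exists_extension {ι : Type*} [Finite ι] [Nonempty ι] (C : Finset ℚ) :
    ∃ C' : Finset ℚ, ∀ z z' : ι → ℚ, SameType C' z z' → ∀ t, ∃ t',
      SameType C (fun o : Option ι => o.elim t z) (fun o : Option ι => o.elim t' z') := by
  let D : Finset ℚ := insert 0 (C ∪ C.image (·⁻¹))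
  refine ⟨insert 0 (C ∪ (D ×ˢ D).image fun q => q.2 / q.1), fun z z' h t => ?_⟩
  have h0 : ∀ i, cmp (z i) (0 * z i) = cmp (z' i) (0 * z' i) := fun i =>
    h 0 (Finset.mem_insert_self _ _) i i
  have hC : SameType C z z' := h.mono fun c hc =>
    Finset.mem_insert_of_mem (Finset.mem_union_left _ hc)
  obtain ⟨t', ht'⟩ := exists_same_cut (κ := D × ι) (p := fun a => a.1 * z a.2)
    (p' := fun a => a.1 * z' a.2) (by
      rintro ⟨⟨d, hd⟩, i⟩ ⟨⟨d', hd'⟩, j⟩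
      by_cases h1 : d = 0
      · subst h1
        have := cmp_mul_congr d' (cmp_swap_congr (h0 j))
        simpa using this
      · have h2 := h (d' / d) (Finset.mem_insert_of_mem (Finset.mem_union_right _
          (Finset.mem_image.2 ⟨(d, d'), Finset.mem_product.2 ⟨hd, hd'⟩, rfl⟩))) i j
        have h3 := cmp_mul_congr d h2
        rwa [← mul_assoc, ← mul_assoc, mul_div_cancel₀ _ h1] at h3) t
  have hp : ∀ d ∈ D, ∀ i, cmp t (d * z i) = cmp t' (d * z' i) := fun d hd i => ht' (⟨d, hd⟩, i)
  refine ⟨t', fun c hc i j => ?_⟩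
  have hcD : c ∈ D := Finset.mem_insert_of_mem (Finset.mem_union_left _ hc)
  rcases i with _ | i <;> rcases j with _ | j
  · obtain ⟨i⟩ : Nonempty ι := inferInstance
    exact cmp_mul_self_congr c (by simpa using hp 0 (Finset.mem_insert_self _ _) i)
  · exact hp c hcD j
  · change cmp (z i) (c * t) = cmp (z' i) (c * t')
    by_cases h1 : c = 0
    · subst h1
      simpa using h0 i
    · have h2 := cmp_mul_congr c (cmp_swap_congr (hp c⁻¹ (Finset.mem_insert_of_mem
        (Finset.mem_union_right _ (Finset.mem_image_of_mem _ hc))) i))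
      rwa [← mul_assoc, ← mul_assoc, mul_inv_cancel₀ h1, one_mul, one_mul] at h2
  · exact hC c hc i j

/-- No function symbol takes more than one argument, so a term is a multiple of a single variable or
of `1`. -/
theorem realize_term {β : Type*} (t : language.Term β) :
    ∃ (c : ℚ) (o : Option β), ∀ v : β → ℚ, t.realize v = c * o.elim 1 v := by
  induction t with
  | var b => exact ⟨1, some b, fun v => by simp⟩
  | @func n f ts ih =>
    cases f with
    | one => exact ⟨1, none, fun v => by simp [Language.Term.realize]; rfl⟩
    | scale c =>
      obtain ⟨d, o, h⟩ := ih 0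
      exact ⟨c * d, o, fun v => by
        change c * (ts 0).realize v = _
        rw [h, mul_assoc]⟩

/-- The tuple of the values of the variables of a formula and of the constant `1`. -/
def valuation {α : Type*} {n : ℕ} (v : α → ℚ) (xs : Fin n → ℚ) : Option (α ⊕ Fin n) → ℚ :=
  fun o => o.elim 1 (Sum.elim v xs)

theorem SameType.cmp_mul {ι : Type*} {z z' : ι → ℚ} {c d : ℚ}
    (h : SameType {0, d / c} z z') (i j : ι) :
    cmp (c * z i) (d * z j) = cmp (c * z' i) (d * z' j) := by
  by_cases hc : c = 0
  · subst hc
    have := cmp_mul_congr d (cmp_swap_congr (h 0 (by simp) j j))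
    simpa using this
  · have := cmp_mul_congr c (h (d / c) (by simp) i j)
    rwa [← mul_assoc, ← mul_assoc, mul_div_cancel₀ _ hc] at this

/-- A quantifier is paid for by a larger finite set of coefficients: by `exists_extension`, every
value of the bound variable on one side has a counterpart on the other. One implication is enough,
as the hypothesis is symmetric. -/
theorem exists_realize_iff {α : Type*} [Finite α] {n : ℕ} (φ : language.BoundedFormula α n) :
    ∃ C : Finset ℚ, ∀ (v v' : α → ℚ) (xs xs' : Fin n → ℚ),
      SameType C (valuation v xs) (valuation v' xs') → (φ.Realize v xs ↔ φ.Realize v' xs') := by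
  induction φ with
  | falsum => exact ⟨∅, fun v v' xs xs' _ => Iff.rfl⟩
  | equal t₁ t₂ =>
    obtain ⟨c, i, hc⟩ := realize_term t₁
    obtain ⟨d, j, hd⟩ := realize_term t₂
    refine ⟨{0, d / c}, fun v v' xs xs' h => ?_⟩
    simp only [Language.BoundedFormula.Realize, hc, hd]
    have key := h.cmp_mul (c := c) (d := d) i j
    exact (cmp_eq_eq_iff _ _).symm.trans ((congrArg (· = Ordering.eq) key).to_iff.trans
      (cmp_eq_eq_iff _ _))
  | @rel n l r ts =>
    cases r with
    | lt =>
      obtain ⟨c, i, hc⟩ := realize_term (ts 0)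
      obtain ⟨d, j, hd⟩ := realize_term (ts 1)
      refine ⟨{0, d / c}, fun v v' xs xs' h => ?_⟩
      change ((ts 0).realize _ < (ts 1).realize _) ↔ ((ts 0).realize _ < (ts 1).realize _)
      rw [hc, hd, hc, hd, ← cmp_eq_lt_iff, ← cmp_eq_lt_iff]
      exact (congrArg (· = Ordering.lt) (h.cmp_mul i j)).to_iff
  | imp φ ψ ih₁ ih₂ =>
    obtain ⟨C₁, h₁⟩ := ih₁
    obtain ⟨C₂, h₂⟩ := ih₂
    refine ⟨C₁ ∪ C₂, fun v v' xs xs' h => ?_⟩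
    simp only [Language.BoundedFormula.Realize]
    rw [h₁ v v' xs xs' (h.mono Finset.subset_union_left),
      h₂ v v' xs xs' (h.mono Finset.subset_union_right)]
  | @all n φ ih =>
    obtain ⟨C, hC⟩ := ih
    obtain ⟨C', hC'⟩ := exists_extension (ι := Option (α ⊕ Fin n)) C
    have key : ∀ (v v' : α → ℚ) (xs xs' : Fin n → ℚ),
        SameType C' (valuation v xs) (valuation v' xs') →
        φ.all.Realize v xs → φ.all.Realize v' xs' := by
      intro v v' xs xs' h H t'
      obtain ⟨t, ht⟩ := hC' _ _ h.symm t'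
      refine (hC v v' _ _ ?_).1 (H t)
      -- The bound variable is the last element of `Fin (n + 1)` in the formula, but the outermost
      -- `none` in `exists_extension`; the map translates between the two indexings.
      have := ht.symm.comp fun o : Option (α ⊕ Fin (n + 1)) => match o with
        | none => some none
        | some (.inl a) => some (some (.inl a))
        | some (.inr k) => Fin.lastCases (motive := fun _ => Option (Option (α ⊕ Fin n))) none
            (fun k => some (some (.inr k))) k
      convert this using 1 <;>
      · funext o
        rcases o with _ | a | k
        · rfl
        · rfl
        · refine Fin.lastCases ?_ (fun k => ?_) k <;> simp [valuation]
    exact ⟨C', fun v v' xs xs' h => ⟨key v v' xs xs' h, key v' v xs' xs h.symm⟩⟩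

theorem IsPLH.exists_mem_iff {n : ℕ} {R : Set (Fin n → ℚ)} (h : IsPLH R) :
    ∃ C : Finset ℚ, ∀ x x' : Fin n → ℚ,
      SameType C (fun o : Option (Fin n) => o.elim 1 x) (fun o : Option (Fin n) => o.elim 1 x') →
      (x ∈ R ↔ x' ∈ R) := by
  obtain ⟨φ, rfl⟩ := Set.empty_definable_iff.1 h
  obtain ⟨C, hC⟩ := exists_realize_iff φ
  refine ⟨C, fun x x' hx => ?_⟩
  change Language.BoundedFormula.Realize φ x _ ↔ Language.BoundedFormula.Realize φ x' _
  refine hC x x' _ _ ?_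
  have := hx.comp fun o : Option (Fin n ⊕ Fin 0) => match o with
    | none => none
    | some (.inl a) => some a
    | some (.inr k) => k.elim0
  convert this using 1 <;>
  · funext o
    rcases o with _ | a | k
    · rfl
    · rfl
    · exact k.elim0

end PLH

/-! ### Solutions by monomials -/

namespace PLH

open Filter Topology Classical

section Monomials

variable {G : Finset ℚ}

/-- The monomial with the given exponents in the elements of `G`. -/
def mon (a : G → ℕ) : ℚ := ∏ j : G, (j : ℚ) ^ a j

theorem mon_pos (hG : ∀ g ∈ G, 0 < g) (a : G → ℕ) : 0 < mon a :=
  Finset.prod_pos fun j _ => pow_pos (hG j j.2) _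

@[simp] theorem mon_zero : mon (0 : G → ℕ) = 1 := by simp [mon]

theorem mon_add_single (a : G → ℕ) (j : G) : mon (a + Pi.single j 1) = mon a * j := by
  simp only [mon, Pi.add_apply, pow_add, Finset.prod_mul_distrib]
  congr 1
  rw [Finset.prod_eq_single j]
  · simp
  · intro b _ hb
    simp [hb]
  · simp

/-- A part `A` of a system of weak and strict inequalities between multiples of positive unknowns
is solved by monomials, if strictness is witnessed by a factor `δ`. -/
structure Settled {X : Type*} (α : X → ℚ) (o : X) (δ : ℚ) (A : Finset X) (u : X → ℚ)
    (a : X → G → ℕ) (e : X → ℤ) : Prop where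
  pos : ∀ i, 0 < u i
  mem : o ∈ A
  exp_self : a o = 0
  power_self : e o = 0
  le : ∀ i j, ∀ c : G, α i ≤ c * α j → u i * (if α i < c * α j then δ else 1) ≤ c * u j
  eq : ∀ i ∈ A, u i = mon (a i) * δ ^ e i
  exp_lt : ∀ i ∈ A, ∀ j, a i j < A.card
  power_lt : ∀ i ∈ A, |e i| < A.card

/-- All unknowns outside `A` are multiplied by `ρ`. Inequalities within `A` or within its complement
survive, the others are assumed in `h1` and `h2`. By `heq`, the new value of `m` is a settled value
times one coefficient and a power of `δ` with exponent at most `1` in absolute value, so the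
exponents grow by at most one, as does the size of `A`. -/
theorem Settled.step {X : Type*} [Finite X] {α : X → ℚ} {o : X} {δ : ℚ} {A : Finset X}
    {u : X → ℚ} {a : X → G → ℕ} {e : X → ℤ} (hδ : 1 < δ)
    (h : Settled α o δ A u a e) {ρ : ℚ} (hρ : 0 < ρ) {m : X} (hm : m ∉ A)
    (h1 : ∀ i ∈ A, ∀ j ∉ A, ∀ c : G, α i ≤ c * α j →
      u i * (if α i < c * α j then δ else 1) ≤ c * (ρ * u j))
    (h2 : ∀ i ∉ A, ∀ j ∈ A, ∀ c : G, α i ≤ c * α j →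
      ρ * u i * (if α i < c * α j then δ else 1) ≤ c * u j)
    {i₀ : X} (hi₀ : i₀ ∈ A) {c₀ : G} {ε : ℤ} (hε : |ε| ≤ 1)
    (heq : ρ * u m = u i₀ * c₀ * δ ^ ε) :
    ∃ (u' : X → ℚ) (a' : X → G → ℕ) (e' : X → ℤ), Settled α o δ (insert m A) u' a' e' := by
  have hδ0 : δ ≠ 0 := by positivity
  have hne : ∀ i ∈ A, i ≠ m := fun i hi hh => hm (hh ▸ hi)
  refine ⟨fun i => if i ∈ A then u i else ρ * u i,
    fun i => if i = m then a i₀ + Pi.single c₀ 1 else a i, fun i => if i = m then e i₀ + ε else e i,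
    fun i => ?_, Finset.mem_insert_of_mem h.mem, ?_, ?_, fun i j c hc => ?_, fun i hi => ?_,
    fun i hi j => ?_, fun i hi => ?_⟩
  · have := h.pos i
    split_ifs <;> positivity
  · simp [hne o h.mem, h.exp_self]
  · simp [hne o h.mem, h.power_self]
  · by_cases hi : i ∈ A <;> by_cases hj : j ∈ A
    · rw [if_pos hi, if_pos hj]; exact h.le i j c hc
    · rw [if_pos hi, if_neg hj]; exact h1 i hi j hj c hc
    · rw [if_neg hi, if_pos hj]; exact h2 i hi j hj c hc
    · rw [if_neg hi, if_neg hj, mul_assoc, mul_left_comm (c : ℚ)]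
      exact mul_le_mul_of_nonneg_left (h.le i j c hc) hρ.le
  · rcases Finset.mem_insert.1 hi with rfl | hi
    · simp only [if_neg hm, if_true, heq, h.eq i₀ hi₀, mon_add_single, zpow_add₀ hδ0]
      ring
    · simp only [if_pos hi, if_neg (hne i hi), h.eq i hi]
  · rw [Finset.card_insert_of_notMem hm]
    rcases Finset.mem_insert.1 hi with rfl | hi
    · have h3 := h.exp_lt i₀ hi₀ j
      have h4 : (Pi.single c₀ 1 : G → ℕ) j ≤ 1 := by
        rw [Pi.single_apply]; split_ifs <;> omega
      simp only [if_true, Pi.add_apply]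
      omega
    · have h3 := h.exp_lt i hi j
      simp only [if_neg (hne i hi)]
      omega
  · rw [Finset.card_insert_of_notMem hm]
    push_cast
    rcases Finset.mem_insert.1 hi with rfl | hi
    · have h3 := h.power_lt i₀ hi₀
      have h4 := abs_add_le (e i₀) ε
      simp only [if_true]
      omega
    · have h3 := h.power_lt i hi
      simp only [if_neg (hne i hi)]
      omega

/-- If settled unknowns bound unsettled ones from below, the latter are lowered until the first of
these bounds becomes tight. Otherwise they are raised until an upper bound becomes tight. In both
cases `ρ` is the extremal ratio over finitely many inequalities, and the unknown in the extremal one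
can be settled. -/
theorem Settled.exists_insert {X : Type*} [Finite X] {α : X → ℚ} {o : X} {δ : ℚ} {A : Finset X}
    {u : X → ℚ} {a : X → G → ℕ} {e : X → ℤ} (hG : ∀ g ∈ G, 0 < g) (hG1 : 1 ∈ G)
    (hGi : ∀ g ∈ G, g⁻¹ ∈ G) (hδ : 1 < δ) (h : Settled α o δ A u a e) (hA : ∃ m, m ∉ A) :
    ∃ m ∉ A, ∃ (u' : X → ℚ) (a' : X → G → ℕ) (e' : X → ℤ), Settled α o δ (insert m A) u' a' e' := by
  let w : X → X → G → ℚ := fun i j c => if α i < c * α j then δ else 1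
  have hδ' : 0 < δ := by positivity
  have hw : ∀ i j c, 0 < w i j c := fun i j c => by simp only [w]; split_ifs <;> positivity
  have hc0 : ∀ c : G, (0 : ℚ) < c := fun c => hG c c.2
  have hwε : ∀ i j c, ∃ ε : ℤ, |ε| ≤ 1 ∧ w i j c = δ ^ ε := fun i j c => by
    by_cases hh : α i < c * α j
    · exact ⟨1, by simp, by simp [w, hh]⟩
    · exact ⟨0, by simp, by simp [w, hh]⟩
  by_cases hc : ∃ i ∈ A, ∃ j ∉ A, ∃ c : G, α i ≤ c * α j
  · let T := {t : X × X × G // t.1 ∈ A ∧ t.2.1 ∉ A ∧ α t.1 ≤ t.2.2 * α t.2.1}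
    have : Nonempty T := by
      obtain ⟨i, hi, j, hj, c, hc⟩ := hc
      exact ⟨⟨(i, j, c), hi, hj, hc⟩⟩
    obtain ⟨⟨⟨i, j, c⟩, hi, hj, hc⟩, hmax⟩ := Finite.exists_max fun t : T =>
      u t.1.1 * w t.1.1 t.1.2.1 t.1.2.2 / (t.1.2.2 * u t.1.2.1)
    have hi' := h.pos i
    have hj' := h.pos j
    have hcc := hc0 c
    have hww := hw i j c
    dsimp only at hi hj hc hmax
    obtain ⟨ε, hε, hwε⟩ := hwε i j c
    refine ⟨j, hj, h.step hδ (ρ := u i * w i j c / (c * u j)) (by positivity) hj ?_ ?_ hi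
      (c₀ := ⟨(c : ℚ)⁻¹, hGi c c.2⟩) hε ?_⟩
    · intro i' hi' j' hj' c' hc'
      have h1 := hmax ⟨(i', j', c'), hi', hj', hc'⟩
      have hj'' := h.pos j'
      have := hc0 c'
      rw [div_le_iff₀ (by positivity)] at h1
      linarith
    -- Here `ρ ≤ 1`, since the extremal inequality already holds for `u`; lowering the unsettled
    -- unknowns preserves their upper bounds.
    · intro i' _ j' _ c' hc'
      refine le_trans ?_ (h.le i' j' c' hc')
      have hρ : u i * w i j c / (c * u j) ≤ 1 := (div_le_one (by positivity)).2 (h.le i j c hc)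
      rw [mul_assoc]
      exact mul_le_of_le_one_left (mul_pos (h.pos i') (hw i' j' c')).le hρ
    · rw [← hwε]
      field_simp
  -- An upper bound exists: for the coefficient `1`, `hc` puts every unknown outside `A` strictly
  -- below `o`.
  · push Not at hc
    obtain ⟨m, hm⟩ := hA
    let T := {t : X × X × G // t.1 ∉ A ∧ t.2.1 ∈ A ∧ α t.1 ≤ t.2.2 * α t.2.1}
    have : Nonempty T := by
      have h1 := hc o h.mem m hm ⟨1, hG1⟩
      refine ⟨⟨(m, o, ⟨1, hG1⟩), hm, h.mem, ?_⟩⟩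
      simp only [one_mul] at h1 ⊢
      exact h1.le
    obtain ⟨⟨⟨i, j, c⟩, hi, hj, hcc⟩, hmin⟩ := Finite.exists_min fun t : T =>
      t.1.2.2 * u t.1.2.1 / (u t.1.1 * w t.1.1 t.1.2.1 t.1.2.2)
    have hi' := h.pos i
    have hj' := h.pos j
    have hcp := hc0 c
    have hww := hw i j c
    dsimp only at hi hj hcc hmin
    obtain ⟨ε, hε, hwε⟩ := hwε i j c
    refine ⟨i, hi, h.step hδ (ρ := c * u j / (u i * w i j c)) (by positivity) hi ?_ ?_ hj
      (c₀ := c) (ε := -ε) (by simpa using hε) ?_⟩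
    · intro i' hi' j' hj' c' hc'
      exact absurd hc' (not_le.2 (hc i' hi' j' hj' c'))
    · intro i' hi' j' hj' c' hc'
      have h1 := hmin ⟨(i', j', c'), hi', hj', hc'⟩
      have := h.pos i'
      have := hw i' j' c'
      rw [le_div_iff₀ (by positivity)] at h1
      calc _ = _ := by rw [mul_assoc]
        _ ≤ _ := h1
    · rw [zpow_neg, ← hwε]
      field_simp

/-- A system of comparisons between multiples of positive numbers, one of them `1`, has a solution
by monomials with small exponents in the coefficients and in a number `δ` that is close to `1`. -/
theorem exists_monomial_solution {X : Type*} [Fintype X] {α : X → ℚ} {o : X} {δ : ℚ}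
    (hG : ∀ g ∈ G, 0 < g) (hG1 : 1 ∈ G) (hGi : ∀ g ∈ G, g⁻¹ ∈ G) (hα : ∀ i, 0 < α i)
    (ho : α o = 1) (hδ : 1 < δ) (hδα : ∀ i j, ∀ c : G, α i < c * α j → α i * δ ≤ c * α j) :
    ∃ (a : X → G → ℕ) (e : X → ℤ), a o = 0 ∧ e o = 0 ∧ (∀ i j, a i j < Fintype.card X) ∧
      (∀ i, |e i| < Fintype.card X) ∧ ∀ i j, ∀ c : G, cmp (α i) (c * α j) =
        cmp (mon (a i) * δ ^ e i) (c * (mon (a j) * δ ^ e j)) := by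
  have key : ∀ n, n < Fintype.card X → ∃ (A : Finset X) (u : X → ℚ) (a : X → G → ℕ) (e : X → ℤ),
      A.card = n + 1 ∧ Settled α o δ A u a e := by
    intro n
    induction n with
    | zero =>
      intro _
      -- The given numbers are the initial solution: `α o = 1` is the empty monomial, and `hδα`
      -- supplies the factor `δ` in the strict inequalities.
      refine ⟨{o}, α, 0, 0, by simp, hα, by simp, rfl, rfl, fun i j c hc => ?_, by simp [ho],
        by simp, by simp⟩
      split_ifs with h
      · exact hδα i j c h
      · rwa [mul_one]
    | succ n ih =>
      intro hn
      obtain ⟨A, u, a, e, hA, h⟩ := ih (by omega)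
      have : ∃ m, m ∉ A := by
        by_contra hh
        push Not at hh
        rw [Finset.eq_univ_iff_forall.2 hh, Finset.card_univ] at hA
        omega
      obtain ⟨m, hm, u', a', e', h'⟩ := h.exists_insert hG hG1 hGi hδ this
      exact ⟨insert m A, u', a', e', by rw [Finset.card_insert_of_notMem hm, hA], h'⟩
  have hX : 0 < Fintype.card X := Fintype.card_pos_iff.2 ⟨o⟩
  obtain ⟨A, u, a, e, hA, h⟩ := key (Fintype.card X - 1) (by omega)
  obtain rfl : A = Finset.univ := Finset.eq_univ_of_card A (by omega)
  refine ⟨a, e, h.exp_self, h.power_self, fun i => h.exp_lt i (Finset.mem_univ i),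
    fun i => h.power_lt i (Finset.mem_univ i), fun i j c => ?_⟩
  rw [← h.eq i (Finset.mem_univ i), ← h.eq j (Finset.mem_univ j)]
  have hc : (0 : ℚ) < c := hG c c.2
  have hlt : ∀ i j, ∀ c : G, α i < c * α j → u i < c * u j := fun i j c hh => by
    have h1 := h.le i j c hh.le
    rw [if_pos hh] at h1
    have h2 := h.pos i
    nlinarith
  have hle : ∀ i j, ∀ c : G, α i ≤ c * α j → u i ≤ c * u j := fun i j c hh => by
    rcases hh.lt_or_eq with h1 | h1
    · exact (hlt i j c h1).le
    · have h2 := h.le i j c hh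
      rwa [if_neg h1.not_lt, mul_one] at h2
  have hinv : ∀ x y : ℚ, (x ≤ (c : ℚ)⁻¹ * y ↔ c * x ≤ y) ∧ (x < (c : ℚ)⁻¹ * y ↔ c * x < y) :=
    fun x y => ⟨by rw [inv_mul_eq_div, le_div_iff₀ hc, mul_comm], by
      rw [inv_mul_eq_div, lt_div_iff₀ hc, mul_comm]⟩
  rcases lt_trichotomy (α i) (c * α j) with h1 | h1 | h1
  · rw [(cmp_eq_lt_iff _ _).2 h1, (cmp_eq_lt_iff _ _).2 (hlt i j c h1)]
  -- An equation is a pair of weak inequalities; the opposite one has the coefficient `c⁻¹`, which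
  -- is in `G`.
  · rw [(cmp_eq_eq_iff _ _).2 h1, eq_comm, cmp_eq_eq_iff]
    refine le_antisymm (hle i j c h1.le) ?_
    rw [← (hinv _ _).1]
    exact hle j i ⟨(c : ℚ)⁻¹, hGi c c.2⟩ ((hinv _ _).1.2 h1.ge)
  · rw [(cmp_eq_gt_iff _ _).2 h1, eq_comm, cmp_eq_gt_iff, ← (hinv _ _).2]
    exact hlt j i ⟨(c : ℚ)⁻¹, hGi c c.2⟩ ((hinv _ _).2.2 h1)

theorem eventually_mul_pow_lt {x y : ℚ} (h : x < y) (D : ℕ) : ∀ᶠ δ in 𝓝[>] (1 : ℚ), x * δ ^ D < y := by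
  have h1 : Tendsto (fun δ : ℚ => x * δ ^ D) (𝓝[>] 1) (𝓝 (x * 1 ^ D)) :=
    Tendsto.mono_left (Continuous.tendsto (by fun_prop) 1) nhdsWithin_le_nhds
  exact h1.eventually_lt_const (by simpa using h)

/-- The powers of `δ` below `δ ^ D` do not matter in the comparison of different monomials. -/
def Infinitesimal (G : Finset ℚ) (l D : ℕ) (δ : ℚ) : Prop :=
  1 < δ ∧ ∀ (a a' : G → ℕ) (c : G), (∀ j, a j ≤ l) → (∀ j, a' j ≤ l) → mon a < c * mon a' →
    mon a * δ ^ D < c * mon a'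

/-- With exponents bounded by `l` there are only finitely many strict inequalities, and each of them
tolerates a factor close to `1`. -/
theorem eventually_infinitesimal (G : Finset ℚ) (l D : ℕ) :
    ∀ᶠ δ in 𝓝[>] (1 : ℚ), Infinitesimal G l D δ := by
  have h : ∀ᶠ δ in 𝓝[>] (1 : ℚ), ∀ (a a' : G → Fin (l + 1)) (c : G),
      mon (fun j => (a j).val) < c * mon (fun j => (a' j).val) →
      mon (fun j => (a j).val) * δ ^ D < c * mon (fun j => (a' j).val) := by
    simp only [eventually_all]
    exact fun a a' c h => eventually_mul_pow_lt h D
  filter_upwards [h, self_mem_nhdsWithin] with δ h1 h2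
  refine ⟨h2, fun a a' c ha ha' => ?_⟩
  exact h1 (fun j => ⟨a j, Nat.lt_succ_of_le (ha j)⟩) (fun j => ⟨a' j, Nat.lt_succ_of_le (ha' j)⟩) c

end Monomials

end PLH

/-! ### Codes of sample values -/

namespace PLH

open Filter Topology Classical

section Codes

variable {G : Finset ℚ}

/-- The components of a code: the sign, the exponent of the infinitesimal, and the exponents of the
elements of `G`. -/
abbrev Comp (G : Finset ℚ) : Type := Option (Option G)

/-- The sign that is denoted by a number. -/
def sgn (n : ℕ) : ℚ := if n = 0 then 0 else if n = 1 then 1 else -1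

theorem sgn_cases (n : ℕ) : sgn n = 0 ∨ sgn n = 1 ∨ sgn n = -1 := by
  unfold sgn
  split_ifs <;> simp

/-- The exponents of the elements of `G`. -/
def exps (s : Comp G → ℕ) : G → ℕ := fun j => s (some (some j))

/-- The absolute value of the number with a given code. -/
def magnitude (δ : ℚ) (mid : ℕ) (s : Comp G → ℕ) : ℚ :=
  mon (exps s) * δ ^ s (some none) / δ ^ mid

/-- The number with a given code. -/
def value (δ : ℚ) (mid : ℕ) (s : Comp G → ℕ) : ℚ := sgn (s none) * magnitude δ mid s

/-- The comparison of absolute values in terms of codes. -/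
def cmpMag (c : ℚ) (s s' : Comp G → ℕ) : Ordering :=
  (cmp (mon (exps s)) (c * mon (exps s'))).then (cmp (s (some none)) (s' (some none)))

/-- The comparison of numbers in terms of codes. -/
def cmpCode (c : ℚ) (s s' : Comp G → ℕ) : Ordering :=
  if 0 < sgn (s none) * (c * sgn (s' none)) then
    if 0 < sgn (s none) then cmpMag |c| s s' else (cmpMag |c| s s').swap
  else cmp (sgn (s none)) (c * sgn (s' none))

theorem magnitude_pos (hG : ∀ g ∈ G, 0 < g) {δ : ℚ} (hδ : 0 < δ) (mid : ℕ) (s : Comp G → ℕ) :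
    0 < magnitude δ mid s := by
  have := mon_pos hG (exps s)
  unfold magnitude
  positivity

/-- If the monomials differ, powers of `δ` below `δ ^ D` cannot make up for it; if they are equal,
the exponents of `δ` decide. The case of a larger left-hand side is reduced to the other one by the
coefficient `c⁻¹`. -/
theorem cmp_magnitude (hG : ∀ g ∈ G, 0 < g) (hGi : ∀ g ∈ G, g⁻¹ ∈ G) {l D : ℕ} {δ : ℚ}
    (hδ : Infinitesimal G l D δ) (mid : ℕ) {c : ℚ} (hc : c ∈ G) {s s' : Comp G → ℕ}
    (hs : ∀ j, exps s j ≤ l) (hs' : ∀ j, exps s' j ≤ l) (hsD : s (some none) < D)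
    (hsD' : s' (some none) < D) :
    cmp (magnitude δ mid s) (c * magnitude δ mid s') = cmpMag c s s' := by
  have hδ1 := hδ.1
  have hδ0 : 0 < δ := by linarith
  have hc0 := hG c hc
  have hm := mon_pos hG (exps s)
  have hm' := mon_pos hG (exps s')
  have h1 : ∀ n, 1 ≤ δ ^ n := fun n => one_le_pow₀ hδ1.le
  have h2 : ∀ n, n < D → δ ^ n ≤ δ ^ D := fun n hn => pow_le_pow_right₀ hδ1.le hn.le
  have e1 : magnitude δ mid s = mon (exps s) * δ ^ s (some none) * (δ ^ mid)⁻¹ := by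
    rw [magnitude, div_eq_mul_inv]
  have e2 : c * magnitude δ mid s' = c * mon (exps s') * δ ^ s' (some none) * (δ ^ mid)⁻¹ := by
    rw [magnitude, div_eq_mul_inv]; ring
  rw [e1, e2, cmp_mul_pos_right (by positivity), cmpMag]
  rcases lt_trichotomy (mon (exps s)) (c * mon (exps s')) with h | h | h
  · rw [(cmp_eq_lt_iff _ _).2 h]
    refine (cmp_eq_lt_iff _ _).2 ?_
    calc _ ≤ mon (exps s) * δ ^ D := mul_le_mul_of_nonneg_left (h2 _ hsD) hm.le
      _ < c * mon (exps s') := hδ.2 _ _ ⟨c, hc⟩ hs hs' h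
      _ ≤ _ := le_mul_of_one_le_right (by positivity) (h1 _)
  · rw [(cmp_eq_eq_iff _ _).2 h, ← h, cmp_mul_pos_left hm]
    exact (pow_right_strictMono₀ hδ1).cmp_map_eq _ _
  · rw [(cmp_eq_gt_iff _ _).2 h]
    refine (cmp_eq_gt_iff _ _).2 ?_
    have h3 := hδ.2 (exps s') (exps s) ⟨c⁻¹, hGi c hc⟩ hs' hs
      (by rw [inv_mul_eq_div, lt_div_iff₀ hc0, mul_comm]; exact h)
    rw [inv_mul_eq_div, lt_div_iff₀ hc0] at h3
    calc _ ≤ c * mon (exps s') * δ ^ D := mul_le_mul_of_nonneg_left (h2 _ hsD') (by positivity)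
      _ = mon (exps s') * δ ^ D * c := by ring
      _ < mon (exps s) := h3
      _ ≤ _ := le_mul_of_one_le_right hm.le (h1 _)

theorem cmp_congr_abs {x y x' y' : ℚ} (hx : cmp x 0 = cmp x' 0) (hy : cmp y 0 = cmp y' 0)
    (h : x ≠ 0 → y ≠ 0 → cmp |x| |y| = cmp |x'| |y'|) : cmp x y = cmp x' y' := by
  have key : ∀ {z z' : ℚ}, cmp z 0 = cmp z' 0 →
      (z < 0 ∧ z' < 0) ∨ (z = 0 ∧ z' = 0) ∨ (0 < z ∧ 0 < z') := by
    intro z z' hz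
    rcases lt_trichotomy z 0 with h | h | h
    · rw [(cmp_eq_lt_iff _ _).2 h, eq_comm, cmp_eq_lt_iff] at hz
      exact Or.inl ⟨h, hz⟩
    · rw [(cmp_eq_eq_iff _ _).2 h, eq_comm, cmp_eq_eq_iff] at hz
      exact Or.inr (Or.inl ⟨h, hz⟩)
    · rw [(cmp_eq_gt_iff _ _).2 h, eq_comm, cmp_eq_gt_iff] at hz
      exact Or.inr (Or.inr ⟨h, hz⟩)
  have hlt : x < y → x' < y' → cmp x y = cmp x' y' := fun h h' => by
    rw [(cmp_eq_lt_iff _ _).2 h, (cmp_eq_lt_iff _ _).2 h']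
  have hgt : y < x → y' < x' → cmp x y = cmp x' y' := fun h h' => by
    rw [(cmp_eq_gt_iff _ _).2 h, (cmp_eq_gt_iff _ _).2 h']
  rcases key hx with ⟨h1, h1'⟩ | ⟨h1, h1'⟩ | ⟨h1, h1'⟩ <;>
  rcases key hy with ⟨h2, h2'⟩ | ⟨h2, h2'⟩ | ⟨h2, h2'⟩
  · have := h h1.ne h2.ne
    rw [abs_of_neg h1, abs_of_neg h2, abs_of_neg h1', abs_of_neg h2'] at this
    simpa using cmp_mul_congr (-1) this
  · exact hlt (by linarith) (by linarith)
  · exact hlt (by linarith) (by linarith)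
  · exact hgt (by linarith) (by linarith)
  · rw [h1, h2, h1', h2']
  · exact hlt (by linarith) (by linarith)
  · exact hgt (by linarith) (by linarith)
  · exact hgt (by linarith) (by linarith)
  · have := h h1.ne' h2.ne'
    rwa [abs_of_pos h1, abs_of_pos h2, abs_of_pos h1', abs_of_pos h2'] at this

/-- Signs decide, unless both sides are positive or both are negative; then the absolute values do,
in the reverse order for negative numbers. The right-hand side mentions neither `δ` nor `mid`, so
the codes alone determine the comparison. -/
theorem cmp_value (hG : ∀ g ∈ G, 0 < g) (hGi : ∀ g ∈ G, g⁻¹ ∈ G) {l D : ℕ} {δ : ℚ}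
    (hδ : Infinitesimal G l D δ) (mid : ℕ) {c : ℚ} (hc : c ≠ 0 → |c| ∈ G) {s s' : Comp G → ℕ}
    (hs : ∀ j, exps s j ≤ l) (hs' : ∀ j, exps s' j ≤ l) (hsD : s (some none) < D)
    (hsD' : s' (some none) < D) :
    cmp (value δ mid s) (c * value δ mid s') = cmpCode c s s' := by
  have hδ0 : 0 < δ := by linarith [hδ.1]
  have hm := magnitude_pos hG hδ0 mid s
  have hm' := magnitude_pos hG hδ0 mid s'
  have hzero : ∀ x m : ℚ, 0 < m → cmp (x * m) 0 = cmp x 0 := fun x m hm => by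
    conv_lhs => rw [← zero_mul m]
    rw [cmp_mul_pos_right hm]
  have habs : ∀ n, sgn n ≠ 0 → |sgn n| = 1 := fun n hn => by
    rcases sgn_cases n with h | h | h
    · exact absurd h hn
    · simp [h]
    · simp [h]
  have e : c * value δ mid s' = c * sgn (s' none) * magnitude δ mid s' := by rw [value]; ring
  rw [e, value, cmpCode]
  split_ifs with h1 h2
  · have hc0 : c ≠ 0 := by rintro rfl; simp at h1
    have hs0 : sgn (s' none) ≠ 0 := by intro h; simp [h] at h1
    have h4 : 0 < c * sgn (s' none) := by
      by_contra h5
      nlinarith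
    rw [← cmp_magnitude hG hGi hδ mid (hc hc0) hs hs' hsD hsD']
    refine cmp_congr_abs ?_ ?_ fun _ _ => ?_
    · rw [hzero _ _ hm, (cmp_eq_gt_iff _ _).2 h2, (cmp_eq_gt_iff _ _).2 hm]
    · rw [hzero _ _ hm', (cmp_eq_gt_iff _ _).2 h4, eq_comm, cmp_eq_gt_iff]
      positivity
    · rw [abs_mul, abs_mul, abs_mul, abs_mul, habs _ h2.ne', habs _ hs0, abs_abs, one_mul, mul_one]
  · have hc0 : c ≠ 0 := by rintro rfl; simp at h1
    have hs0 : sgn (s' none) ≠ 0 := by intro h; simp [h] at h1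
    have hs0' : sgn (s none) ≠ 0 := by intro h; simp [h] at h1
    have h3 : sgn (s none) < 0 := lt_of_le_of_ne (not_lt.1 h2) hs0'
    have h4 : c * sgn (s' none) < 0 := by
      by_contra h5
      nlinarith
    rw [← cmp_magnitude hG hGi hδ mid (hc hc0) hs hs' hsD hsD', cmp_swap]
    have key : cmp (|c| * magnitude δ mid s') (magnitude δ mid s) =
        cmp (-magnitude δ mid s) (-(|c| * magnitude δ mid s')) := by
      have := cmp_mul_neg_left (show (-1 : ℚ) < 0 by norm_num) (magnitude δ mid s)
        (|c| * magnitude δ mid s')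
      rw [neg_one_mul, neg_one_mul] at this
      exact this.symm
    rw [key]
    refine cmp_congr_abs ?_ ?_ fun _ _ => ?_
    · rw [hzero _ _ hm, (cmp_eq_lt_iff _ _).2 h3, eq_comm, cmp_eq_lt_iff]
      linarith
    · rw [hzero _ _ hm', (cmp_eq_lt_iff _ _).2 h4, eq_comm, cmp_eq_lt_iff]
      have : 0 < |c| * magnitude δ mid s' := by positivity
      linarith
    · rw [abs_neg, abs_neg, abs_mul, abs_mul, abs_mul, abs_mul, habs _ hs0', habs _ hs0, abs_abs,
        one_mul, mul_one]
  · have h2 : ∀ x : ℚ, x ≤ 0 → x * magnitude δ mid s' ≤ 0 := fun x hx =>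
      mul_nonpos_of_nonpos_of_nonneg hx hm'.le
    rcases sgn_cases (s none) with h | h | h
    · rw [h, zero_mul]
      exact cmp_swap_congr (hzero _ _ hm')
    · rw [h] at h1 ⊢
      rw [one_mul] at h1 ⊢
      rw [(cmp_eq_gt_iff _ _).2, eq_comm, cmp_eq_gt_iff]
      · linarith
      · linarith [h2 _ (not_lt.1 h1)]
    · rw [h] at h1 ⊢
      rw [neg_one_mul] at h1 ⊢
      rw [(cmp_eq_lt_iff _ _).2, eq_comm, cmp_eq_lt_iff]
      · linarith
      · have : 0 ≤ c * sgn (s' none) * magnitude δ mid s' := mul_nonneg (by linarith) hm'.le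
        linarith

/-- Membership of a tuple of numbers in a relation in terms of codes; there is one additional code,
for the number `1`. -/
def MemCode {n : ℕ} (C : Finset ℚ) (R : Set (Fin n → ℚ)) (t : Option (Fin n) → Comp G → ℕ) : Prop :=
  ∃ x ∈ R, ∀ c ∈ C, ∀ i j : Option (Fin n),
    cmp (i.elim 1 x) (c * j.elim 1 x) = cmpCode c (t i) (t j)

/-- Since `MemCode` does not involve `δ`, pruning needs no concrete infinitesimal, and soundness and
completeness may be proved with different ones. -/
theorem memCode_iff (hG : ∀ g ∈ G, 0 < g) (hGi : ∀ g ∈ G, g⁻¹ ∈ G) {l D : ℕ} {δ : ℚ}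
    (hδ : Infinitesimal G l D δ) (mid : ℕ) {n : ℕ} {C : Finset ℚ} {R : Set (Fin n → ℚ)}
    (hC : ∀ c ∈ C, c ≠ 0 → |c| ∈ G) (hR : ∀ x x' : Fin n → ℚ,
      SameType C (fun o : Option (Fin n) => o.elim 1 x) (fun o : Option (Fin n) => o.elim 1 x') →
      (x ∈ R ↔ x' ∈ R)) {t : Option (Fin n) → Comp G → ℕ} (ht : ∀ i j, exps (t i) j ≤ l)
    (htD : ∀ i, t i (some none) < D) (h1 : value δ mid (t none) = 1) :
    MemCode C R t ↔ (fun i => value δ mid (t (some i))) ∈ R := by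
  have key : ∀ c ∈ C, ∀ i j : Option (Fin n),
      cmp (i.elim 1 fun i => value δ mid (t (some i)))
        (c * j.elim 1 fun i => value δ mid (t (some i))) = cmpCode c (t i) (t j) := by
    intro c hc i j
    rw [← cmp_value hG hGi hδ mid (hC c hc) (ht i) (ht j) (htD i) (htD j)]
    have : ∀ i : Option (Fin n), (i.elim 1 fun i => value δ mid (t (some i))) =
        value δ mid (t i) := by
      rintro (_ | i)
      · exact h1.symm
      · rfl
    rw [this, this]
  constructor
  · rintro ⟨x, hx, h⟩
    exact (hR _ _ fun c hc i j => (h c hc i j).trans (key c hc i j).symm).1 hx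
  · exact fun h => ⟨_, h, key⟩

/-- Sample points: every assignment can be replaced by one with values that have small codes. -/
theorem exists_codes (hG : ∀ g ∈ G, 0 < g) (hG1 : 1 ∈ G) (hGi : ∀ g ∈ G, g⁻¹ ∈ G) {V : Type*}
    [Fintype V] (α : V → ℚ) {l : ℕ} (hl : Fintype.card V ≤ l) (D : ℕ) :
    ∃ δ, Infinitesimal G l D δ ∧ ∃ σ : V → Comp G → ℕ, (∀ v j, exps (σ v) j ≤ l) ∧
      (∀ v, σ v (some none) ≤ 2 * l) ∧ (∀ v, σ v none ≤ 2) ∧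
      ∀ C : Finset ℚ, (∀ c ∈ C, c ≠ 0 → |c| ∈ G) →
        SameType C (fun o : Option V => o.elim 1 α)
          (fun o : Option V => o.elim 1 fun v => value δ l (σ v)) := by
  set x : Option V → ℚ := fun o => o.elim 1 α with hx
  let X := {o : Option V // x o ≠ 0}
  have hclose : ∀ᶠ δ in 𝓝[>] (1 : ℚ), ∀ (i j : X) (c : G), |x i| < c * |x j| →
      |x i| * δ ≤ c * |x j| := by
    simp only [eventually_all]
    intro i j c h
    filter_upwards [eventually_mul_pow_lt h 1] with δ hδ
    rw [pow_one] at hδ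
    exact hδ.le
  -- `δ` must be close to `1` both for the monomials with small exponents and for the gaps in the
  -- given assignment.
  obtain ⟨δ, hδ, hδα⟩ := ((eventually_infinitesimal G l D).and hclose).exists
  have hδ0 : 0 < δ := by linarith [hδ.1]
  obtain ⟨a, e, ha0, he0, ha, he, hcmp⟩ := exists_monomial_solution (X := X)
    (α := fun i => |x i|) (o := ⟨none, one_ne_zero⟩) hG hG1 hGi (fun i => abs_pos.2 i.2) (by simp [hx])
    hδ.1 hδα
  have hcard : Fintype.card X ≤ l + 1 := by
    refine (Fintype.card_subtype_le _).trans ?_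
    rw [Fintype.card_option]
    omega
  -- Zero gets the zero code. At most `l + 1` numbers are nonzero, including `1`, so the exponent of
  -- `δ` lies between `-l` and `l`; adding `l` makes it a natural number.
  refine ⟨δ, hδ, fun v c => if h : x (some v) = 0 then 0 else match c with
    | none => if 0 < x (some v) then 1 else 2
    | some none => (e ⟨some v, h⟩ + l).toNat
    | some (some j) => a ⟨some v, h⟩ j, fun v j => ?_, fun v => ?_, fun v => ?_, fun C hC => ?_⟩
  · simp only [exps]
    split_ifs with h
    · omega
    · have := ha ⟨some v, h⟩ j
      omega
  · dsimp only
    split_ifs with h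
    · omega
    · have := he ⟨some v, h⟩
      have := le_abs_self (e ⟨some v, h⟩)
      omega
  · dsimp only
    split_ifs <;> omega
  · set y : Option V → ℚ := fun o => o.elim 1 _ with hy
    have hu : ∀ i : X, 0 < mon (a i) * δ ^ e i := fun i => by
      have := mon_pos hG (a i)
      positivity
    have hy0 : ∀ o, x o = 0 → y o = 0 := by
      rintro (_ | v) h
      · exact absurd h one_ne_zero
      · simp only [hy, Option.elim_some, value, h, dif_pos, sgn, if_pos, zero_mul]
    have hy1 : ∀ (o) (h : x o ≠ 0), y o = (if 0 < x o then 1 else -1) *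
        (mon (a ⟨o, h⟩) * δ ^ e ⟨o, h⟩) := by
      rintro (_ | v) h
      · have e1 : x none = 1 := rfl
        have e2 : y none = 1 := rfl
        rw [e1, e2, if_pos one_pos, ha0, he0]
        simp
      · have h1 := (abs_lt.1 (he ⟨some v, h⟩)).1
        have h2 : ((e ⟨some v, h⟩ + l).toNat : ℤ) = e ⟨some v, h⟩ + l :=
          Int.toNat_of_nonneg (by omega)
        have h3 : δ ^ (e ⟨some v, h⟩ + l).toNat / δ ^ l = δ ^ e ⟨some v, h⟩ := by
          rw [← zpow_natCast, h2, zpow_add₀ hδ0.ne', zpow_natCast, mul_div_assoc,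
            div_self (by positivity), mul_one]
        simp only [hy, Option.elim_some, value, magnitude, dif_neg h]
        rw [mul_div_assoc, h3]
        congr 1
        split_ifs <;> simp [sgn]
    have hsign : ∀ o, cmp (x o) 0 = cmp (y o) 0 := by
      intro o
      by_cases h : x o = 0
      · rw [h, hy0 o h]
      · have := hu ⟨o, h⟩
        rw [hy1 o h]
        split_ifs with h'
        · rw [(cmp_eq_gt_iff _ _).2 h', eq_comm, cmp_eq_gt_iff]
          linarith
        · rw [(cmp_eq_lt_iff _ _).2 (lt_of_le_of_ne (not_lt.1 h') h), eq_comm, cmp_eq_lt_iff]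
          linarith
    have habs : ∀ (o) (h : x o ≠ 0), |y o| = mon (a ⟨o, h⟩) * δ ^ e ⟨o, h⟩ := by
      intro o h
      rw [hy1 o h, abs_mul, abs_of_pos (hu ⟨o, h⟩)]
      split_ifs <;> simp
    intro c hc i j
    refine cmp_congr_abs (hsign i) ?_ fun h1 h2 => ?_
    · have := cmp_mul_congr c (hsign j)
      simpa using this
    · have hc0 : c ≠ 0 := left_ne_zero_of_mul h2
      have hj : x j ≠ 0 := right_ne_zero_of_mul h2
      rw [abs_mul, abs_mul, habs i h1, habs j hj]
      exact hcmp ⟨i, h1⟩ ⟨j, hj⟩ ⟨|c|, hC c hc hc0⟩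

end Codes

/-! ### Max-closed relations and largest remaining values -/

/-- The maximum of the tuples given for the single coordinates stays below `u` and attains every
coordinate. For arity `0` there is no tuple to start with, hence `hn`. -/
theorem MaxClosed.exists_mem {n : ℕ} {R : Set (Fin n → ℚ)} (hR : MaxClosed R)
    (hn : n = 0 → R.Nonempty) (u : Fin n → ℚ)
    (h : ∀ j, ∃ y ∈ R, y j = u j ∧ ∀ i, y i ≤ u i) : u ∈ R := by
  have key : ∀ J : Finset (Fin n), J.Nonempty →
      ∃ y ∈ R, (∀ j ∈ J, y j = u j) ∧ ∀ i, y i ≤ u i := by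
    intro J hJ
    induction hJ using Finset.Nonempty.cons_induction with
    | singleton j =>
      obtain ⟨y, hy, h1, h2⟩ := h j
      exact ⟨y, hy, by simpa using h1, h2⟩
    | cons j J _ _ ih =>
      obtain ⟨y, hy, h1, h2⟩ := h j
      obtain ⟨y', hy', h1', h2'⟩ := ih
      refine ⟨_, hR y hy y' hy', fun i hi => ?_, fun i => max_le (h2 i) (h2' i)⟩
      rcases Finset.mem_cons.1 hi with rfl | hi
      · exact (max_eq_left (by rw [h1]; exact h2' i)).trans h1
      · exact (max_eq_right (by rw [h1' i hi]; exact h2 i)).trans (h1' i hi)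
  rcases Nat.eq_zero_or_pos n with rfl | hn'
  · obtain ⟨y, hy⟩ := hn rfl
    rwa [Subsingleton.elim u y]
  · obtain ⟨y, hy, h1, -⟩ := key Finset.univ ⟨⟨0, hn'⟩, Finset.mem_univ _⟩
    rwa [show u = y from funext fun j => (h1 j (Finset.mem_univ j)).symm]

/-- The values that arc consistency leaves over contain a solution: take the largest ones. -/
theorem exists_solution_of_closed {τ P V S : Type*} {ar : τ → ℕ} {R : (r : τ) → Set (Fin (ar r) → ℚ)}
    (hmax : ∀ r, MaxClosed (R r)) (K : Set (Σ r : τ, Fin (ar r) → P)) (name : P → V) {Q : Set S}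
    (hQ : Q.Finite) (val : S → ℚ) (Rem : P → S → Prop)
    (hclosed : ∀ c ∈ K, ∀ j q s, name q = name (c.2 j) →
      (∀ t : Fin (ar c.1) → S, (∀ i, t i ∈ Q) → t j = s → (fun i => val (t i)) ∈ R c.1 →
        ∃ i, Rem (c.2 i) (t i)) → Rem q s)
    (hne : ∀ c ∈ K, ∀ j, ∃ s ∈ Q, ¬Rem (c.2 j) s)
    (h0 : ∀ c ∈ K, ar c.1 = 0 → (R c.1).Nonempty) :
    ∃ u : V → ℚ, ∀ c ∈ K, (fun j => u (name (c.2 j))) ∈ R c.1 := by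
  have hex : ∀ v, ∃ x : ℚ, (∃ s ∈ Q, ∃ q, name q = v ∧ ¬Rem q s) →
      (∃ s ∈ Q, (∃ q, name q = v ∧ ¬Rem q s) ∧ val s = x) ∧
      ∀ s ∈ Q, (∃ q, name q = v ∧ ¬Rem q s) → val s ≤ x := by
    intro v
    by_cases h : ∃ s ∈ Q, ∃ q, name q = v ∧ ¬Rem q s
    · obtain ⟨s₀, hs₀, hq₀⟩ := h
      obtain ⟨s, ⟨hs, hq⟩, hle⟩ := Set.exists_max_image {s ∈ Q | ∃ q, name q = v ∧ ¬Rem q s} val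
        (hQ.subset (Set.sep_subset _ _)) ⟨s₀, hs₀, hq₀⟩
      exact ⟨val s, fun _ => ⟨⟨s, hs, hq, rfl⟩, fun s' h1 h2 => hle s' ⟨h1, h2⟩⟩⟩
    -- By `hne`, a name without remaining values occurs in no constraint, so any value will do.
    · exact ⟨0, fun h' => absurd h' h⟩
  choose u hu using hex
  refine ⟨u, fun c hc => (hmax c.1).exists_mem (h0 c hc) _ fun j => ?_⟩
  obtain ⟨s₀, hs₀, hr₀⟩ := hne c hc j
  obtain ⟨⟨s, -, ⟨q, hq, hr⟩, hval⟩, -⟩ := hu (name (c.2 j)) ⟨s₀, hs₀, _, rfl, hr₀⟩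
  -- The largest value has not been removed, hence it is supported by a tuple in the relation whose
  -- entries all remain, and these are at most the largest values of their variables.
  have h1 := mt (hclosed c hc j q s hq) hr
  push Not at h1
  obtain ⟨t, htQ, htj, htR, htr⟩ := h1
  refine ⟨_, htR, by rw [htj, hval], fun i => ?_⟩
  exact (hu (name (c.2 i)) ⟨t i, htQ i, _, rfl, htr i⟩).2 _ (htQ i) ⟨_, rfl, htr i⟩

end PLH

/-! ### Tables of the binary digits of monomials -/

open Function Classical

/-- The carry into digit `p` in the multiplication of `F` by `μ`. -/
def mulCarry (μ F p : ℕ) : ℕ := μ * (F % 2 ^ p) / 2 ^ p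

theorem mulCarry_zero (μ F : ℕ) : mulCarry μ F 0 = 0 := by simp [mulCarry, Nat.mod_one]

theorem mulCarry_lt {μ : ℕ} (hμ : 0 < μ) (F p : ℕ) : mulCarry μ F p < μ := by
  rw [mulCarry, Nat.div_lt_iff_lt_mul (by positivity)]
  exact Nat.mul_lt_mul_of_pos_left (Nat.mod_lt _ (by positivity)) hμ

theorem mod_two_pow_succ_eq (F p : ℕ) :
    F % 2 ^ (p + 1) = 2 ^ p * (F.testBit p).toNat + F % 2 ^ p := by
  rw [Nat.mod_pow_succ, Nat.toNat_testBit]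
  ring

/-- School multiplication from the least significant digit on. The carry stays below the constant
`μ`, so each step is a finite case distinction that a formula can make. -/
theorem mulCarry_succ (μ F p : ℕ) :
    mulCarry μ F (p + 1) = (μ * (F.testBit p).toNat + mulCarry μ F p) / 2 := by
  have hp : 0 < 2 ^ p := by positivity
  rw [mulCarry, mulCarry, mod_two_pow_succ_eq, pow_succ, ← Nat.div_div_eq_div_mul, mul_add,
    mul_left_comm, Nat.mul_add_div hp]

theorem testBit_mul_eq (μ F p : ℕ) :
    (μ * F).testBit p = decide ((μ * (F.testBit p).toNat + mulCarry μ F p) % 2 = 1) := by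
  have hp : 0 < 2 ^ p := by positivity
  rw [Nat.testBit_eq_decide_div_mod_eq]
  congr 2
  conv_lhs => rw [← Nat.div_add_mod F (2 ^ (p + 1)), mod_two_pow_succ_eq]
  have e : μ * (2 ^ (p + 1) * (F / 2 ^ (p + 1)) + (2 ^ p * (F.testBit p).toNat + F % 2 ^ p)) =
      2 ^ p * (2 * (μ * (F / 2 ^ (p + 1))) + μ * (F.testBit p).toNat) + μ * (F % 2 ^ p) := by ring
  rw [e, Nat.mul_add_div hp, mulCarry, add_assoc, Nat.mul_add_mod]

/-- Comparison of binary numbers by their most significant different digit. -/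
theorem lt_iff_exists_testBit {a b N : ℕ} (ha : a < 2 ^ N) (hb : b < 2 ^ N) :
    a < b ↔ ∃ p < N, a.testBit p = false ∧ b.testBit p = true ∧
      ∀ q < N, p < q → a.testBit q = b.testBit q := by
  have key : ∀ {a b : ℕ}, a < 2 ^ N → b < 2 ^ N → ∀ p, (∀ q < N, p < q → a.testBit q = b.testBit q) →
      ∀ q, p < q → a.testBit q = b.testBit q := by
    intro a b ha hb p h q hq
    by_cases hqN : q < N
    · exact h q hqN hq
    · have := Nat.pow_le_pow_right (n := 2) two_pos (not_lt.1 hqN)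
      rw [Nat.testBit_lt_two_pow (ha.trans_le this), Nat.testBit_lt_two_pow (hb.trans_le this)]
  constructor
  · intro h
    have hne : ∃ p, a.testBit p ≠ b.testBit p := by
      by_contra hh
      push Not at hh
      exact h.ne (Nat.eq_of_testBit_eq hh)
    have hN : ∀ p, a.testBit p ≠ b.testBit p → p < N := by
      intro p hp
      by_contra hpN
      have := Nat.pow_le_pow_right (n := 2) two_pos (not_lt.1 hpN)
      rw [Nat.testBit_lt_two_pow (ha.trans_le this), Nat.testBit_lt_two_pow (hb.trans_le this)] at hp
      exact hp rfl
    obtain ⟨p₀, hp₀⟩ := hne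
    obtain ⟨p, hp, hmax⟩ := Finset.exists_max_image
      ((Finset.range N).filter fun p => a.testBit p ≠ b.testBit p) id
      ⟨p₀, by simpa using ⟨hN p₀ hp₀, hp₀⟩⟩
    simp only [Finset.mem_filter, Finset.mem_range, id] at hp hmax
    have hq : ∀ q < N, p < q → a.testBit q = b.testBit q := by
      intro q hq hpq
      by_contra hh
      exact absurd (hmax q ⟨hq, hh⟩) (not_le.2 hpq)
    have hbit : a.testBit p = false := by
      by_contra hh
      rw [Bool.not_eq_false] at hh
      have hb' : b.testBit p = false := by
        rw [hh] at hp
        simpa using hp.2.symm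
      exact absurd h (not_lt.2 (Nat.lt_of_testBit p hb' hh
        fun q hpq => (key ha hb p hq q hpq).symm).le)
    exact ⟨p, hp.1, hbit, by
      have := hp.2
      rw [hbit] at this
      simpa using this.symm, hq⟩
  · rintro ⟨p, -, h1, h2, h3⟩
    exact Nat.lt_of_testBit p h1 h2 (key ha hb p h3)

namespace TabProg

variable {A I T V : Type}

/-- Run the programs of a list one after the other. -/
def seqs {B : Type} (f : B → TabProg A I V) : List B → TabProg A I V
  | [] => skip
  | b :: l => seq (f b) (seqs f l)

theorem den_assign_of_ne {N : ℕ} {L : A → ℕ → Prop} {i j : I} (h : j ≠ i) (φ : Fml A I V)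
    (X : I → (V → ℕ) → Prop) : (assign i φ).den N L X j = X j := by
  rw [den, update_of_ne h]

theorem den_assign_self {N : ℕ} {L : A → ℕ → Prop} {i : I} {P : Env A I V → Prop} (hP : Dfn P)
    (X : I → (V → ℕ) → Prop) {x : V → ℕ} (hx : ∀ v, x v < N) :
    (assign i hP.fml).den N L X i x ↔ P ⟨N, L, X, x⟩ := by
  rw [den, update_self, hP.sat_fml hx]

/-! ### Multiplication by powers of constants on tables of digits -/

section Digits

variable (ι : T ⊕ Fin 4 → V) (car big : I)

/-- A table contains the binary digits of the values of a function of the variables. -/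
def IsDigits (N : ℕ) (X : I → (V → ℕ) → Prop) (F : (T → ℕ) → ℕ) : Prop :=
  ∀ x : V → ℕ, (∀ v, x v < N) →
    (X big x ↔ (F fun t => x (ι (.inl t))).testBit (x (ι (.inr 0))) = true)

/-- The recursive description of the carries. -/
def CarryStep (μ : ℕ) (e : Env A I V) : Prop :=
  (e.x (ι (.inr 0)) = 0 ∧ e.x (ι (.inr 1)) = 0) ∨ ∃ y < e.N, (fun e : Env A I V =>
    e.x (ι (.inr 0)) = e.x (ι (.inr 2)) + 1 ∧ ∃ (k : Fin μ) (β : Bool),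
      (∃ y < e.N, (fun e : Env A I V => e.x (ι (.inr 3)) = k ∧
        e.X car (e.x ∘ update (update id (ι (.inr 0)) (ι (.inr 2))) (ι (.inr 1)) (ι (.inr 3))))
        (e.withVars (update e.x (ι (.inr 3)) y))) ∧
      (e.X big (e.x ∘ update id (ι (.inr 0)) (ι (.inr 2))) ↔ β = true) ∧
      e.x (ι (.inr 1)) = (μ * β.toNat + k) / 2) (e.withVars (update e.x (ι (.inr 2)) y))

theorem dfn_carryStep [Nontrivial V] (hι : Injective ι) (μ : ℕ) :
    Dfn (A := A) (CarryStep ι car big μ) := by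
  refine ((Dfn.var_eq 0 _).and (Dfn.var_eq 0 _)).or (Dfn.ex _ ((Dfn.succ (u := ι (.inr 3)) ?_ ?_).and
    (Dfn.exists_finite fun k => Dfn.exists_finite fun β => (Dfn.ex _ ((Dfn.var_eq _ _).and
      (Dfn.tab _ _))).and (((Dfn.tab _ _).iff (Dfn.const _)).and (Dfn.var_eq _ _)))))
  · simp [hι.ne_iff]
  · simp [hι.ne_iff]

/-- The carry into a position is determined by the digit and the carry one position below, so a
table that is right below `m` becomes right below `m + 1`. By `hμN`, the carries are in the range of
the quantifiers. -/
theorem carryStep_iff (hι : Injective ι) {N : ℕ} {L : A → ℕ → Prop} {X : I → (V → ℕ) → Prop}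
    {F : (T → ℕ) → ℕ} (hF : IsDigits ι big N X F) {μ m : ℕ} (hμ : 0 < μ) (hμN : μ ≤ N)
    (hcar : ∀ x : V → ℕ, (∀ v, x v < N) → x (ι (.inr 0)) < m →
      (X car x ↔ x (ι (.inr 1)) = mulCarry μ (F fun t => x (ι (.inl t))) (x (ι (.inr 0)))))
    {x : V → ℕ} (hx : ∀ v, x v < N) (hm : x (ι (.inr 0)) < m + 1) :
    CarryStep ι car big μ (⟨N, L, X, x⟩ : Env A I V) ↔
      x (ι (.inr 1)) = mulCarry μ (F fun t => x (ι (.inl t))) (x (ι (.inr 0))) := by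
  set z : T → ℕ := fun t => x (ι (.inl t)) with hz
  have hcar' : ∀ p < m, p < N → ∀ k < N, (X car ((update (update x (ι (.inr 2)) p) (ι (.inr 3)) k) ∘
      update (update id (ι (.inr 0)) (ι (.inr 2))) (ι (.inr 1)) (ι (.inr 3))) ↔
      k = mulCarry μ (F z) p) := by
    intro p hp hpN k hk
    rw [hcar]
    · simp [hι.eq_iff, hz]
    · intro v
      simp only [comp_apply, update_apply, id]
      split_ifs <;> first | exact hx _ | assumption
    · simpa [hι.eq_iff, update_apply] using hp
  have hbig' : ∀ p < N, (X big (update x (ι (.inr 2)) p ∘ update id (ι (.inr 0)) (ι (.inr 2))) ↔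
      (F z).testBit p = true) := by
    intro p hp
    rw [hF]
    · simp [hι.eq_iff, hz]
    · intro v
      simp only [comp_apply, update_apply, id]
      split_ifs <;> first | exact hx _ | assumption
  have hN := hx (ι (.inr 0))
  simp only [CarryStep, Env.withVars_N, Env.withVars_x, Env.withVars_X, Env.withVars_withVars]
  rcases hv : x (ι (.inr 0)) with _ | p
  · rw [mulCarry_zero]
    simp [hι.eq_iff, hv]
  · have hlt := mulCarry_lt hμ (F z) p
    rw [mulCarry_succ]
    constructor
    · rintro (⟨h, -⟩ | ⟨y, hy, h1, k, β, ⟨w, hw, h2, h3⟩, h4, h5⟩)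
      · omega
      · simp only [update_apply, hι.eq_iff, hv, Sum.inr.injEq, if_true] at h1 h2 h5
        simp only [Fin.reduceEq, if_false] at h1 h5
        obtain rfl : p = y := by omega
        subst h2
        rw [hcar' p (by omega) hy _ hw] at h3
        rw [hbig' p hy] at h4
        rw [h5, ← h3, show β = (F z).testBit p by
          rcases β with _ | _ <;> simpa using h4.symm]
    · intro h
      refine Or.inr ⟨p, by omega, ?_, ⟨mulCarry μ (F z) p, hlt⟩, (F z).testBit p,
        ⟨mulCarry μ (F z) p, by omega, ?_, ?_⟩, ?_, ?_⟩
      · simp [hι.eq_iff, hv]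
      · simp
      · exact (hcar' p (by omega) (by omega) _ (by omega)).2 rfl
      · exact hbig' p (by omega)
      · simpa [update_apply, hι.eq_iff] using h

/-- Compute the table of the carries. -/
noncomputable def carryProg [Nontrivial V] (hι : Injective ι) (μ : ℕ) : TabProg A I V :=
  seq (assign car (Dfn.false (A := A)).fml) (rep (assign car (dfn_carryStep ι car big hι μ).fml))

theorem den_carryProg [Nontrivial V] (hι : Injective ι) (hne : big ≠ car) {N : ℕ}
    {L : A → ℕ → Prop} {X : I → (V → ℕ) → Prop} {F : (T → ℕ) → ℕ} (hF : IsDigits ι big N X F)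
    {μ : ℕ} (hμ : 0 < μ) (hμN : μ ≤ N) :
    (∀ i ≠ car, (carryProg ι car big hι μ).den N L X i = X i) ∧ ∀ x : V → ℕ, (∀ v, x v < N) →
      ((carryProg ι car big hι μ).den N L X car x ↔
        x (ι (.inr 1)) = mulCarry μ (F fun t => x (ι (.inl t))) (x (ι (.inr 0)))) := by
  rw [carryProg, den, den]
  set X₀ := (assign car (Dfn.false (A := A)).fml).den N L X
  have key : ∀ m,
      (∀ i ≠ car, ((assign car (dfn_carryStep ι car big hι μ).fml).den N L)^[m] X₀ i = X i) ∧
      ∀ x : V → ℕ, (∀ v, x v < N) → x (ι (.inr 0)) < m →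
      (((assign car (dfn_carryStep ι car big hι μ).fml).den N L)^[m] X₀ car x ↔
        x (ι (.inr 1)) = mulCarry μ (F fun t => x (ι (.inl t))) (x (ι (.inr 0)))) := by
    intro m
    induction m with
    | zero => exact ⟨fun i hi => den_assign_of_ne hi _ _, fun x _ h => by omega⟩
    | succ m ih =>
      rw [iterate_succ_apply']
      refine ⟨fun i hi => (den_assign_of_ne hi _ _).trans (ih.1 i hi), fun x hx hm => ?_⟩
      rw [den_assign_self _ _ hx]
      refine carryStep_iff ι car big hι (fun x hx => ?_) hμ hμN ih.2 hx hm
      rw [ih.1 big hne]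
      exact hF x hx
  exact ⟨(key N).1, fun x hx => (key N).2 x hx (hx _)⟩

/-- The digits of the products of smaller numbers with `μ`. -/
def DigitStep (t : T) (μ : ℕ) (e : Env A I V) : Prop :=
  (e.x (ι (.inl t)) = 0 ∧ e.X big (e.x ∘ id)) ∨ ∃ y < e.N, (fun e : Env A I V =>
    e.x (ι (.inl t)) = e.x (ι (.inr 2)) + 1 ∧ ∃ (k : Fin μ) (β : Bool),
      (∃ y < e.N, (fun e : Env A I V => e.x (ι (.inr 3)) = k ∧
        e.X car (e.x ∘ update (update id (ι (.inl t)) (ι (.inr 2))) (ι (.inr 1)) (ι (.inr 3))))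
        (e.withVars (update e.x (ι (.inr 3)) y))) ∧
      (e.X big (e.x ∘ update id (ι (.inl t)) (ι (.inr 2))) ↔ β = true) ∧
      (μ * β.toNat + k) % 2 = 1) (e.withVars (update e.x (ι (.inr 2)) y))

theorem dfn_digitStep [Nontrivial V] (hι : Injective ι) (t : T) (μ : ℕ) :
    Dfn (A := A) (DigitStep ι car big t μ) := by
  refine ((Dfn.var_eq 0 _).and (Dfn.tab _ _)).or (Dfn.ex _ ((Dfn.succ (u := ι (.inr 3)) ?_ ?_).and
    (Dfn.exists_finite fun k => Dfn.exists_finite fun β => (Dfn.ex _ ((Dfn.var_eq _ _).and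
      (Dfn.tab _ _))).and (((Dfn.tab _ _).iff (Dfn.const _)).and (Dfn.const _)))))
  · simp [hι.ne_iff]
  · simp [hι.ne_iff]

/-- A digit of a product depends only on digits of `F` at the same or lower positions. Cutting off
at `N` digits is therefore harmless, and no bound for `F` is needed. -/
theorem digitStep_iff (hι : Injective ι) {N : ℕ} {L : A → ℕ → Prop} {X : I → (V → ℕ) → Prop}
    {F : (T → ℕ) → ℕ} (hF : IsDigits ι big N X F) {μ : ℕ} (hμ : 0 < μ) (hμN : μ ≤ N)
    (hcar : ∀ x : V → ℕ, (∀ v, x v < N) →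
      (X car x ↔ x (ι (.inr 1)) = mulCarry μ (F fun t => x (ι (.inl t))) (x (ι (.inr 0)))))
    {x : V → ℕ} (hx : ∀ v, x v < N) (t : T) :
    DigitStep ι car big t μ (⟨N, L, X, x⟩ : Env A I V) ↔
      ((fun z : T → ℕ => if z t = 0 then F z else μ * F (update z t (z t - 1)))
        fun t => x (ι (.inl t))).testBit (x (ι (.inr 0))) = true := by
  set z : T → ℕ := fun t => x (ι (.inl t)) with hz
  have hupd : ∀ p k, (fun t' => (update (update x (ι (.inr 2)) p) (ι (.inr 3)) k ∘
      update (update id (ι (.inl t)) (ι (.inr 2))) (ι (.inr 1)) (ι (.inr 3))) (ι (.inl t'))) =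
      update z t p := by
    intro p k
    funext t'
    by_cases h : t' = t
    · subst h; simp [hι.eq_iff]
    · simp [hι.eq_iff, h, hz]
  have hupd' : ∀ p, (fun t' => (update x (ι (.inr 2)) p ∘
      update id (ι (.inl t)) (ι (.inr 2))) (ι (.inl t'))) = update z t p := by
    intro p
    funext t'
    by_cases h : t' = t
    · subst h; simp
    · simp [hι.eq_iff, h, hz]
  have hcar' : ∀ p < N, ∀ k < N, (X car ((update (update x (ι (.inr 2)) p) (ι (.inr 3)) k) ∘
      update (update id (ι (.inl t)) (ι (.inr 2))) (ι (.inr 1)) (ι (.inr 3))) ↔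
      k = mulCarry μ (F (update z t p)) (x (ι (.inr 0)))) := by
    intro p hpN k hk
    rw [hcar, hupd]
    · simp [hι.eq_iff]
    · intro v
      simp only [comp_apply, update_apply, id]
      split_ifs <;> first | exact hx _ | assumption
  have hbig' : ∀ p < N, (X big (update x (ι (.inr 2)) p ∘ update id (ι (.inl t)) (ι (.inr 2))) ↔
      (F (update z t p)).testBit (x (ι (.inr 0))) = true) := by
    intro p hp
    rw [hF, hupd']
    · simp [hι.eq_iff]
    · intro v
      simp only [comp_apply, update_apply, id]
      split_ifs <;> first | exact hx _ | assumption
  have hN := hx (ι (.inl t))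
  have hzt : z t = x (ι (.inl t)) := rfl
  simp only [DigitStep, Env.withVars_N, Env.withVars_x, Env.withVars_X, Env.withVars_withVars]
  rcases hv : x (ι (.inl t)) with _ | p
  · rw [hv] at hzt
    simp only [hzt, if_true, true_and, comp_id, hF x hx]
    simp [hι.eq_iff, hv, hz]
  · rw [hv] at hzt
    have hlt := mulCarry_lt hμ (F (update z t p)) (x (ι (.inr 0)))
    simp only [hzt, Nat.succ_ne_zero, if_false, Nat.add_sub_cancel, false_and, false_or]
    rw [testBit_mul_eq, decide_eq_true_eq]
    constructor
    · rintro ⟨y, hy, h1, k, β, ⟨w, hw, h2, h3⟩, h4, h5⟩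
      simp only [update_apply, hι.eq_iff, reduceCtorEq, if_false, hv,
          if_true, Nat.add_right_cancel_iff] at h1 h2
      subst h1
      subst h2
      rw [hcar' p hy _ hw] at h3
      rw [hbig' p hy] at h4
      rwa [← h3, show (F (update z t p)).testBit (x (ι (.inr 0))) = β by
          rcases β with _ | _ <;> simpa using h4.symm]
    · intro h
      refine ⟨p, by omega, ?_, ⟨_, hlt⟩, (F (update z t p)).testBit (x (ι (.inr 0))),
        ⟨_, by omega, ?_, (hcar' p (by omega) _ (by omega)).2 rfl⟩, hbig' p (by omega), h⟩
      · simp [hι.eq_iff, hv]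
      · simp

/-- Multiply by the power of `μ` with exponent `t`. -/
noncomputable def powProg [Nontrivial V] (hι : Injective ι) (t : T) (μ : ℕ) : TabProg A I V :=
  rep (seq (carryProg ι car big hι μ) (assign big (dfn_digitStep ι car big hι t μ).fml))

/-- A round replaces the entry for an exponent `z t > 0` by `μ` times the entry for `z t - 1`. Since
`F` does not depend on the coordinate `t`, the exponent of `μ` is `min (z t) m` after `m` rounds,
and `N` rounds suffice because `z t < N`. -/
theorem den_powProg [Nontrivial V] (hι : Injective ι) (hne : big ≠ car) {N : ℕ}
    {L : A → ℕ → Prop} {X : I → (V → ℕ) → Prop} {F : (T → ℕ) → ℕ} (hF : IsDigits ι big N X F)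
    {μ : ℕ} (hμ : 0 < μ) (hμN : μ ≤ N) (t : T) (hFt : ∀ z n, F (update z t n) = F z) :
    (∀ i ≠ car, i ≠ big → (powProg ι car big hι t μ).den N L X i = X i) ∧
      IsDigits ι big N ((powProg ι car big hι t μ).den N L X) fun z => F z * μ ^ z t := by
  rw [powProg, den]
  set p := seq (carryProg ι car big hι μ) (assign big (dfn_digitStep ι car big hι t μ).fml)
  have key : ∀ m, (∀ i ≠ car, i ≠ big → (p.den N L)^[m] X i = X i) ∧
      IsDigits ι big N ((p.den N L)^[m] X) fun z => F z * μ ^ min (z t) m := by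
    intro m
    induction m with
    | zero => exact ⟨fun _ _ _ => rfl, by simpa using hF⟩
    | succ m ih =>
      rw [iterate_succ_apply']
      set Y := (p.den N L)^[m] X
      obtain ⟨h1, h2⟩ := den_carryProg ι car big hι hne (L := L) ih.2 hμ hμN
      set Y' := (carryProg ι car big hι μ).den N L Y
      have e : p.den N L Y = (assign big (dfn_digitStep ι car big hι t μ).fml).den N L Y' := rfl
      rw [e]
      refine ⟨fun i hi hi' => (den_assign_of_ne hi' _ _).trans ((h1 i hi).trans (ih.1 i hi hi')),
        fun x hx => ?_⟩
      rw [den_assign_self _ _ hx, digitStep_iff ι car big hι (F := fun z => F z * μ ^ min (z t) m)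
        (fun x hx => ?_) hμ hμN h2 hx t]
      · dsimp only
        split_ifs with h
        · simp [h]
        · rw [hFt, update_self]
          have : min (x (ι (.inl t))) (m + 1) = min (x (ι (.inl t)) - 1) m + 1 := by omega
          rw [this, pow_succ]
          ring_nf
      · rw [h1 big hne]
        exact ih.2 x hx
  refine ⟨(key N).1, fun x hx => ?_⟩
  rw [(key N).2 x hx]
  dsimp only
  rw [min_eq_left (hx _).le]

theorem den_seqs_powProg [Nontrivial V] (hι : Injective ι) (hne : big ≠ car) {N : ℕ}
    {L : A → ℕ → Prop} {μ : T → ℕ} (hμ : ∀ t, 0 < μ t) (hμN : ∀ t, μ t ≤ N) :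
    ∀ (l : List T) (_ : l.Nodup) (X : I → (V → ℕ) → Prop) (F : (T → ℕ) → ℕ)
      (_ : IsDigits ι big N X F) (_ : ∀ t ∈ l, ∀ z n, F (update z t n) = F z),
      (∀ i ≠ car, i ≠ big →
        (seqs (fun t => powProg ι car big hι t (μ t)) l).den N L X i = X i) ∧
      IsDigits ι big N ((seqs (fun t => powProg ι car big hι t (μ t)) l).den N L X)
        fun z => F z * (l.map fun t => μ t ^ z t).prod
  | [], _, X, F, hF, _ => ⟨fun _ _ _ => rfl, by simpa [seqs, den] using hF⟩
  | t :: l, hl, X, F, hF, hFt => by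
    rw [List.nodup_cons] at hl
    obtain ⟨h1, h2⟩ := den_powProg ι car big hι hne (L := L) hF (hμ t) (hμN t) t
      (hFt t List.mem_cons_self)
    obtain ⟨h3, h4⟩ := den_seqs_powProg hι hne hμ hμN l hl.2 _ _ h2 (by
      intro t' ht' z n
      have : t ≠ t' := fun h => hl.1 (h ▸ ht')
      rw [hFt t' (List.mem_cons_of_mem _ ht'), update_of_ne this])
    refine ⟨fun i hi hi' => (h3 i hi hi').trans (h1 i hi hi'), ?_⟩
    rw [seqs, den]
    simpa only [List.map_cons, List.prod_cons, mul_assoc] using h4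

/-- Compute the table of the binary digits of all monomials. -/
noncomputable def digitsProg [Fintype T] [Nontrivial V] (hι : Injective ι) (μ : T → ℕ) :
    TabProg A I V :=
  seq (assign big (Dfn.var_eq (A := A) 0 (ι (.inr 0))).fml)
    (seqs (fun t => powProg ι car big hι t (μ t)) Finset.univ.toList)

theorem den_digitsProg [Fintype T] [Nontrivial V] (hι : Injective ι) (hne : big ≠ car) {N : ℕ}
    {L : A → ℕ → Prop} {μ : T → ℕ} (hμ : ∀ t, 0 < μ t) (hμN : ∀ t, μ t ≤ N)
    (X : I → (V → ℕ) → Prop) :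
    (∀ i ≠ car, i ≠ big → (digitsProg ι car big hι μ).den N L X i = X i) ∧
      IsDigits ι big N ((digitsProg ι car big hι μ).den N L X) fun z => ∏ t, μ t ^ z t := by
  obtain ⟨h1, h2⟩ := den_seqs_powProg ι car big hι hne (L := L) hμ hμN Finset.univ.toList
    (Finset.nodup_toList _) ((assign big (Dfn.var_eq (A := A) 0 (ι (.inr 0))).fml).den N L X)
    (fun _ => 1) (fun x hx => by
      rw [den_assign_self _ _ hx]
      simp [Nat.testBit_one_eq_true_iff_self_eq_zero]) (fun _ _ _ _ => rfl)
  refine ⟨fun i hi hi' => (h1 i hi hi').trans (den_assign_of_ne hi' _ _), ?_⟩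
  rw [digitsProg, den]
  simpa only [one_mul, Finset.prod_map_toList] using h2

end Digits

end TabProg

/-! ### Arc consistency -/

open Function Classical

/-- The iterates of an increasing operator on the subsets of a finite set become stationary. -/
theorem iterate_stationary {α : Type*} [Finite α] (f : Set α → Set α) (hf : ∀ S, S ⊆ f S) {M : ℕ}
    (hM : Nat.card α ≤ M) : f (f^[M] ∅) = f^[M] ∅ := by
  have hsub : ∀ m, f^[m] ∅ ⊆ f^[m + 1] ∅ := fun m => by
    rw [iterate_succ_apply']
    exact hf _
  by_contra hne
  have hne' : ∀ m ≤ M, f^[m + 1] ∅ ≠ f^[m] ∅ := by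
    intro m hm h
    apply hne
    obtain ⟨k, rfl⟩ := Nat.exists_eq_add_of_le hm
    have hfix : ∀ k, f^[m + k] ∅ = f^[m] ∅ := by
      intro k
      induction k with
      | zero => rfl
      | succ k ih => rw [← add_assoc, iterate_succ_apply', ih, ← iterate_succ_apply' f, h]
    rw [hfix, ← iterate_succ_apply' f, h]
  have hcard : ∀ m ≤ M + 1, m ≤ (f^[m] ∅).ncard := by
    intro m
    induction m with
    | zero => intro _; exact Nat.zero_le _
    | succ m ih =>
      intro hm
      have h1 := ih (by omega)
      have h2 := Set.ncard_lt_ncard ((hsub m).ssubset_of_ne (hne' m (by omega)).symm)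
        (Set.toFinite _)
      omega
  have h1 := hcard (M + 1) le_rfl
  have h2 := Set.ncard_le_card (f^[M + 1] ∅)
  omega

namespace PLH

section Prune

variable {τ : Type} {ar : τ → ℕ} {Nm : Type} {G : Finset ℚ} {N : ℕ}

/-- The code of the number `1`. -/
def oneCode (G : Finset ℚ) (l : ℕ) : Comp G → ℕ
  | none => 1
  | some none => l
  | some (some _) => 0

theorem value_oneCode {δ : ℚ} (hδ : 0 < δ) (l : ℕ) : value δ l (oneCode G l) = 1 := by
  have : exps (oneCode G l) = 0 := rfl
  simp [value, magnitude, this, oneCode, sgn, hδ.ne']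

/-- The exponents in the code are small. -/
def IsValid (l : ℕ) (s : Comp G → ℕ) : Prop := ∀ j, s (some (some j)) ≤ l

/-- Remove a code for a variable if some constraint does not allow it. -/
def prune (R : (r : τ) → Set (Fin (ar r) → ℚ)) (C : τ → Finset ℚ) (l : ℕ) (name : Fin N → Nm)
    (K : Set (Σ r : τ, Fin (ar r) → Fin N)) (Rem : Set (Fin N × (Comp G → Fin N))) :
    Set (Fin N × (Comp G → Fin N)) :=
  Rem ∪ {a | a.1.val < l ∧ ∃ c ∈ K, ∃ j, name a.1 = name (c.2 j) ∧
    ∀ t : Fin (ar c.1) → Comp G → Fin N, (∀ i, IsValid l fun k => (t i k).val) → t j = a.2 →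
      MemCode (C c.1) (R c.1)
        (fun o : Option (Fin (ar c.1)) => o.elim (oneCode G l) fun i k => (t i k).val) →
      ∃ i, (c.2 i, t i) ∈ Rem}

/-- If codes remain everywhere, the process has become stationary by `hM`, and the largest remaining
values for an arbitrary infinitesimal `δ` form a solution. Conversely, a solution has a copy among
the sample values, and the codes of this copy are never removed. -/
theorem prune_correct (hG : ∀ g ∈ G, 0 < g) (hG1 : 1 ∈ G) (hGi : ∀ g ∈ G, g⁻¹ ∈ G)
    {R : (r : τ) → Set (Fin (ar r) → ℚ)} (hmax : ∀ r, MaxClosed (R r)) {C : τ → Finset ℚ}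
    (hC : ∀ r, ∀ c ∈ C r, c ≠ 0 → |c| ∈ G) (hR : ∀ r, ∀ x x' : Fin (ar r) → ℚ,
      SameType (C r) (fun o : Option (Fin (ar r)) => o.elim 1 x)
        (fun o : Option (Fin (ar r)) => o.elim 1 x') → (x ∈ R r ↔ x' ∈ R r)) {l : ℕ}
    (hl : 2 * l + 3 ≤ N) (name : Fin N → Nm) {K : Set (Σ r : τ, Fin (ar r) → Fin N)}
    (hK : ∀ c ∈ K, ∀ j, (c.2 j).val < l) {M : ℕ}
    (hM : Nat.card (Fin N × (Comp G → Fin N)) ≤ M) :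
    (∀ c ∈ K, (ar c.1 = 0 → (R c.1).Nonempty) ∧ ∀ j, ∃ s : Comp G → Fin N,
      IsValid l (fun k => (s k).val) ∧ (c.2 j, s) ∉ (prune R C l name K)^[M] ∅) ↔
    ∃ u : Nm → ℚ, ∀ c ∈ K, (fun j => u (name (c.2 j))) ∈ R c.1 := by
  have hmem : ∀ {δ : ℚ}, Infinitesimal G l N δ → ∀ r, ∀ t : Fin (ar r) → Comp G → Fin N,
      (∀ i, IsValid l fun k => (t i k).val) → (MemCode (C r) (R r)
        (fun o : Option (Fin (ar r)) => o.elim (oneCode G l) fun i k => (t i k).val) ↔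
        (fun i => value δ l fun k => (t i k).val) ∈ R r) := by
    intro δ hδ r t ht
    refine memCode_iff hG hGi hδ l (hC r) (hR r) ?_ ?_ ?_
    · rintro (_ | i) j
      · exact Nat.zero_le _
      · exact ht i j
    · rintro (_ | i)
      · change l < N
        omega
      · exact (t i (some none)).2
    · exact value_oneCode (by linarith [hδ.1]) l
  constructor
  · intro h
    obtain ⟨δ, hδ⟩ := (eventually_infinitesimal G l N).exists
    set F := (prune R C l name K)^[M] ∅ with hF
    have hfix : prune R C l name K F = F :=
      iterate_stationary _ (fun S => Set.subset_union_left) hM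
    -- Positions `q ≥ l` are never pruned; counting all their codes as removed prevents them from
    -- contributing values to a name.
    refine exists_solution_of_closed hmax K name (Q := {s : Comp G → Fin N | IsValid l fun k =>
      (s k).val}) (Set.toFinite _) (fun s => value δ l fun k => (s k).val)
      (fun q s => q.val < l → (q, s) ∈ F) ?_ (fun c hc j => ?_) fun c hc => (h c hc).1
    · intro c hc j q s hq hs hql
      rw [← hfix]
      refine Or.inr ⟨hql, c, hc, j, hq, fun t ht htj htm => ?_⟩
      obtain ⟨i, hi⟩ := hs t ht htj ((hmem hδ c.1 t ht).1 htm)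
      exact ⟨i, hi (hK c hc i)⟩
    · obtain ⟨s, hs, hsF⟩ := (h c hc).2 j
      exact ⟨s, hs, fun h' => hsF (h' (hK c hc j))⟩
  · rintro ⟨u, hu⟩
    let E : Finset Nm := ((Finset.univ : Finset (Fin N)).filter fun q => q.val < l).image name
    have hE : Fintype.card E ≤ l := by
      rw [Fintype.card_coe]
      refine Finset.card_image_le.trans ?_
      have : ((Finset.univ : Finset (Fin N)).filter fun q => q.val < l).card =
          (((Finset.univ : Finset (Fin N)).filter fun q => q.val < l).image Fin.val).card :=
        (Finset.card_image_of_injective _ Fin.val_injective).symm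
      rw [this]
      refine (Finset.card_le_card (t := Finset.range l) ?_).trans (Finset.card_range l).le
      intro x hx
      simp only [Finset.mem_image, Finset.mem_filter, Finset.mem_univ, true_and] at hx
      obtain ⟨q, hq, rfl⟩ := hx
      exact Finset.mem_range.2 hq
    have hmemE : ∀ q : Fin N, q.val < l → name q ∈ E := fun q hq =>
      Finset.mem_image_of_mem _ (by simpa using hq)
    obtain ⟨δ, hδ, σ, hσ1, hσ2, hσ3, hσ⟩ := exists_codes hG hG1 hGi (fun v : E => u v) hE N
    -- Exponents are at most `2 * l` and signs at most `2`; this is the origin of the bound `2 * l +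
    -- 3 ≤ N`.
    have hσN : ∀ v k, σ v k < N := by
      rintro v (_ | _ | j)
      · have := hσ3 v; omega
      · have := hσ2 v; omega
      · have := hσ1 v j
        simp only [exps] at this
        omega
    let s : E → Comp G → Fin N := fun v k => ⟨σ v k, hσN v k⟩
    have hs : ∀ v, IsValid l fun k => (s v k).val := fun v j => hσ1 v j
    -- In every constraint, the copied solution itself supports its codes, so none of them is the
    -- first to be removed.
    have key : ∀ m, ∀ (q : Fin N) (hq : q.val < l),
        (q, s ⟨name q, hmemE q hq⟩) ∉ (prune R C l name K)^[m] ∅ := by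
      intro m
      induction m with
      | zero => intro q hq h; exact h
      | succ m ih =>
        intro q hq h
        rw [iterate_succ_apply'] at h
        rcases h with h | ⟨-, c, hc, j, hn, h⟩
        · exact ih q hq h
        · obtain ⟨i, hi⟩ := h (fun i => s ⟨name (c.2 i), hmemE _ (hK c hc i)⟩) (fun i => hs _)
            (by simp only [hn]) (by
              rw [hmem hδ c.1 _ fun i => hs _]
              refine (hR c.1 _ _ ?_).1 (hu c hc)
              have := (hσ (C c.1) (hC c.1)).comp fun o : Option (Fin (ar c.1)) =>
                o.map fun i => (⟨name (c.2 i), hmemE _ (hK c hc i)⟩ : E)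
              convert this using 1 <;>
              · funext o
                rcases o with _ | i <;> rfl)
          exact ih _ (hK c hc i) hi
    intro c hc
    refine ⟨fun h0 => ⟨_, hu c hc⟩, fun j => ⟨_, hs _, key M _ (hK c hc j)⟩⟩

end Prune

end PLH

/-! ### Words that encode instances -/

namespace CSP

open Classical

section Words

variable {τ : Type}

/-- The letter is a bit. -/
def Letter.IsBit : Letter τ → Bool
  | .bit _ => true
  | _ => false

/-- The name of the variable that is written after the position `q`. -/
def varName (w : List (Letter τ)) (q : ℕ) : List (Letter τ) :=
  (w.drop (q + 1)).takeWhile Letter.IsBit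

/-- The next separator after the position `p` is at the position `q`. -/
def NextComma (w : List (Letter τ)) (p q : ℕ) : Prop :=
  p < q ∧ w[q]? = some .comma ∧ ∀ m, p < m → m < q → w[m]? ≠ some .comma

/-- The arguments of the relation symbol at the position `p` are written after the positions
`q 0`, `q 1`, … -/
def IsArgs (w : List (Letter τ)) (p : ℕ) {k : ℕ} (q : Fin k → ℕ) : Prop :=
  ∀ i : Fin k, NextComma w (if h : i.val = 0 then p else q ⟨i.val - 1, by omega⟩) (q i)

theorem NextComma.unique {w : List (Letter τ)} {p q q' : ℕ} (h : NextComma w p q)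
    (h' : NextComma w p q') : q = q' := by
  rcases lt_trichotomy q q' with hlt | rfl | hlt
  · exact absurd h.2.1 (h'.2.2 q h.1 hlt)
  · rfl
  · exact absurd h'.2.1 (h.2.2 q' h'.1 hlt)

theorem IsArgs.unique {w : List (Letter τ)} {p k : ℕ} {q q' : Fin k → ℕ} (h : IsArgs w p q)
    (h' : IsArgs w p q') : q = q' := by
  have key : ∀ n (hn : n < k), q ⟨n, hn⟩ = q' ⟨n, hn⟩ := by
    intro n
    induction n with
    | zero => exact fun hn => (h ⟨0, hn⟩).unique (h' ⟨0, hn⟩)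
    | succ n ih =>
      intro hn
      have h1 := h ⟨n + 1, hn⟩
      have h2 := h' ⟨n + 1, hn⟩
      simp only [Nat.succ_ne_zero, dif_neg, not_false_eq_true, Nat.add_sub_cancel] at h1 h2
      rw [ih] at h1
      exact h1.unique h2
  exact funext fun i => key i.1 i.2

theorem isBit_of_mem_encodeNat {n : ℕ} {a : Letter τ} (h : a ∈ encodeNat τ n) :
    a.IsBit = true := by
  obtain ⟨b, -, rfl⟩ := List.mem_map.1 h
  rfl

theorem encodeNat_injective : Function.Injective (encodeNat τ) := by
  intro m n h
  have h1 := List.map_injective_iff.2 (fun a b (hab : Letter.bit (τ := τ) a = Letter.bit b) => by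
    cases hab; rfl) h
  rw [← Computability.decode_encodeNat m, h1, Computability.decode_encodeNat]

theorem takeWhile_encodeNat_append (n : ℕ) {r : List (Letter τ)}
    (hr : ∀ a ∈ r.head?, a.IsBit = false) :
    (encodeNat τ n ++ r).takeWhile Letter.IsBit = encodeNat τ n := by
  rw [List.takeWhile_append_of_pos fun a ha => isBit_of_mem_encodeNat ha]
  rcases r with _ | ⟨a, r⟩
  · simp
  · have := hr a (by simp)
    simp [this]

/-- The arguments of a constraint. -/
def encodeArgs (l : List ℕ) : List (Letter τ) := l.flatMap fun v => .comma :: encodeNat τ v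

/-- The positions are those of the separators. The rest `r` must not begin with a bit, since the
last name would run on into it. -/
theorem exists_isArgs (pre : List (Letter τ)) (a : Letter τ) {k : ℕ} (v : Fin k → ℕ)
    {r : List (Letter τ)} (hr : ∀ b ∈ r.head?, b.IsBit = false) :
    ∃ q : Fin k → ℕ, IsArgs (pre ++ a :: (encodeArgs (List.ofFn v) ++ r)) pre.length q ∧
      ∀ i, varName (pre ++ a :: (encodeArgs (List.ofFn v) ++ r)) (q i) = encodeNat τ (v i) := by
  set w := pre ++ a :: (encodeArgs (List.ofFn v) ++ r) with hw
  let q : ℕ → ℕ := fun i => pre.length + 1 +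
    (encodeArgs (τ := τ) ((List.ofFn v).take i)).length
  have hsplit : ∀ i : Fin k, w = (pre ++ a :: encodeArgs ((List.ofFn v).take i)) ++
      .comma :: (encodeNat τ (v i) ++ (encodeArgs ((List.ofFn v).drop (i + 1)) ++ r)) := by
    intro i
    have h1 : List.ofFn v = (List.ofFn v).take i ++ v i :: (List.ofFn v).drop (i + 1) := by
      conv_lhs => rw [← List.take_append_drop i (List.ofFn v)]
      rw [List.drop_eq_getElem_cons (by simp)]
      simp
    rw [hw]
    conv_lhs => rw [h1]
    simp [encodeArgs]
  have hlen : ∀ i : Fin k, (pre ++ a :: encodeArgs ((List.ofFn v).take i)).length = q i := by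
    intro i
    simp [q]
    omega
  have hnext : ∀ i : Fin k, q (i + 1) = q i + 1 + (encodeNat τ (v i)).length := by
    intro i
    have h1 : (List.ofFn v).take (i + 1) = (List.ofFn v).take i ++ [v i] := by
      rw [List.take_add_one]
      simp
    simp only [q, h1, encodeArgs, List.flatMap_append, List.length_append]
    simp
    omega
  have hcomma : ∀ i : Fin k, w[q i]? = some .comma := by
    intro i
    rw [hsplit i, ← hlen i, List.getElem?_append_right le_rfl]
    simp
  have hdrop : ∀ i : Fin k, w.drop (q i + 1) =
      encodeNat τ (v i) ++ (encodeArgs ((List.ofFn v).drop (i + 1)) ++ r) := by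
    intro i
    rw [← List.drop_drop]
    conv_lhs => rw [hsplit i, ← hlen i]
    rw [List.drop_left]
    rfl
  refine ⟨fun i => q i, fun i => ?_, fun i => ?_⟩
  · dsimp only
    split_ifs with h
    · have hq : q i = pre.length + 1 := by simp [q, h, encodeArgs]
      exact ⟨by omega, hcomma i, fun m h1 h2 => by omega⟩
    · let j : Fin k := ⟨i.val - 1, by omega⟩
      have hj : i.val = j + 1 := by simp only [j]; omega
      have hn := hnext j
      rw [← hj] at hn
      change NextComma w (q j) (q i)
      refine ⟨by omega, hcomma i, fun m h1 h2 => ?_⟩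
      have h3 : w[m]? = (w.drop (q j + 1))[m - (q j + 1)]? := by
        rw [List.getElem?_drop]
        congr 1
        omega
      have hlt : m - (q j + 1) < (encodeNat τ (v j)).length := by omega
      rw [h3, hdrop j, List.getElem?_append_left hlt, List.getElem?_eq_getElem hlt]
      intro h4
      have := isBit_of_mem_encodeNat (List.getElem_mem hlt)
      rw [Option.some.inj h4] at this
      exact absurd this (by simp [Letter.IsBit])
  · rw [varName, hdrop i]
    refine takeWhile_encodeNat_append _ ?_
    intro b hb
    rcases hd : (List.ofFn v).drop (i + 1) with _ | ⟨x, l⟩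
    · rw [hd] at hb
      exact hr b (by simpa [encodeArgs] using hb)
    · rw [hd] at hb
      have : b = .comma := by simpa [encodeArgs, eq_comm] using hb
      rw [this]
      rfl

variable {ar : τ → ℕ}

theorem encodeConstraint_eq {n : ℕ} (c : Σ r : τ, Fin (ar r) → Fin n) :
    encodeConstraint c = .rel c.1 :: encodeArgs (List.ofFn fun j => (c.2 j).val) := by
  rw [encodeConstraint, encodeArgs, ← Function.comp_def (fun v : Fin n => v.val) c.2,
    ← List.map_ofFn, List.flatMap_map]

theorem not_mem_encodeArgs (l : List ℕ) (r : τ) : Letter.rel r ∉ encodeArgs (τ := τ) l := by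
  intro h
  obtain ⟨v, -, h⟩ := List.mem_flatMap.1 h
  rcases List.mem_cons.1 h with h | h
  · cases h
  · exact absurd (isBit_of_mem_encodeNat h) (by simp [Letter.IsBit])

theorem head_flatMap_encodeConstraint {n : ℕ} (l : List (Σ r : τ, Fin (ar r) → Fin n)) :
    ∀ b ∈ (l.flatMap encodeConstraint).head?, b.IsBit = false := by
  intro b hb
  rcases l with _ | ⟨c, l⟩
  · simp at hb
  · have : b = .rel c.1 := by simpa [encodeConstraint, eq_comm] using hb
    rw [this]
    rfl

/-- Every occurrence of a relation symbol begins a constraint. -/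
theorem exists_constraint_of_getElem? {n : ℕ} (l : List (Σ r : τ, Fin (ar r) → Fin n))
    (pre : List (Letter τ)) (hpre : ∀ r, Letter.rel r ∉ pre) {p : ℕ} {r : τ}
    (h : (pre ++ l.flatMap encodeConstraint)[p]? = some (.rel r)) :
    ∃ l₁ c l₂, l = l₁ ++ c :: l₂ ∧ c.1 = r ∧ p = (pre ++ l₁.flatMap encodeConstraint).length := by
  induction l generalizing pre p with
  | nil =>
    exact absurd (List.mem_of_getElem? h) (by simpa using hpre r)
  | cons c l ih =>
    rw [List.flatMap_cons, encodeConstraint_eq] at h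
    rcases lt_trichotomy p pre.length with hp | hp | hp
    · rw [List.getElem?_append_left hp] at h
      exact absurd (List.mem_of_getElem? h) (hpre r)
    · refine ⟨[], c, l, rfl, ?_, by simpa using hp⟩
      rw [hp, List.getElem?_append_right le_rfl] at h
      simpa using h
    · rw [List.getElem?_append_right hp.le] at h
      obtain ⟨m, hm⟩ : ∃ m, p - pre.length = m + 1 := ⟨p - pre.length - 1, by omega⟩
      rw [hm, List.cons_append, List.getElem?_cons_succ] at h
      obtain ⟨l₁, c', l₂, h1, h2, h3⟩ := ih _ (fun r => not_mem_encodeArgs _ r) h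
      refine ⟨c :: l₁, c', l₂, by rw [h1]; rfl, h2, ?_⟩
      rw [List.flatMap_cons, encodeConstraint_eq]
      simp only [List.length_append, List.length_cons] at h3 ⊢
      omega

theorem Instance.encode_eq (I : Instance ar) {l₁ l₂} {c} (h : I.constraints = l₁ ++ c :: l₂) :
    I.encode = (encodeNat τ I.numVars ++ l₁.flatMap encodeConstraint) ++ .rel c.1 ::
      (encodeArgs (List.ofFn fun j => (c.2 j).val) ++ l₂.flatMap encodeConstraint) := by
  rw [Instance.encode, h, List.flatMap_append, List.flatMap_cons, encodeConstraint_eq]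
  simp

/-- A solution can be given by values for the names of the variables. -/
theorem Instance.feasible_iff {D : Type} [Nonempty D] (R : (r : τ) → Set (Fin (ar r) → D))
    (I : Instance ar) :
    I.Feasible R ↔ ∃ u : List (Letter τ) → D, ∀ (r : τ) (p : ℕ) (q : Fin (ar r) → ℕ),
      I.encode[p]? = some (.rel r) → IsArgs I.encode p q →
      (fun j => u (varName I.encode (q j))) ∈ R r := by
  constructor
  · rintro ⟨α, hα⟩
    obtain ⟨d⟩ : Nonempty D := inferInstance
    have hinj : Function.Injective fun v : Fin I.numVars => encodeNat τ v.val :=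
      fun v v' h => Fin.ext (encodeNat_injective h)
    refine ⟨Function.extend (fun v : Fin I.numVars => encodeNat τ v.val) α fun _ => d, ?_⟩
    intro r p q hp hq
    obtain ⟨l₁, ⟨r', v⟩, l₂, h1, h2, h3⟩ := exists_constraint_of_getElem? I.constraints
      (encodeNat τ I.numVars) (fun r h => absurd (isBit_of_mem_encodeNat h)
        (by simp [Letter.IsBit])) hp
    dsimp only at h2
    subst h2
    obtain ⟨q', hq', hn⟩ := exists_isArgs (encodeNat τ I.numVars ++ l₁.flatMap encodeConstraint)
      (.rel r') (fun j => (v j).val) (head_flatMap_encodeConstraint l₂)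
    have e := I.encode_eq h1
    dsimp only at e
    rw [← e] at hq' hn
    rw [← h3] at hq'
    obtain rfl := hq.unique hq'
    have := hα ⟨r', v⟩ (by rw [h1]; simp)
    convert this using 2 with j
    rw [hn j]
    exact hinj.extend_apply α _ (v j)
  · rintro ⟨u, hu⟩
    refine ⟨fun v => u (encodeNat τ v.val), fun c hc => ?_⟩
    obtain ⟨l₁, l₂, h1⟩ := List.append_of_mem hc
    obtain ⟨q, hq, hn⟩ := exists_isArgs (encodeNat τ I.numVars ++ l₁.flatMap encodeConstraint)
      (.rel c.1) (fun j => (c.2 j).val) (head_flatMap_encodeConstraint l₂)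
    have e := I.encode_eq h1
    rw [← e] at hq hn
    have := hu c.1 _ q (by rw [e, List.getElem?_append_right le_rfl]; simp) hq
    simpa only [hn] using this

theorem varName_eq_nil {w : List (Letter τ)} {q : ℕ} (h : ∀ b, w[q + 1]? ≠ some (.bit b)) :
    varName w q = [] := by
  rw [varName]
  rcases hd : w.drop (q + 1) with _ | ⟨a, l⟩
  · rfl
  · have : w[q + 1]? = some a := by
      have := congrArg (·[0]?) hd
      simpa using this
    cases a with
    | bit b => exact absurd this (h b)
    | rel r => simp [Letter.IsBit]
    | comma => simp [Letter.IsBit]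

/-- Equality of names, by recursion from the right. -/
theorem varName_eq_iff (w : List (Letter τ)) {q q' : ℕ} :
    varName w q = varName w q' ↔
      ((∀ b, w[q + 1]? ≠ some (.bit b)) ∧ ∀ b, w[q' + 1]? ≠ some (.bit b)) ∨
      ∃ b, w[q + 1]? = some (.bit b) ∧ w[q' + 1]? = some (.bit b) ∧
        varName w (q + 1) = varName w (q' + 1) := by
  have h2 : ∀ q b, w[q + 1]? = some (.bit b) → varName w q = .bit b :: varName w (q + 1) := by
    intro q b h
    obtain ⟨hq, h⟩ := List.getElem?_eq_some_iff.1 h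
    rw [varName, List.drop_eq_getElem_cons hq, h]
    rw [List.takeWhile_cons_of_pos rfl, varName]
  by_cases hq : ∃ b, w[q + 1]? = some (.bit b) <;> by_cases hq' : ∃ b, w[q' + 1]? = some (.bit b)
  · obtain ⟨b, hb⟩ := hq
    obtain ⟨b', hb'⟩ := hq'
    rw [h2 q b hb, h2 q' b' hb']
    constructor
    · intro h
      simp only [List.cons.injEq, Letter.bit.injEq] at h
      obtain ⟨rfl, h⟩ := h
      exact Or.inr ⟨b, hb, hb', h⟩
    · rintro (⟨h, -⟩ | ⟨c, hc, hc', h⟩)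
      · exact absurd hb (h b)
      · rw [hb] at hc
        rw [hb'] at hc'
        cases hc
        cases hc'
        rw [h]
  · obtain ⟨b, hb⟩ := hq
    push Not at hq'
    rw [h2 q b hb, varName_eq_nil hq']
    simp only [List.cons_ne_nil, false_iff]
    rintro (⟨h, -⟩ | ⟨c, hc, hc', h⟩)
    · exact h b hb
    · exact hq' c hc'
  · obtain ⟨b, hb⟩ := hq'
    push Not at hq
    rw [h2 q' b hb, varName_eq_nil hq]
    simp only [List.nil_eq, reduceCtorEq, false_iff]
    rintro (⟨-, h⟩ | ⟨c, hc, hc', h⟩)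
    · exact h b hb
    · exact hq c hc
  · push Not at hq hq'
    rw [varName_eq_nil hq, varName_eq_nil hq']
    simp [hq, hq']

theorem varName_length_lt {w : List (Letter τ)} {q : ℕ} (hq : q < w.length) :
    (varName w q).length < w.length := by
  have h1 : (varName w q).length ≤ (w.drop (q + 1)).length :=
    (List.takeWhile_sublist _).length_le
  rw [List.length_drop] at h1
  omega

theorem varName_length_of_bit {w : List (Letter τ)} {q : ℕ} {b : Bool}
    (h : w[q + 1]? = some (.bit b)) : (varName w q).length = (varName w (q + 1)).length + 1 := by
  obtain ⟨hq, h⟩ := List.getElem?_eq_some_iff.1 h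
  rw [varName, List.drop_eq_getElem_cons hq, h]
  rw [List.takeWhile_cons_of_pos rfl, varName, List.length_cons]

end Words

end CSP

/-! ### Comparison of monomials by formulas -/

open Function Classical

namespace Dfn

variable {A I V : Type} {P : Env A I V → Prop}

/-- Existential quantification over finitely many variables. -/
theorem exsRange {B : Type*} [Finite B] (g : B → V) (hP : Dfn P) :
    Dfn fun e => ∃ z : V → ℕ, (∀ v, z v < e.N) ∧ (∀ v ∉ Set.range g, z v = e.x v) ∧
      P (e.withVars z) :=
  (hP.exs (Set.finite_range g).toFinset).congr fun e _ => by
    simp only [Set.Finite.mem_toFinset]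

/-- Universal quantification over finitely many variables. -/
theorem allsRange {B : Type*} [Finite B] (g : B → V) (hP : Dfn P) :
    Dfn fun e => ∀ z : V → ℕ, (∀ v, z v < e.N) → (∀ v ∉ Set.range g, z v = e.x v) →
      P (e.withVars z) :=
  (hP.alls (Set.finite_range g).toFinset).congr fun e _ => by
    simp only [Set.Finite.mem_toFinset]

end Dfn

namespace PLH

/-! ### Clearing denominators in monomials -/

section Base

variable {G : Finset ℚ}

/-- The numerators and the denominators of the elements of `G`. -/
def base (G : Finset ℚ) (t : G × Bool) : ℕ := if t.2 then (t.1 : ℚ).den else (t.1 : ℚ).num.toNat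

theorem base_pos (hG : ∀ g ∈ G, 0 < g) (t : G × Bool) : 0 < base G t := by
  unfold base
  split_ifs
  · exact Rat.den_pos _
  · have := Rat.num_pos.2 (hG t.1 t.1.2)
    omega

/-- The exponents of the numerators and the denominators. -/
def pair (a b : G → ℕ) (t : G × Bool) : ℕ := if t.2 then b t.1 else a t.1

/-- A product of powers of numerators and of powers of denominators. -/
def monNat (G : Finset ℚ) (z : G × Bool → ℕ) : ℕ := ∏ t, base G t ^ z t

/-- Numerators get the exponents `a` and denominators the exponents `b`. The factor beside `mon a`
is symmetric in `a` and `b`, so it cancels when `pair a b` is compared with `pair b a`. -/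
theorem monNat_pair (hG : ∀ g ∈ G, 0 < g) (a b : G → ℕ) :
    (monNat G (pair a b) : ℚ) = mon a * ((∏ j : G, ((j : ℚ).den : ℚ) ^ a j) *
      ∏ j : G, ((j : ℚ).den : ℚ) ^ b j) := by
  rw [monNat, Fintype.prod_prod_type, mon, ← mul_assoc, ← Finset.prod_mul_distrib,
    ← Finset.prod_mul_distrib]
  push_cast
  refine Finset.prod_congr rfl fun j _ => ?_
  have h1 : ((j : ℚ).num.toNat : ℚ) = (j : ℚ) * ((j : ℚ).den : ℚ) := by
    rw [Rat.mul_den_eq_num]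
    exact_mod_cast Int.toNat_of_nonneg (Rat.num_pos.2 (hG j j.2)).le
  simp only [Fintype.prod_bool, base, pair, if_true, Bool.false_eq_true, if_false]
  rw [h1, mul_pow]
  ring

theorem mon_lt_mon_iff (hG : ∀ g ∈ G, 0 < g) (a b : G → ℕ) :
    mon a < mon b ↔ monNat G (pair a b) < monNat G (pair b a) := by
  have hD : ∀ a : G → ℕ, 0 < ∏ j : G, ((j : ℚ).den : ℚ) ^ a j := fun a =>
    Finset.prod_pos fun j _ => pow_pos (by exact_mod_cast (j : ℚ).den_pos) _
  rw [← Nat.cast_lt (α := ℚ), monNat_pair hG, monNat_pair hG, mul_comm (∏ j : G, _ ^ b j)]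
  exact (mul_lt_mul_iff_left₀ (mul_pos (hD a) (hD b))).symm

/-- This is why `κ * (l + 1)` digit positions are enough. Exponents up to `l + 1` are admitted
because a coefficient in a comparison raises one exponent by one. -/
theorem monNat_lt (hG : ∀ g ∈ G, 0 < g) {κ l : ℕ} (hκ : ∏ t, base G t < κ) {z : G × Bool → ℕ}
    (hz : ∀ t, z t ≤ l + 1) : monNat G z < 2 ^ (κ * (l + 1)) := by
  calc monNat G z ≤ ∏ t, base G t ^ (l + 1) := Finset.prod_le_prod' fun t _ =>
        Nat.pow_le_pow_right (base_pos hG t) (hz t)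
    _ = (∏ t, base G t) ^ (l + 1) := Finset.prod_pow _ _ _
    _ < (2 ^ κ) ^ (l + 1) := Nat.pow_lt_pow_left (hκ.trans Nat.lt_two_pow_self) (by omega)
    _ = _ := (pow_mul _ _ _).symm

end Base

/-! ### Variables of the formulas and comparison of codes -/

section Vars

variable {τ : Type} (ar : τ → ℕ) (G : Finset ℚ)

/-- Names for positions and for codes: a distinguished one, another one, and one for each argument
of each relation symbol. -/
abbrev Slot : Type := Option (Option (Σ r : τ, Fin (ar r)))

/-- The variables: positions, components of codes and auxiliary variables. -/
inductive Var : Type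
  | pos (o : Slot ar)
  | code (o : Slot ar) (k : Comp G)
  | aux (i : Fin 6)

variable {ar G}

instance [Finite τ] : Finite (Var ar G) :=
  Finite.of_surjective (fun s : (Slot ar ⊕ Slot ar × Comp G) ⊕ Fin 6 => match s with
    | .inl (.inl o) => Var.pos o
    | .inl (.inr (o, k)) => Var.code o k
    | .inr i => Var.aux i) (by
      rintro (o | ⟨o, k⟩ | i)
      exacts [⟨.inl (.inl o), rfl⟩, ⟨.inl (.inr (o, k)), rfl⟩, ⟨.inr i, rfl⟩])

/-- The slot for an argument. -/
abbrev argSlot (r : τ) (i : Fin (ar r)) : Slot ar := some (some ⟨r, i⟩)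

instance : Nontrivial (Var ar G) := ⟨⟨.aux 0, .aux 1, by simp⟩⟩

/-- The variables of the tables of digits. -/
def digitVar : G × Bool ⊕ Fin 4 → Var ar G
  | .inl (j, b) => Var.code (if b then some none else none) (some (some j))
  | .inr i => .aux (i.castLE (by norm_num))

theorem digitVar_injective : Injective (digitVar (ar := ar) (G := G)) := by
  rintro (⟨j, b⟩ | i) (⟨j', b'⟩ | i') h
  · cases b <;> cases b' <;> simp_all [digitVar]
  · simp [digitVar] at h
  · simp [digitVar] at h
  · simpa [digitVar] using h

/-- The substitution for looking up a digit. -/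
def digitSubst (a b : G → Var ar G) (β : Var ar G) : Var ar G → Var ar G
  | .code none (some (some j)) => a j
  | .code (some none) (some (some j)) => b j
  | .aux i => if i = 0 then β else .aux i
  | v => v

/-- The code in a slot. -/
def codeOf {A : Type} (e : Env A (Fin 4) (Var ar G)) (o : Slot ar) : Comp G → ℕ :=
  fun k => e.x (Var.code o k)

/-- The second table contains the digits of products of powers of numerators and denominators. -/
abbrev HasDigits (N : ℕ) (X : Fin 4 → (Var ar G → ℕ) → Prop) : Prop :=
  TabProg.IsDigits (digitVar (ar := ar)) 1 N X (monNat G)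

theorem HasDigits.lookup {N : ℕ} {X : Fin 4 → (Var ar G → ℕ) → Prop} (h : HasDigits N X)
    {x : Var ar G → ℕ} (hx : ∀ v, x v < N) (a b : G → Var ar G) (β : Var ar G) :
    X 1 (x ∘ digitSubst a b β) ↔
      (monNat G (pair (fun j => x (a j)) fun j => x (b j))).testBit (x β) = true := by
  rw [h (x ∘ digitSubst a b β) fun v => hx _]
  have h1 : (fun t => (x ∘ digitSubst a b β) (digitVar (.inl t))) =
      pair (fun j => x (a j)) fun j => x (b j) := by
    funext ⟨j, b⟩
    cases b <;> rfl
  rw [h1]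
  rfl

/-- The exponents of a code, where the exponent of `c` is replaced by an auxiliary variable. -/
def raised (o : Slot ar) (c : G) : G → Var ar G := fun j =>
  if j = c then .aux 4 else Var.code o (some (some j))

/-- The exponents of a code. -/
def plain (o : Slot ar) : G → Var ar G := fun j => Var.code o (some (some j))

/-- Two products have the same digit, if the digit is more significant than a given one. -/
def DigitsAgree {A : Type} (o o' : Slot ar) (c : G) (e : Env A (Fin 4) (Var ar G)) : Prop :=
  e.x (.aux 0) < e.x (.aux 5) → (e.X 1 (e.x ∘ digitSubst (plain o) (raised o' c) (.aux 5)) ↔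
    e.X 1 (e.x ∘ digitSubst (raised o' c) (plain o) (.aux 5)))

/-- A given digit is the most significant one in which two products are different. -/
def DigitsLt {A : Type} (o o' : Slot ar) (c : G) (e : Env A (Fin 4) (Var ar G)) : Prop :=
  ¬e.X 1 (e.x ∘ digitSubst (plain o) (raised o' c) (.aux 0)) ∧
    e.X 1 (e.x ∘ digitSubst (raised o' c) (plain o) (.aux 0)) ∧
    ∀ y < e.N, DigitsAgree o o' c (e.withVars (update e.x (.aux 5) y))

/-- The comparison of monomials by means of the table of digits. -/
def LtMon {A : Type} (o o' : Slot ar) (c : G) (e : Env A (Fin 4) (Var ar G)) : Prop :=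
  ∃ y < e.N, (fun e : Env A (Fin 4) (Var ar G) =>
    e.x (.aux 4) = e.x (Var.code o' (some (some c))) + 1 ∧
    ∃ y < e.N, DigitsLt o o' c (e.withVars (update e.x (.aux 0) y)))
    (e.withVars (update e.x (.aux 4) y))

theorem dfn_ltMon {A : Type} (o o' : Slot ar) (c : G) : Dfn (LtMon (A := A) o o' c) := by
  have h1 : Dfn (DigitsAgree (A := A) o o' c) :=
    (Dfn.lt _ _).imp ((Dfn.tab 1 _).iff (Dfn.tab 1 _))
  have h2 : Dfn (DigitsLt (A := A) o o' c) := (Dfn.tab 1 _).not.and ((Dfn.tab 1 _).and (h1.all _))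
  have h3 : Dfn fun e : Env A (Fin 4) (Var ar G) =>
      e.x (.aux 4) = e.x (Var.code o' (some (some c))) + 1 :=
    Dfn.succ (u := .aux 3) (by simp) (by simp)
  exact (h3.and (h2.ex _)).ex _

/-- Multiplication by `c` raises the exponent of `c` by one, and `.aux 4` holds the raised exponent.
After denominators are cleared, two natural numbers are compared at their most significant different
digit, whose position is in `.aux 0`. -/
theorem ltMon_iff {A : Type} (hG : ∀ g ∈ G, 0 < g) {κ l : ℕ} (hκ : ∏ t, base G t < κ)
    (hκ2 : 2 ≤ κ) {o o' : Slot ar} {c : G} {e : Env A (Fin 4) (Var ar G)} (he : e.Ok)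
    (hN : e.N = κ * (l + 1)) (hX : HasDigits e.N e.X) (ho : IsValid l (codeOf e o))
    (ho' : IsValid l (codeOf e o')) :
    LtMon o o' c e ↔ mon (exps (codeOf e o)) < c * mon (exps (codeOf e o')) := by
  set a := exps (codeOf e o) with ha
  set b := exps (codeOf e o') + Pi.single c 1 with hb
  have hlN : l + 1 < e.N := by rw [hN]; nlinarith
  have hbl : ∀ j, b j ≤ l + 1 := by
    intro j
    have h1 : exps (codeOf e o') j ≤ l := ho' j
    have h2 : (Pi.single c 1 : G → ℕ) j ≤ 1 := by rw [Pi.single_apply]; split_ifs <;> omega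
    simp only [hb, Pi.add_apply]
    omega
  have hal : ∀ j, a j ≤ l + 1 := fun j => (ho j).trans (by omega)
  have hpair : ∀ {a b : G → ℕ}, (∀ j, a j ≤ l + 1) → (∀ j, b j ≤ l + 1) →
      monNat G (pair a b) < 2 ^ e.N := by
    intro a b ha hb
    rw [hN]
    refine monNat_lt hG hκ fun t => ?_
    unfold pair
    split_ifs
    · exact hb _
    · exact ha _
  rw [mul_comm, ← mon_add_single, ← hb, mon_lt_mon_iff hG,
    lt_iff_exists_testBit (hpair hal hbl) (hpair hbl hal)]
  have key : ∀ x : Var ar G → ℕ, (∀ v, x v < e.N) → (∀ o k, x (Var.code o k) = e.x (Var.code o k)) →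
      x (.aux 4) = e.x (Var.code o' (some (some c))) + 1 → ∀ β,
      (e.X 1 (x ∘ digitSubst (plain o) (raised o' c) β) ↔
        (monNat G (pair a b)).testBit (x β) = true) ∧
      (e.X 1 (x ∘ digitSubst (raised o' c) (plain o) β) ↔
        (monNat G (pair b a)).testBit (x β) = true) := by
    intro x hx hxc hx4 β
    have h1 : (fun j => x (plain o j)) = a := funext fun j => hxc o _
    have h2 : (fun j => x (raised o' c j)) = b := by
      funext j
      by_cases h : j = c
      · subst h
        simp [raised, hx4, hb, exps, codeOf]
      · simp [raised, h, hxc, hb, exps, codeOf]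
    rw [hX.lookup hx, hX.lookup hx, h1, h2]
    exact ⟨Iff.rfl, Iff.rfl⟩
  have hupd : ∀ {x : Var ar G → ℕ}, (∀ v, x v < e.N) → ∀ (v) {y}, y < e.N →
      ∀ w, update x v y w < e.N := by
    intro x hx v y hy w
    rw [update_apply]
    split_ifs
    · exact hy
    · exact hx w
  have hc : e.x (Var.code o' (some (some c))) ≤ l := ho' c
  constructor
  · rintro ⟨y, hy, h1, p, hp, h2, h3, h4⟩
    simp only [Env.withVars_N, Env.withVars_x, Env.withVars_X, Env.withVars_withVars] at *
    have h1' : y = e.x (Var.code o' (some (some c))) + 1 := by simpa using h1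
    have hx1 := hupd (hupd he (.aux 4) hy) (.aux 0) hp
    obtain ⟨k1, k2⟩ := key _ hx1 (by simp) (by simp [h1']) (.aux 0)
    rw [k1] at h2
    rw [k2] at h3
    simp only [update_self, Bool.not_eq_true] at h2 h3
    refine ⟨p, hp, h2, h3, fun q hq hpq => ?_⟩
    have h5 := h4 q hq (by simpa using hpq)
    obtain ⟨k3, k4⟩ := key _ (hupd hx1 (.aux 5) hq) (by simp) (by simp [h1']) (.aux 5)
    simp only [Env.withVars_x, Env.withVars_X] at h5
    rw [k3, k4] at h5
    simp only [update_self] at h5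
    exact Bool.eq_iff_iff.2 h5
  · rintro ⟨p, hp, h2, h3, h4⟩
    have hy : e.x (Var.code o' (some (some c))) + 1 < e.N := by omega
    have hx1 := hupd (hupd he (.aux 4) hy) (.aux 0) hp
    obtain ⟨k1, k2⟩ := key _ hx1 (by simp) (by simp) (.aux 0)
    refine ⟨_, hy, by simp, p, hp, ?_, ?_, fun q hq hpq => ?_⟩
    · refine fun h => ?_
      have := k1.1 h
      simp [h2] at this
    · exact k2.2 (by simpa using h3)
    · obtain ⟨k3, k4⟩ := key _ (hupd hx1 (.aux 5) hq) (by simp) (by simp) (.aux 5)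
      refine k3.trans (Iff.trans ?_ k4.symm)
      simp only [update_self]
      rw [h4 q hq (by simpa using hpq)]

theorem cmp_eq_of_iff {a b a' b' : ℚ} (h1 : a < b ↔ a' < b') (h2 : b < a ↔ b' < a') :
    cmp a b = cmp a' b' := by
  rcases lt_trichotomy a b with h | h | h
  · rw [(cmp_eq_lt_iff _ _).2 h, (cmp_eq_lt_iff _ _).2 (h1.1 h)]
  · rw [(cmp_eq_eq_iff _ _).2 h, eq_comm, cmp_eq_eq_iff]
    exact le_antisymm (not_lt.1 fun h' => h.not_gt (h2.2 h')) (not_lt.1 fun h' => h.not_lt (h1.2 h'))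
  · rw [(cmp_eq_gt_iff _ _).2 h, (cmp_eq_gt_iff _ _).2 (h2.1 h)]

theorem cmpCode_congr {c : ℚ} {s s' u u' : Comp G → ℕ} (h1 : sgn (s none) = sgn (u none))
    (h2 : sgn (s' none) = sgn (u' none)) (h3 : c ≠ 0 → cmpMag |c| s s' = cmpMag |c| u u') :
    cmpCode c s s' = cmpCode c u u' := by
  by_cases hc : c = 0
  · subst hc
    simp [cmpCode, h1]
  · rw [cmpCode, cmpCode, h1, h2, h3 hc]

/-- The slots for the number `1` and for the arguments of a relation symbol. -/
def slotOf (r : τ) : Option (Fin (ar r)) → Slot ar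
  | none => none
  | some i => argSlot r i

/-- Membership in a relation is definable in terms of codes. -/
theorem exists_dfn_memCode {A : Type} (hG : ∀ g ∈ G, 0 < g) (hGi : ∀ g ∈ G, g⁻¹ ∈ G) {κ : ℕ}
    (hκ : ∏ t, base G t < κ) (hκ2 : 2 ≤ κ) (r : τ) (R : Set (Fin (ar r) → ℚ)) {C : Finset ℚ}
    (hC : ∀ c ∈ C, c ≠ 0 → |c| ∈ G) :
    ∃ P : Env A (Fin 4) (Var ar G) → Prop, Dfn P ∧ ∀ e l, e.Ok → e.N = κ * (l + 1) →
      HasDigits e.N e.X → (∀ o, IsValid l (codeOf e (slotOf r o))) →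
      (P e ↔ MemCode C R fun o => codeOf e (slotOf r o)) := by
  let Q : (Option (Fin (ar r)) × Bool) ⊕ (Option (Fin (ar r)) × Option (Fin (ar r)) × Option G) →
      Env A (Fin 4) (Var ar G) → Prop := fun q => match q with
    | .inl (o, b) => fun e => e.x (Var.code (slotOf r o) none) = b.toNat
    | .inr (o, o', none) => fun e =>
        e.x (Var.code (slotOf r o) (some none)) < e.x (Var.code (slotOf r o') (some none))
    | .inr (o, o', some c) => LtMon (slotOf r o) (slotOf r o') c
  obtain ⟨P, hP, h⟩ := Dfn.of_family (Q := Q) (by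
      rintro (⟨o, b⟩ | ⟨o, o', _ | c⟩)
      · exact Dfn.var_eq _ _
      · exact Dfn.lt _ _
      · exact dfn_ltMon _ _ _)
    (fun e => ∃ l, e.Ok ∧ e.N = κ * (l + 1) ∧ HasDigits e.N e.X ∧
      ∀ o, IsValid l (codeOf e (slotOf r o)))
    (fun e => MemCode C R fun o => codeOf e (slotOf r o)) (by
      rintro e e' ⟨l, he, hN, hX, hv⟩ ⟨l', he', hN', hX', hv'⟩ hQ ⟨x, hx, hcmp⟩
      refine ⟨x, hx, fun c hc i j => (hcmp c hc i j).trans ?_⟩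
      -- Tests for `0` and `1` determine the sign, as all other numbers denote `-1`.
      have hs : ∀ o, sgn (codeOf e (slotOf r o) none) = sgn (codeOf e' (slotOf r o) none) := by
        intro o
        have h0 : codeOf e (slotOf r o) none = 0 ↔ codeOf e' (slotOf r o) none = 0 :=
          hQ (.inl (o, false))
        have h1 : codeOf e (slotOf r o) none = 1 ↔ codeOf e' (slotOf r o) none = 1 :=
          hQ (.inl (o, true))
        simp only [sgn, h0, h1]
      refine cmpCode_congr (hs i) (hs j) fun hc0 => ?_
      have hcG := hC c hc hc0
      have hcp := hG _ hcG
      have hlt : ∀ (i j) (d : G),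
          mon (exps (codeOf e (slotOf r i))) < d * mon (exps (codeOf e (slotOf r j))) ↔
          mon (exps (codeOf e' (slotOf r i))) < d * mon (exps (codeOf e' (slotOf r j))) := by
        intro i j d
        rw [← ltMon_iff hG hκ hκ2 he hN hX (hv i) (hv j),
          ← ltMon_iff hG hκ hκ2 he' hN' hX' (hv' i) (hv' j)]
        exact hQ (.inr (i, j, some d))
      have hdlt : ∀ i j, codeOf e (slotOf r i) (some none) < codeOf e (slotOf r j) (some none) ↔
          codeOf e' (slotOf r i) (some none) < codeOf e' (slotOf r j) (some none) := fun i j =>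
        hQ (.inr (i, j, none))
      unfold cmpMag
      congr 1
      -- The reverse inequality is an instance of the same test, with the roles of `i` and `j`
      -- exchanged and the coefficient inverted.
      · refine cmp_eq_of_iff (hlt i j ⟨_, hcG⟩) ?_
        have h1 := hlt j i ⟨_, hGi _ hcG⟩
        simpa only [inv_mul_eq_div, lt_div_iff₀ hcp, mul_comm |c|] using h1
      · have h1 := hdlt i j
        have h2 := hdlt j i
        simp only [cmp, cmpUsing, h1, h2])
  exact ⟨P, hP, fun e l he hN hX hv => h e ⟨l, he, hN, hX, hv⟩⟩

end Vars

end PLH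

/-! ### Names of variables and constraints by formulas -/

open Function Classical

namespace PLH

section Formulas

variable {τ : Type} {ar : τ → ℕ} {G : Finset ℚ}

/-- The letters of a word, as predicates on positions. -/
def lettersOf (w : List (CSP.Letter τ)) (a : CSP.Letter τ) (n : ℕ) : Prop := w[n]? = some a

instance [Finite τ] : Finite (CSP.Letter τ) :=
  Finite.of_surjective (fun s : Option (τ ⊕ Bool) => match s with
    | none => CSP.Letter.comma
    | some (.inl r) => CSP.Letter.rel r
    | some (.inr b) => CSP.Letter.bit b) (by
      rintro (r | b | _)
      exacts [⟨some (.inl r), rfl⟩, ⟨some (.inr b), rfl⟩, ⟨none, rfl⟩])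

/-- The environments of the formulas. -/
abbrev WEnv (ar : τ → ℕ) (G : Finset ℚ) : Type := Env (CSP.Letter τ) (Fin 4) (Var ar G)

/-- The position of the variable is in the word. -/
def HasLetter (v : Var ar G) (e : WEnv ar G) : Prop := ∃ a, e.L a (e.x v)

theorem dfn_hasLetter [Finite τ] (v : Var ar G) : Dfn (HasLetter v) :=
  Dfn.exists_finite fun a => Dfn.letter a v

theorem hasLetter_iff {w : List (CSP.Letter τ)} {e : WEnv ar G} (hL : e.L = lettersOf w)
    (v : Var ar G) : HasLetter v e ↔ e.x v < w.length := by
  rw [HasLetter, hL]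
  simp only [lettersOf]
  rw [← isSome_getElem? w (e.x v), Option.isSome_iff_exists]

/-- The letters after two positions are the same bit, or both of them are no bits. -/
def NextBits (e : WEnv ar G) : Prop :=
  ((∀ b, ¬e.L (.bit b) (e.x (.aux 2))) ∧ ∀ b, ¬e.L (.bit b) (e.x (.aux 3))) ∨
    ∃ b, e.L (.bit b) (e.x (.aux 2)) ∧ e.L (.bit b) (e.x (.aux 3)) ∧
      e.X 2 (e.x ∘ update (update id (.pos none) (.aux 2)) (.pos (some none)) (.aux 3))

/-- The recursive description of equality of names. -/
def SameStep (e : WEnv ar G) : Prop :=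
  ∃ y < e.N, (fun e : WEnv ar G => e.x (.aux 2) = e.x (.pos none) + 1 ∧
    ∃ y < e.N, (fun e : WEnv ar G => e.x (.aux 3) = e.x (.pos (some none)) + 1 ∧ NextBits e)
      (e.withVars (update e.x (.aux 3) y))) (e.withVars (update e.x (.aux 2) y))

theorem dfn_sameStep : Dfn (SameStep (ar := ar) (G := G)) := by
  have h1 : Dfn (NextBits (ar := ar) (G := G)) :=
    ((Dfn.forall_finite fun b => (Dfn.letter _ _).not).and
      (Dfn.forall_finite fun b => (Dfn.letter _ _).not)).or
      (Dfn.exists_finite fun b => (Dfn.letter _ _).and ((Dfn.letter _ _).and (Dfn.tab 2 _)))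
  have h2 : Dfn fun e : WEnv ar G => e.x (.aux 3) = e.x (.pos (some none)) + 1 :=
    Dfn.succ (u := .aux 4) (by simp) (by simp)
  have h3 : Dfn fun e : WEnv ar G => e.x (.aux 2) = e.x (.pos none) + 1 :=
    Dfn.succ (u := .aux 4) (by simp) (by simp)
  exact (h3.and ((h2.and h1).ex _)).ex _

/-- The stage of the recursion is measured by the length of the name: if the table is right for
names shorter than `m`, then one step makes it right for names shorter than `m + 1`. Names are
shorter than the word, so `N` steps suffice. -/
theorem sameStep_iff {w : List (CSP.Letter τ)} {N m : ℕ} (hN : w.length < N)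
    {X : Fin 4 → (Var ar G → ℕ) → Prop}
    (hX : ∀ x : Var ar G → ℕ, (∀ v, x v < N) → x (.pos none) < w.length →
      x (.pos (some none)) < w.length → (X 2 x ↔
        CSP.varName w (x (.pos none)) = CSP.varName w (x (.pos (some none))) ∧
        (CSP.varName w (x (.pos none))).length < m)) {x : Var ar G → ℕ} (hx : ∀ v, x v < N)
    (h1 : x (.pos none) < w.length) (h2 : x (.pos (some none)) < w.length) :
    SameStep ⟨N, lettersOf w, X, x⟩ ↔
      CSP.varName w (x (.pos none)) = CSP.varName w (x (.pos (some none))) ∧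
        (CSP.varName w (x (.pos none))).length < m + 1 := by
  have hs : SameStep ⟨N, lettersOf w, X, x⟩ ↔
      NextBits ⟨N, lettersOf w, X, update (update x (.aux 2) (x (.pos none) + 1)) (.aux 3)
        (x (.pos (some none)) + 1)⟩ := by
    constructor
    · rintro ⟨y, hy, h3, z, hz, h4, h5⟩
      simp only [Env.withVars_x, update_self] at h3 h4
      have h3' : y = x (.pos none) + 1 := by simpa using h3
      have h4' : z = x (.pos (some none)) + 1 := by simpa using h4
      subst h3' h4'
      exact h5
    · intro h
      exact ⟨_, by change _ + 1 < N; omega, by simp, _, by change _ + 1 < N; omega, by simp, h⟩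
  rw [hs, NextBits]
  have e2 : update (update x (.aux 2) (x (.pos none) + 1)) (.aux 3)
        (x (.pos (some none)) + 1) (.aux 2) = x (.pos none) + 1 := by simp
  dsimp only
  rw [e2, update_self, CSP.varName_eq_iff]
  simp only [lettersOf]
  have hX' : ∀ b, w[x (.pos none) + 1]? = some (.bit b) →
      w[x (.pos (some none)) + 1]? = some (.bit b) →
      (X 2 (update (update x (.aux 2) (x (.pos none) + 1)) (.aux 3) (x (.pos (some none)) + 1) ∘
        update (update id (.pos none) (.aux 2)) (.pos (some none)) (.aux 3)) ↔
        CSP.varName w (x (.pos none) + 1) = CSP.varName w (x (.pos (some none)) + 1) ∧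
        (CSP.varName w (x (.pos none))).length < m + 1) := by
    intro b hb hb'
    obtain ⟨hq, -⟩ := List.getElem?_eq_some_iff.1 hb
    obtain ⟨hq', -⟩ := List.getElem?_eq_some_iff.1 hb'
    rw [hX, CSP.varName_length_of_bit hb]
    · simp
    · intro v
      have hu : ∀ u, update (update x (.aux 2) (x (.pos none) + 1)) (.aux 3)
          (x (.pos (some none)) + 1) u < N := by
        intro u
        rw [update_apply, update_apply]
        split_ifs
        · omega
        · omega
        · exact hx u
      exact hu _
    · simpa using hq
    · simpa using hq'
  constructor
  · rintro (⟨h3, h4⟩ | ⟨b, h3, h4, h5⟩)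
    · exact ⟨Or.inl ⟨h3, h4⟩, by rw [CSP.varName_eq_nil h3]; exact Nat.succ_pos m⟩
    · rw [hX' b h3 h4] at h5
      exact ⟨Or.inr ⟨b, h3, h4, h5.1⟩, h5.2⟩
  · rintro ⟨⟨h3, h4⟩ | ⟨b, h3, h4, h5⟩, h6⟩
    · exact Or.inl ⟨h3, h4⟩
    · exact Or.inr ⟨b, h3, h4, (hX' b h3 h4).2 ⟨h5, h6⟩⟩

/-- Compute the table of the pairs of positions that are followed by the same name. -/
noncomputable def sameProg : TabProg (CSP.Letter τ) (Fin 4) (Var ar G) :=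
  .rep (.assign 2 dfn_sameStep.fml)

theorem den_sameProg {w : List (CSP.Letter τ)} {N : ℕ} (hN : w.length < N)
    (X : Fin 4 → (Var ar G → ℕ) → Prop) (hX : X 2 = fun _ => False) :
    (∀ i ≠ 2, (sameProg (ar := ar) (G := G)).den N (lettersOf w) X i = X i) ∧
    ∀ x : Var ar G → ℕ, (∀ v, x v < N) → x (.pos none) < w.length →
      x (.pos (some none)) < w.length → (sameProg.den N (lettersOf w) X 2 x ↔
        CSP.varName w (x (.pos none)) = CSP.varName w (x (.pos (some none)))) := by
  rw [sameProg, TabProg.den]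
  set p := (TabProg.assign 2 (dfn_sameStep (ar := ar) (G := G)).fml).den N (lettersOf w)
  have key : ∀ m, (∀ i ≠ 2, p^[m] X i = X i) ∧ ∀ x : Var ar G → ℕ, (∀ v, x v < N) →
      x (.pos none) < w.length → x (.pos (some none)) < w.length → (p^[m] X 2 x ↔
        CSP.varName w (x (.pos none)) = CSP.varName w (x (.pos (some none))) ∧
        (CSP.varName w (x (.pos none))).length < m) := by
    intro m
    induction m with
    | zero =>
      refine ⟨fun _ _ => rfl, fun x _ _ _ => ?_⟩
      rw [iterate_zero, id, hX]
      simp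
    | succ m ih =>
      rw [iterate_succ_apply']
      refine ⟨fun i hi => (TabProg.den_assign_of_ne hi _ _).trans (ih.1 i hi),
        fun x hx h1 h2 => ?_⟩
      exact (TabProg.den_assign_self dfn_sameStep _ hx).trans (sameStep_iff hN ih.2 hx h1 h2)
  refine ⟨(key N).1, fun x hx h1 h2 => ?_⟩
  rw [(key N).2 x hx h1 h2]
  have := CSP.varName_length_lt h1
  exact ⟨fun h => h.1, fun h => ⟨h, by omega⟩⟩

/-- The second position is the one of the next separator. -/
def NextCommaF (v v' : Var ar G) (e : WEnv ar G) : Prop :=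
  e.x v < e.x v' ∧ e.L .comma (e.x v') ∧ ∀ y < e.N, (fun e : WEnv ar G =>
    e.x v < e.x (.aux 4) → e.x (.aux 4) < e.x v' → ¬e.L .comma (e.x (.aux 4)))
    (e.withVars (update e.x (.aux 4) y))

theorem dfn_nextCommaF (v v' : Var ar G) : Dfn (NextCommaF v v') :=
  (Dfn.lt _ _).and ((Dfn.letter _ _).and (((Dfn.lt _ _).imp ((Dfn.lt _ _).imp
    (Dfn.letter _ _).not)).all _))

theorem nextCommaF_iff {w : List (CSP.Letter τ)} {e : WEnv ar G} (he : e.Ok)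
    (hL : e.L = lettersOf w) {v v' : Var ar G} (hv : v ≠ .aux 4) (hv' : v' ≠ .aux 4) :
    NextCommaF v v' e ↔ CSP.NextComma w (e.x v) (e.x v') := by
  simp only [NextCommaF, hL, lettersOf, Env.withVars_x, Env.withVars_L, update_of_ne hv,
    update_of_ne hv', update_self, CSP.NextComma]
  refine and_congr_right fun _ => and_congr_right fun _ => ⟨fun h m h1 h2 => ?_,
    fun h y _ h1 h2 => h y h1 h2⟩
  exact h m (h2.trans (he v')) h1 h2

/-- The positions of the arguments of a constraint. -/
def IsArgsF (r : τ) (e : WEnv ar G) : Prop :=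
  e.L (.rel r) (e.x (.pos (some none))) ∧ ∀ i : Fin (ar r),
    NextCommaF (if h : i.val = 0 then .pos (some none) else .pos (argSlot r ⟨i.val - 1, by omega⟩))
      (.pos (argSlot r i)) e

theorem dfn_isArgsF (r : τ) : Dfn (IsArgsF (ar := ar) (G := G) r) :=
  (Dfn.letter _ _).and (Dfn.forall_finite fun _ => dfn_nextCommaF _ _)

theorem isArgsF_iff {w : List (CSP.Letter τ)} {e : WEnv ar G} (he : e.Ok)
    (hL : e.L = lettersOf w) (r : τ) :
    IsArgsF r e ↔ w[e.x (.pos (some none))]? = some (.rel r) ∧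
      CSP.IsArgs w (e.x (.pos (some none))) fun i => e.x (.pos (argSlot r i)) := by
  have h0 : e.L (.rel r) (e.x (.pos (some none))) ↔
      w[e.x (.pos (some none))]? = some (.rel r) := by rw [hL]; rfl
  rw [IsArgsF, CSP.IsArgs, h0]
  refine and_congr_right fun _ => forall_congr' fun i => ?_
  rw [nextCommaF_iff he hL (by split_ifs <;> simp) (by simp)]
  split_ifs <;> rfl

/-- The distinguished code is the one of the number `1`. -/
def IsOneF (e : WEnv ar G) : Prop :=
  e.x (.code none none) = 1 ∧ (∀ j : G, e.x (.code none (some (some j))) = 0) ∧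
    ¬HasLetter (.code none (some none)) e ∧ ∀ y < e.N, (fun e : WEnv ar G =>
      e.x (.aux 4) < e.x (.code none (some none)) → HasLetter (.aux 4) e)
      (e.withVars (update e.x (.aux 4) y))

theorem dfn_isOneF [Finite τ] : Dfn (IsOneF (ar := ar) (G := G)) :=
  (Dfn.var_eq _ _).and ((Dfn.forall_finite fun _ => Dfn.var_eq _ _).and
    ((dfn_hasLetter _).not.and (((Dfn.lt _ _).imp (dfn_hasLetter _)).all _)))

/-- The exponent of `δ` in the code of `1` is the length of the word, which is definable as the
first position without a letter and is in the range because of `hN`. -/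
theorem isOneF_iff {w : List (CSP.Letter τ)} {e : WEnv ar G} (he : e.Ok)
    (hL : e.L = lettersOf w) (hN : w.length < e.N) :
    IsOneF e ↔ codeOf e none = oneCode G w.length := by
  have h4 : ∀ y, HasLetter (.aux 4) (e.withVars (update e.x (.aux 4) y)) ↔ y < w.length := by
    intro y
    rw [hasLetter_iff (by exact hL)]
    simp
  simp only [IsOneF, hasLetter_iff hL, h4, Env.withVars_x, update_self]
  have hd : ∀ {x}, x < e.N → ((¬x < w.length ∧ ∀ y < e.N, y < x → y < w.length) ↔ x = w.length) := by
    intro x hx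
    constructor
    · rintro ⟨h1, h2⟩
      by_contra hne
      exact absurd (h2 w.length hN (by omega)) (lt_irrefl _)
    · rintro rfl
      exact ⟨lt_irrefl _, fun y _ h => h⟩
  simp only [ne_eq, reduceCtorEq, not_false_eq_true, update_of_ne]
  rw [hd (he _)]
  constructor
  · rintro ⟨h1, h2, h3⟩
    funext k
    rcases k with _ | _ | j
    exacts [h1, h3, h2 j]
  · intro h
    exact ⟨congrFun h none, fun j => congrFun h (some (some j)), congrFun h (some none)⟩

/-- The exponents of the code are at most the length of the word. -/
def IsValidF (o : Slot ar) (e : WEnv ar G) : Prop :=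
  ∀ j : G, ¬e.x (.code none (some none)) < e.x (.code o (some (some j)))

theorem dfn_isValidF (o : Slot ar) : Dfn (IsValidF (G := G) o) :=
  Dfn.forall_finite fun _ => (Dfn.lt _ _).not

theorem isValidF_iff {l : ℕ} {e : WEnv ar G} (h : codeOf e none = oneCode G l) (o : Slot ar) :
    IsValidF o e ↔ IsValid l (codeOf e o) := by
  have h1 : e.x (.code none (some none)) = l := congrFun h (some none)
  simp only [IsValidF, IsValid, h1, not_lt, codeOf]

end Formulas

end PLH

/-! ### Arc consistency by formulas -/

open Function Classical

namespace PLH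

section Formulas

variable {τ : Type} {ar : τ → ℕ} {G : Finset ℚ}

/-- The variables for the positions of a constraint and for the code of the number `1`. -/
def argVars (r : τ) : Option (Fin (ar r)) ⊕ Comp G → Var ar G
  | .inl none => .pos (some none)
  | .inl (some i) => .pos (argSlot r i)
  | .inr k => .code none k

/-- The variables for the codes of the arguments of a constraint. -/
def codeVars (r : τ) (t : Fin (ar r) × Comp G) : Var ar G := .code (argSlot r t.1) t.2

theorem argVars_injective (r : τ) : Injective (argVars (ar := ar) (G := G) r) := by
  rintro ((_ | i) | k) ((_ | i') | k') h <;> simp_all [argVars]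

theorem codeVars_injective (r : τ) : Injective (codeVars (ar := ar) (G := G) r) := by
  rintro ⟨i, k⟩ ⟨i', k'⟩ h
  simpa [codeVars] using h

theorem pos_notMem_argVars (r : τ) : Var.pos none ∉ Set.range (argVars (ar := ar) (G := G) r) := by
  rintro ⟨(_ | i) | k, h⟩ <;> simp [argVars] at h

theorem code_notMem_argVars (r : τ) (o) (k : Comp G) :
    Var.code (some o) k ∉ Set.range (argVars (ar := ar) (G := G) r) := by
  rintro ⟨(_ | i) | k, h⟩ <;> simp [argVars] at h

theorem pos_notMem_codeVars (r : τ) (o) : Var.pos o ∉ Set.range (codeVars (ar := ar) (G := G) r) := by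
  rintro ⟨t, h⟩
  simp [codeVars] at h

theorem code_none_notMem_codeVars (r : τ) (k : Comp G) :
    Var.code none k ∉ Set.range (codeVars (ar := ar) (G := G) r) := by
  rintro ⟨t, h⟩
  simp [codeVars] at h

theorem code_some_none_notMem_codeVars (r : τ) (k : Comp G) :
    Var.code (some none) k ∉ Set.range (codeVars (ar := ar) (G := G) r) := by
  rintro ⟨t, h⟩
  simp [codeVars] at h

/-- The substitution for looking up whether the code of an argument is removed. -/
def argSubst (r : τ) (i : Fin (ar r)) : Var ar G → Var ar G
  | .pos none => .pos (argSlot r i)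
  | .code (some none) k => .code (argSlot r i) k
  | v => v

/-- If the codes of the arguments satisfy the constraint, and the one of the argument `j` is the
given one, then one of them is removed. -/
def Excluded (Mem : τ → WEnv ar G → Prop) (r : τ) (j : Fin (ar r)) (e : WEnv ar G) : Prop :=
  (∀ i, IsValidF (argSlot r i) e) →
    (∀ k, e.x (.code (argSlot r j) k) = e.x (.code (some none) k)) → Mem r e →
    ∃ i, e.X 3 (e.x ∘ argSubst r i)

/-- The given code is to be removed because of a given constraint. -/
def PruneAt (Mem : τ → WEnv ar G → Prop) (r : τ) (j : Fin (ar r)) (e : WEnv ar G) : Prop :=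
  IsArgsF r e ∧ IsOneF e ∧ HasLetter (.pos none) e ∧
    e.X 2 (e.x ∘ update id (.pos (some none)) (.pos (argSlot r j))) ∧
    ∀ z : Var ar G → ℕ, (∀ v, z v < e.N) → (∀ v ∉ Set.range (codeVars r), z v = e.x v) →
      Excluded Mem r j (e.withVars z)

/-- The given code is to be removed. -/
def PruneF (Mem : τ → WEnv ar G → Prop) (e : WEnv ar G) : Prop :=
  e.X 3 (e.x ∘ id) ∨ ∃ (r : τ) (j : Fin (ar r)), ∃ z : Var ar G → ℕ, (∀ v, z v < e.N) ∧
    (∀ v ∉ Set.range (argVars r), z v = e.x v) ∧ PruneAt Mem r j (e.withVars z)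

theorem dfn_pruneF [Finite τ] {Mem : τ → WEnv ar G → Prop} (hMem : ∀ r, Dfn (Mem r)) :
    Dfn (PruneF Mem) := by
  have h1 : ∀ r j, Dfn (Excluded Mem r j) := fun r j =>
    (Dfn.forall_finite fun _ => dfn_isValidF _).imp ((Dfn.forall_finite fun _ => Dfn.eq _ _).imp
      ((hMem r).imp (Dfn.exists_finite fun _ => Dfn.tab _ _)))
  have h2 : ∀ r j, Dfn (PruneAt Mem r j) := fun r j =>
    (dfn_isArgsF r).and (dfn_isOneF.and ((dfn_hasLetter _).and ((Dfn.tab _ _).and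
      (Dfn.allsRange _ (h1 r j)))))
  exact (Dfn.tab _ _).or (Dfn.exists_finite fun r => Dfn.exists_finite fun j =>
    Dfn.exsRange _ (h2 r j))

/-- The constraints that are written in a word. -/
def constraintsOf (ar : τ → ℕ) (w : List (CSP.Letter τ)) (N : ℕ) :
    Set (Σ r : τ, Fin (ar r) → Fin N) :=
  {c | ∃ p, w[p]? = some (.rel c.1) ∧ CSP.IsArgs w p fun i => (c.2 i).val}

theorem lt_length_of_mem_constraintsOf {w : List (CSP.Letter τ)} {N : ℕ}
    {c : Σ r : τ, Fin (ar r) → Fin N} (hc : c ∈ constraintsOf ar w N) (j) :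
    (c.2 j).val < w.length := by
  obtain ⟨p, -, h⟩ := hc
  exact (List.getElem?_eq_some_iff.1 (h j).2.1).1

/-- The last table contains the removed codes. -/
def HasRemoved (N : ℕ) (X : Fin 4 → (Var ar G → ℕ) → Prop)
    (S : Set (Fin N × (Comp G → Fin N))) : Prop :=
  ∀ (x : Var ar G → ℕ) (hx : ∀ v, x v < N), X 3 x ↔
    ((⟨x (.pos none), hx _⟩ : Fin N), fun k => (⟨x (.code (some none) k), hx _⟩ : Fin N)) ∈ S

/-- A formula expresses membership in the relations. -/
def ExpressesMem (κ : ℕ) (R : (r : τ) → Set (Fin (ar r) → ℚ)) (C : τ → Finset ℚ)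
    (Mem : τ → WEnv ar G → Prop) : Prop :=
  ∀ r e l, e.Ok → e.N = κ * (l + 1) → HasDigits e.N e.X →
    (∀ o, IsValid l (codeOf e (slotOf r o))) →
    (Mem r e ↔ MemCode (C r) (R r) fun o => codeOf e (slotOf r o))

/-- The free variables `.pos none` and `.code (some none)` hold the position and the code in
question; `.pos (some none)` holds the position of the relation symbol and `.code none` the code of
`1`. Blocks of quantified variables stand for a constraint and for a tuple of codes; `extend` turns
such an object into values for a block. -/
theorem pruneF_iff {κ N : ℕ} {R : (r : τ) → Set (Fin (ar r) → ℚ)} {C : τ → Finset ℚ}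
    {Mem : τ → WEnv ar G → Prop} (hMem : ExpressesMem κ R C Mem) (hκ : 2 ≤ κ)
    {w : List (CSP.Letter τ)} (hN : N = κ * (w.length + 1)) {X : Fin 4 → (Var ar G → ℕ) → Prop}
    (hX1 : HasDigits N X)
    (hX2 : ∀ x : Var ar G → ℕ, (∀ v, x v < N) → x (.pos none) < w.length →
      x (.pos (some none)) < w.length → (X 2 x ↔
        CSP.varName w (x (.pos none)) = CSP.varName w (x (.pos (some none)))))
    {S : Set (Fin N × (Comp G → Fin N))} (hX3 : HasRemoved N X S) (x : Var ar G → ℕ)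
    (hx : ∀ v, x v < N) :
    PruneF Mem ⟨N, lettersOf w, X, x⟩ ↔
      ((⟨x (.pos none), hx _⟩ : Fin N), fun k => (⟨x (.code (some none) k), hx _⟩ : Fin N)) ∈
        prune R C w.length (fun q : Fin N => CSP.varName w q) (constraintsOf ar w N) S := by
  have hwN : w.length < N := by rw [hN]; nlinarith
  have hargs : ∀ {r z}, (∀ v, z v < N) → (IsArgsF r (⟨N, lettersOf w, X, z⟩ : WEnv ar G) ↔
      w[z (.pos (some none))]? = some (.rel r) ∧
      CSP.IsArgs w (z (.pos (some none))) fun i => z (.pos (argSlot r i))) := fun hz =>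
    isArgsF_iff (e := ⟨N, lettersOf w, X, _⟩) hz rfl _
  have hone : ∀ {z}, (∀ v, z v < N) → (IsOneF (⟨N, lettersOf w, X, z⟩ : WEnv ar G) ↔
      (fun k => z (.code none k)) = oneCode G w.length) := fun hz =>
    isOneF_iff (e := ⟨N, lettersOf w, X, _⟩) hz rfl hwN
  have hlet : ∀ {z v}, HasLetter v (⟨N, lettersOf w, X, z⟩ : WEnv ar G) ↔ z v < w.length :=
    hasLetter_iff (e := ⟨N, lettersOf w, X, _⟩) rfl _
  have hval : ∀ {z}, (fun k => z (.code none k)) = oneCode G w.length → ∀ o,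
      (IsValidF o (⟨N, lettersOf w, X, z⟩ : WEnv ar G) ↔
        IsValid w.length fun k => z (.code o k)) := fun hz o =>
    isValidF_iff (e := ⟨N, lettersOf w, X, _⟩) hz o
  have hexc : ∀ {r j z} (hz : ∀ v, z v < N), (fun k => z (.code none k)) = oneCode G w.length →
      (Excluded Mem r j ⟨N, lettersOf w, X, z⟩ ↔
        ((∀ i, IsValid w.length fun k => z (.code (argSlot r i) k)) →
          (∀ k, z (.code (argSlot r j) k) = z (.code (some none) k)) →
          MemCode (C r) (R r) (fun o : Option (Fin (ar r)) => o.elim (oneCode G w.length) fun i k =>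
            z (.code (argSlot r i) k)) →
          ∃ i, ((⟨z (.pos (argSlot r i)), hz _⟩ : Fin N),
            fun k => (⟨z (.code (argSlot r i) k), hz _⟩ : Fin N)) ∈ S)) := by
    intro r j z hz h1
    unfold Excluded
    simp only [hval h1]
    refine forall_congr' fun hv => forall_congr' fun _ => ?_
    have hcode : (fun o => codeOf (⟨N, lettersOf w, X, z⟩ : WEnv ar G) (slotOf r o)) =
        fun o : Option (Fin (ar r)) => o.elim (oneCode G w.length) fun i k =>
          z (.code (argSlot r i) k) := by
      funext o
      rcases o with _ | i
      · exact h1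
      · rfl
    rw [hMem r ⟨N, lettersOf w, X, z⟩ w.length hz hN hX1, hcode]
    · refine forall_congr' fun _ => exists_congr fun i => ?_
      exact hX3 (z ∘ argSubst r i) fun v => hz _
    · intro o
      rw [congrFun hcode o]
      rcases o with _ | i
      · exact fun j => Nat.zero_le _
      · exact hv i
  have hsame : ∀ {r j z}, (∀ v, z v < N) → z (.pos none) < w.length →
      z (.pos (argSlot r j)) < w.length →
      (X 2 (z ∘ update id (.pos (some none)) (.pos (argSlot r j))) ↔
        CSP.varName w (z (.pos none)) = CSP.varName w (z (.pos (argSlot r j)))) := by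
    intro r j z hz h1 h2
    rw [hX2 (z ∘ update id (.pos (some none)) (.pos (argSlot r j))) fun v => hz _]
    · simp
    · simpa using h1
    · simpa using h2
  unfold PruneF prune
  refine or_congr (hX3 x hx) ?_
  constructor
  · rintro ⟨r, j, z, hz, hzx, h1, h2, h3, h4, h5⟩
    simp only [Env.withVars, hargs hz, hone hz, hlet] at h1 h2 h3 h4
    have hz0 : z (.pos none) = x (.pos none) := hzx _ (pos_notMem_argVars r)
    have hzc : ∀ k, z (.code (some none) k) = x (.code (some none) k) := fun k =>
      hzx _ (code_notMem_argVars r _ k)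
    have hc : (⟨r, fun i => ⟨z (.pos (argSlot r i)), hz _⟩⟩ : Σ r : τ, Fin (ar r) → Fin N) ∈
        constraintsOf ar w N := ⟨_, h1.1, h1.2⟩
    refine ⟨hz0.symm.trans_lt h3, _, hc, j, ?_, fun t ht htj htm => ?_⟩
    · have := (hsame hz h3 (lt_length_of_mem_constraintsOf hc j)).1 h4
      rw [hz0] at this
      exact this
    · set z' := extend (codeVars r) (fun i => (t i.1 i.2).val) z with hz'
      have e1 : ∀ i k, z' (.code (argSlot r i) k) = t i k := fun i k =>
        (codeVars_injective r).extend_apply _ _ (i, k)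
      have e2 : ∀ v ∉ Set.range (codeVars r), z' v = z v := fun v hv =>
        extend_apply' _ _ _ hv
      have hz'N : ∀ v, z' v < N := by
        intro v
        by_cases hv : v ∈ Set.range (codeVars r)
        · obtain ⟨⟨i, k⟩, rfl⟩ := hv
          rw [show z' (codeVars r (i, k)) = t i k from e1 i k]
          exact (t i k).2
        · rw [e2 v hv]
          exact hz v
      have h6 := (hexc hz'N (by
        rw [← h2]
        exact funext fun k => e2 _ (code_none_notMem_codeVars r k))).1 (h5 z' hz'N e2)
      simp only [e1, e2 _ (code_some_none_notMem_codeVars r _), e2 _ (pos_notMem_codeVars r _),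
        hzc] at h6
      exact h6 ht (fun k => by rw [htj]) htm
  · rintro ⟨h3, ⟨r, q⟩, ⟨p, h1⟩, j, h4, h5⟩
    dsimp only at h3 h1 h4 h5 j
    have hpN : p < N := (List.getElem?_eq_some_iff.1 h1.1).1.trans hwN
    have hq : ∀ i, (q i).val < w.length :=
      lt_length_of_mem_constraintsOf (c := ⟨r, q⟩) ⟨p, h1⟩
    set z := extend (argVars r) (Sum.elim (fun o => o.elim p fun i => (q i).val)
      (oneCode G w.length)) x with hz
    have e1 : z (.pos (some none)) = p := (argVars_injective r).extend_apply _ _ (.inl none)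
    have e2 : ∀ i, z (.pos (argSlot r i)) = q i := fun i =>
      (argVars_injective r).extend_apply _ _ (.inl (some i))
    have e3 : (fun k => z (.code none k)) = oneCode G w.length := funext fun k =>
      (argVars_injective r).extend_apply _ _ (.inr k)
    have e4 : ∀ v ∉ Set.range (argVars r), z v = x v := fun v hv => extend_apply' _ _ _ hv
    have e5 := e4 _ (pos_notMem_argVars r)
    have hzN : ∀ v, z v < N := by
      intro v
      by_cases hv : v ∈ Set.range (argVars r)
      · obtain ⟨(_ | i) | k, rfl⟩ := hv
        · exact e1.trans_lt hpN
        · exact (e2 i).trans_lt (q i).2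
        · refine (congrFun e3 k).trans_lt ?_
          rcases k with _ | _ | k
          · change 1 < N; rw [hN]; nlinarith
          · exact hwN
          · change 0 < N; omega
      · rw [e4 v hv]
        exact hx v
    refine ⟨r, j, z, hzN, e4, ?_, ?_, ?_, ?_, fun z' hz'N hz' => ?_⟩
    · refine (hargs hzN).2 ?_
      simp only [e1, e2]
      exact h1
    · exact (hone hzN).2 e3
    · exact hlet.2 (by rw [e5]; exact h3)
    · refine (hsame hzN (by rw [e5]; exact h3) (by rw [e2]; exact hq j)).2 ?_
      rw [e5, e2]
      exact h4
    · simp only [Env.withVars] at hz'N hz'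
      have e6 : ∀ k, z' (.code (some none) k) = x (.code (some none) k) := fun k =>
        (hz' _ (code_some_none_notMem_codeVars r k)).trans (e4 _ (code_notMem_argVars r _ k))
      refine (hexc hz'N ((funext fun k => hz' _ (code_none_notMem_codeVars r k)).trans e3)).2
        fun hv hj hm => ?_
      obtain ⟨i, hi⟩ := h5 (fun i k => ⟨z' (.code (argSlot r i) k), hz'N _⟩) hv
        (funext fun k => Fin.ext ((hj k).trans (e6 k))) hm
      refine ⟨i, ?_⟩
      have e7 : (⟨z' (.pos (argSlot r i)), hz'N _⟩ : Fin N) = q i := Fin.ext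
        ((hz' _ (pos_notMem_codeVars r _)).trans (e2 i))
      rw [e7]
      exact hi

end Formulas

end PLH

/-! ### The polynomial-time algorithm -/

open Function Classical

/-- Run a program `N ^ k` times, if loops have `N` iterations. -/
def TabProg.repPow {A I V : Type} (p : TabProg A I V) : ℕ → TabProg A I V
  | 0 => p
  | k + 1 => .rep (repPow p k)

theorem TabProg.den_repPow {A I V : Type} (N : ℕ) (L : A → ℕ → Prop) (p : TabProg A I V) (k : ℕ) :
    (p.repPow k).den N L = (p.den N L)^[N ^ k] := by
  induction k with
  | zero => rfl
  | succ k ih =>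
    funext X
    rw [repPow, den, ih, ← iterate_mul, pow_succ]

namespace PLH

section Formulas

variable {τ : Type} {ar : τ → ℕ} {G : Finset ℚ}

/-- The rounds assign only to table `3`, so the tables of digits and of equal names stay valid and
`pruneF_iff` applies in each round. -/
theorem HasRemoved.iterate [Finite τ] {κ N : ℕ} {R : (r : τ) → Set (Fin (ar r) → ℚ)}
    {C : τ → Finset ℚ} {Mem : τ → WEnv ar G → Prop} (hMem : ExpressesMem κ R C Mem)
    (hMem' : ∀ r, Dfn (Mem r)) (hκ : 2 ≤ κ)
    {w : List (CSP.Letter τ)} (hN : N = κ * (w.length + 1)) {X : Fin 4 → (Var ar G → ℕ) → Prop}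
    (hX1 : HasDigits N X)
    (hX2 : ∀ x : Var ar G → ℕ, (∀ v, x v < N) → x (.pos none) < w.length →
      x (.pos (some none)) < w.length → (X 2 x ↔
        CSP.varName w (x (.pos none)) = CSP.varName w (x (.pos (some none)))))
    (hX3 : X 3 = fun _ => False) (m : ℕ) :
    HasRemoved N (((TabProg.assign 3 (dfn_pruneF hMem').fml).den N (lettersOf w))^[m] X)
      ((prune R C w.length (fun q : Fin N => CSP.varName w q) (constraintsOf ar w N))^[m] ∅) := by
  set p := (TabProg.assign 3 (dfn_pruneF hMem').fml).den N (lettersOf w)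
  have key : ∀ m, (∀ i ≠ 3, p^[m] X i = X i) ∧ HasRemoved N (p^[m] X)
      ((prune R C w.length (fun q : Fin N => CSP.varName w q) (constraintsOf ar w N))^[m] ∅) := by
    intro m
    induction m with
    | zero =>
      refine ⟨fun _ _ => rfl, fun x hx => ?_⟩
      rw [iterate_zero, iterate_zero, id, id, hX3]
      simp
    | succ m ih =>
      rw [iterate_succ_apply', iterate_succ_apply']
      refine ⟨fun i hi => (TabProg.den_assign_of_ne hi _ _).trans (ih.1 i hi), fun x hx => ?_⟩
      refine (TabProg.den_assign_self (dfn_pruneF hMem') _ hx).trans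
        (pruneF_iff hMem hκ hN ?_ ?_ ih.2 x hx)
      · intro x hx
        rw [ih.1 1 (by decide)]
        exact hX1 x hx
      · intro x hx
        rw [ih.1 2 (by decide)]
        exact hX2 x hx
  exact (key m).2

/-- Some code for the argument `j` is not removed. -/
def NotEmptied (r : τ) (j : Fin (ar r)) (e : WEnv ar G) : Prop :=
  ∃ z : Var ar G → ℕ, (∀ v, z v < e.N) ∧ (∀ v ∉ Set.range (Var.code (some none)), z v = e.x v) ∧
    (fun e : WEnv ar G => IsValidF (some none) e ∧
      ¬e.X 3 (e.x ∘ update id (.pos none) (.pos (argSlot r j)))) (e.withVars z)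

/-- Arc consistency does not refute the instance. -/
def AcceptF (R : (r : τ) → Set (Fin (ar r) → ℚ)) (e : WEnv ar G) : Prop :=
  ∀ r : τ, ∀ z : Var ar G → ℕ, (∀ v, z v < e.N) → (∀ v ∉ Set.range (argVars r), z v = e.x v) →
    (fun e : WEnv ar G => IsArgsF r e → IsOneF e → (ar r = 0 → (R r).Nonempty) ∧
      ∀ j, NotEmptied r j e) (e.withVars z)

theorem dfn_acceptF [Finite τ] (R : (r : τ) → Set (Fin (ar r) → ℚ)) :
    Dfn (AcceptF (G := G) R) := by
  have h1 : ∀ (r : τ) (j : Fin (ar r)), Dfn (NotEmptied (G := G) r j) := fun r j =>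
    Dfn.exsRange _ ((dfn_isValidF _).and (Dfn.tab _ _).not)
  exact Dfn.forall_finite fun r => Dfn.allsRange _ ((dfn_isArgsF r).imp (dfn_isOneF.imp
    ((Dfn.const _).and (Dfn.forall_finite fun j => h1 r j))))

theorem acceptF_iff {κ N : ℕ} (R : (r : τ) → Set (Fin (ar r) → ℚ)) (hκ : 2 ≤ κ)
    {w : List (CSP.Letter τ)} (hN : N = κ * (w.length + 1)) {X : Fin 4 → (Var ar G → ℕ) → Prop}
    {S : Set (Fin N × (Comp G → Fin N))} (hX3 : HasRemoved N X S) (x : Var ar G → ℕ)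
    (hx : ∀ v, x v < N) :
    AcceptF R ⟨N, lettersOf w, X, x⟩ ↔ ∀ c ∈ constraintsOf ar w N,
      (ar c.1 = 0 → (R c.1).Nonempty) ∧ ∀ j, ∃ s : Comp G → Fin N,
        IsValid w.length (fun k => (s k).val) ∧ (c.2 j, s) ∉ S := by
  have hwN : w.length < N := by rw [hN]; nlinarith
  have hargs : ∀ {r z}, (∀ v, z v < N) → (IsArgsF r (⟨N, lettersOf w, X, z⟩ : WEnv ar G) ↔
      w[z (.pos (some none))]? = some (.rel r) ∧
      CSP.IsArgs w (z (.pos (some none))) fun i => z (.pos (argSlot r i))) := fun hz =>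
    isArgsF_iff (e := ⟨N, lettersOf w, X, _⟩) hz rfl _
  have hone : ∀ {z}, (∀ v, z v < N) → (IsOneF (⟨N, lettersOf w, X, z⟩ : WEnv ar G) ↔
      (fun k => z (.code none k)) = oneCode G w.length) := fun hz =>
    isOneF_iff (e := ⟨N, lettersOf w, X, _⟩) hz rfl hwN
  have hval : ∀ {z}, (fun k => z (.code none k)) = oneCode G w.length → ∀ o,
      (IsValidF o (⟨N, lettersOf w, X, z⟩ : WEnv ar G) ↔
        IsValid w.length fun k => z (.code o k)) := fun hz o =>
    isValidF_iff (e := ⟨N, lettersOf w, X, _⟩) hz o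
  have hpos : ∀ o, Var.pos o ∉ Set.range (Var.code (ar := ar) (G := G) (some none)) := by
    rintro o ⟨k, h⟩
    cases h
  have hcode : ∀ k, Var.code none k ∉ Set.range (Var.code (ar := ar) (G := G) (some none)) := by
    rintro k ⟨k', h⟩
    simp at h
  have hinj : Injective (Var.code (ar := ar) (G := G) (some none)) := fun k k' h => by
    simpa using h
  have hne : ∀ {r j z} (hz : ∀ v, z v < N), (fun k => z (.code none k)) = oneCode G w.length →
      (NotEmptied r j (⟨N, lettersOf w, X, z⟩ : WEnv ar G) ↔ ∃ s : Comp G → Fin N,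
        IsValid w.length (fun k => (s k).val) ∧
          ((⟨z (.pos (argSlot r j)), hz _⟩ : Fin N), s) ∉ S) := by
    intro r j z hz h1
    constructor
    · rintro ⟨z', hz'N, hz', h2, h3⟩
      simp only [Env.withVars] at h2 h3 hz'N hz'
      rw [hval ((funext fun k => hz' _ (hcode k)).trans h1)] at h2
      refine ⟨fun k => ⟨z' (.code (some none) k), hz'N _⟩, h2, fun h4 => h3 ?_⟩
      refine (hX3 _ fun v => hz'N _).2 ?_
      convert h4 using 2
      · refine Fin.ext ?_
        simp only [update_self]
        exact hz' _ (hpos _)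
      · funext k
        exact Fin.ext (by simp)
    · rintro ⟨s, hs, h2⟩
      set z' := extend (Var.code (some none)) (fun k => (s k).val) z with hz'
      have e1 : ∀ k, z' (.code (some none) k) = s k := fun k => hinj.extend_apply _ _ k
      have e2 : ∀ v ∉ Set.range (Var.code (some none)), z' v = z v := fun v hv =>
        extend_apply' _ _ _ hv
      have hz'N : ∀ v, z' v < N := by
        intro v
        by_cases hv : v ∈ Set.range (Var.code (some none))
        · obtain ⟨k, rfl⟩ := hv
          rw [e1]
          exact (s k).2
        · rw [e2 v hv]
          exact hz v
      refine ⟨z', hz'N, e2, (hval ((funext fun k => e2 _ (hcode k)).trans h1) _).2 ?_, fun h3 => ?_⟩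
      · simpa only [e1] using hs
      · refine h2 ?_
        have h4 := (hX3 _ fun v => hz'N _).1 h3
        convert h4 using 2
        · refine Fin.ext ?_
          simp only [update_self]
          exact (e2 _ (hpos _)).symm
        · funext k
          exact Fin.ext (by simp [e1])
  constructor
  · rintro h ⟨r, q⟩ ⟨p, h1⟩
    dsimp only at h1 ⊢
    have hpN : p < N := (List.getElem?_eq_some_iff.1 h1.1).1.trans hwN
    set z := extend (argVars r) (Sum.elim (fun o => o.elim p fun i => (q i).val)
      (oneCode G w.length)) x with hz
    have e1 : z (.pos (some none)) = p := (argVars_injective r).extend_apply _ _ (.inl none)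
    have e2 : ∀ i, z (.pos (argSlot r i)) = q i := fun i =>
      (argVars_injective r).extend_apply _ _ (.inl (some i))
    have e3 : (fun k => z (.code none k)) = oneCode G w.length := funext fun k =>
      (argVars_injective r).extend_apply _ _ (.inr k)
    have e4 : ∀ v ∉ Set.range (argVars r), z v = x v := fun v hv => extend_apply' _ _ _ hv
    have hzN : ∀ v, z v < N := by
      intro v
      by_cases hv : v ∈ Set.range (argVars r)
      · obtain ⟨(_ | i) | k, rfl⟩ := hv
        · exact e1.trans_lt hpN
        · exact (e2 i).trans_lt (q i).2
        · refine (congrFun e3 k).trans_lt ?_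
          rcases k with _ | _ | k
          · change 1 < N; rw [hN]; nlinarith
          · exact hwN
          · change 0 < N; omega
      · rw [e4 v hv]
        exact hx v
    obtain ⟨h2, h3⟩ := h r z hzN e4 ((hargs hzN).2 (by simp only [e1, e2]; exact h1))
      ((hone hzN).2 e3)
    refine ⟨h2, fun j => ?_⟩
    obtain ⟨s, hs, h4⟩ := (hne hzN e3).1 (h3 j)
    refine ⟨s, hs, ?_⟩
    have e5 : (⟨z (.pos (argSlot r j)), hzN _⟩ : Fin N) = q j := Fin.ext (e2 j)
    rwa [e5] at h4
  · intro h r z hz _ h1 h2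
    simp only [Env.withVars] at hz h1 h2 ⊢
    rw [hargs hz] at h1
    rw [hone hz] at h2
    obtain ⟨h3, h4⟩ := h ⟨r, fun i => ⟨z (.pos (argSlot r i)), hz _⟩⟩ ⟨_, h1⟩
    exact ⟨h3, fun j => (hne hz h2).2 (h4 j)⟩

/-- Signs are part of the codes, so absolute values suffice. Inverses are added so that inequalities
can be turned around. -/
theorem exists_coefficients [Finite τ] (C : τ → Finset ℚ) :
    ∃ G : Finset ℚ, (∀ g ∈ G, 0 < g) ∧ 1 ∈ G ∧ (∀ g ∈ G, g⁻¹ ∈ G) ∧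
      ∀ r, ∀ c ∈ C r, c ≠ 0 → |c| ∈ G := by
  have := Fintype.ofFinite τ
  set B : Finset ℚ := insert 1 (((Finset.univ.biUnion C).erase 0).image (|·|)) with hB
  have hpos : ∀ g ∈ B, 0 < g := by
    intro g hg
    rcases Finset.mem_insert.1 hg with rfl | hg
    · exact one_pos
    · obtain ⟨c, hc, rfl⟩ := Finset.mem_image.1 hg
      exact abs_pos.2 (Finset.ne_of_mem_erase hc)
  refine ⟨B ∪ B.image (·⁻¹), fun g hg => ?_, by simp [hB], fun g hg => ?_, fun r c hc h0 => ?_⟩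
  · rcases Finset.mem_union.1 hg with hg | hg
    · exact hpos g hg
    · obtain ⟨c, hc, rfl⟩ := Finset.mem_image.1 hg
      exact inv_pos.2 (hpos c hc)
  · rcases Finset.mem_union.1 hg with hg | hg
    · exact Finset.mem_union_right _ (Finset.mem_image_of_mem _ hg)
    · obtain ⟨c, hc, rfl⟩ := Finset.mem_image.1 hg
      rw [inv_inv]
      exact Finset.mem_union_left _ hc
  · refine Finset.mem_union_left _ (Finset.mem_insert_of_mem (Finset.mem_image_of_mem _ ?_))
    exact Finset.mem_erase.2 ⟨h0, Finset.mem_biUnion.2 ⟨r, Finset.mem_univ r, hc⟩⟩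

end Formulas

end PLH

open PLH in
theorem mainTheorem3 {τ : Type} [Finite τ] (ar : τ → ℕ) (R : (r : τ) → Set (Fin (ar r) → ℚ))
    (hPLH : ∀ r, PLH.IsPLH (R r)) (hmax : ∀ r, PLH.MaxClosed (R r)) :
    PolyTimeDecidable (CSP.Instance.encode (ar := ar)) (CSP.Instance.Feasible R) := by
  choose C hR using fun r => (hPLH r).exists_mem_iff
  obtain ⟨G, hG, hG1, hGi, hC⟩ := exists_coefficients C
  -- The product makes `N` digits enough for all the integers that are compared; the summand `3`
  -- yields `2 * w.length + 3 ≤ N`, which gives room for all sample codes.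
  set κ := ∏ t, base G t + 3 with hκ
  choose Mem hMemD hMem using fun r => exists_dfn_memCode (A := CSP.Letter τ) hG hGi
    (show ∏ t, base G t < κ by omega) (by omega) r (R r) (hC r)
  have := Fintype.ofFinite (Var ar G)
  -- The tables `0` to `3` hold the carries, the digits, the pairs of positions with equal names and
  -- the removed codes. The number of rounds is the number of pairs of a position and a code with
  -- all entries below `N`.
  refine TabProg.polyTimeDecidable (V := Var ar G) (I := Fin 4) CSP.Instance.encode _ κ (by omega)
    (.seq (TabProg.digitsProg digitVar 0 1 digitVar_injective (base G))
      (.seq sameProg ((TabProg.assign 3 (dfn_pruneF hMemD).fml).repPow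
        (Fintype.card (Comp G) + 1))))
    (dfn_acceptF R).fml fun I => ?_
  set w := I.encode with hw
  set N := κ * (w.length + 1) with hN
  have hN3 : 2 * w.length + 3 ≤ N := by
    have : 3 * (w.length + 1) ≤ N := Nat.mul_le_mul_right _ (by omega)
    omega
  have hbase : ∀ t, base G t ≤ N := by
    intro t
    have h1 : base G t ≤ ∏ t, base G t := Nat.le_of_dvd
      (Finset.prod_pos fun t _ => base_pos hG t) (Finset.dvd_prod_of_mem _ (Finset.mem_univ t))
    have h2 : κ * 1 ≤ N := Nat.mul_le_mul_left _ (by omega)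
    omega
  rw [Dfn.sat_fml _ fun _ => by change 0 < N; omega]
  obtain ⟨h1, h2⟩ := TabProg.den_digitsProg (I := Fin 4) (digitVar (ar := ar)) 0 1 digitVar_injective
    (by decide) (L := lettersOf w) (base_pos hG) hbase fun _ _ => False
  set X₁ := (TabProg.digitsProg (I := Fin 4) (digitVar (ar := ar)) 0 1 digitVar_injective (base G)).den N
    (lettersOf w) fun _ _ => False
  obtain ⟨h3, h4⟩ := den_sameProg (ar := ar) (G := G) (w := w) (N := N) (by omega) X₁ (h1 2 (by decide) (by decide))
  set X₂ := (sameProg (ar := ar) (G := G)).den N (lettersOf w) X₁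
  have h5 := HasRemoved.iterate (X := X₂) hMem hMemD (by omega) hN
    (fun x hx => by rw [h3 1 (by decide)]; exact h2 x hx) h4
    ((h3 3 (by decide)).trans (h1 3 (by decide) (by decide))) (N ^ (Fintype.card (Comp G) + 1))
  rw [← TabProg.den_repPow] at h5
  refine (acceptF_iff R (by omega) hN h5 0 fun _ => by change 0 < N; omega).trans ?_
  have hcard : Nat.card (Fin N × (Comp G → Fin N)) ≤ N ^ (Fintype.card (Comp G) + 1) := by
    rw [Nat.card_eq_fintype_card, Fintype.card_prod, Fintype.card_fun, Fintype.card_fin, pow_succ,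
      mul_comm]
  rw [prune_correct hG hG1 hGi hmax hC hR hN3 _ (fun c hc j => lt_length_of_mem_constraintsOf hc j)
    hcard, CSP.Instance.feasible_iff]
  refine exists_congr fun u => ⟨fun h r p q hp hq => ?_, fun h c hc => ?_⟩
  · have hqN : ∀ i, q i < N := fun i => by
      have : q i < w.length := (List.getElem?_eq_some_iff.1 (hq i).2.1).1
      omega
    exact h ⟨r, fun i => ⟨q i, hqN i⟩⟩ ⟨p, hp, hq⟩
  · obtain ⟨p, hp, hq⟩ := hc
    exact h c.1 p _ hp hq
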